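/- **Theorem 2 (Beurling estimate).** For $\alpha\ge 0$ and $x_1,\dots,x_n\in\mathbb R^2$ let $$E(x)=\sum_{j=1}^n \frac1{\|x-x_j\|^{\alpha}}\quad(\alpha>0),\qquad E(x)=\sum_{j=1}^n\log\frac1{\|x-x_j\|}\quad(\alpha=0),$$ for $x\in\mathbb R^2\setminus\{x_1,\dots,x_n\}$. We say that $\{x_1,\dots,x_n\}$ has property (P) if $E$ has finitely many critical points. The points $x_1,\dots,x_n$ are the particles of an aggregate: $\|x_j-x_k\|\ge 1$ for $j\ne k$, and each $x_k$ with $k\ge 2$ has distance exactly $1$ from some $x_j$ with $j<k$ (as is the case for particles produced by Gradient Flow Aggregation). For $r>0$ let $p_i(r)$ be the probability that the gradient ascent flow $\dot\gamma=\nabla E(\gamma)$, started at a uniformly random point of the circle $\|x\|=r$, attaches to $x_i$, i.e. reaches distance $1$ from $x_i$ at some time before which it has had distance greater than $1$ from all of $x_1,\dots,x_n$, its distance from every one of them being still at least $1$ at that time. The probability that the next particle attaches to $x_i$ is $$\mathbb P(\text{new particle hits }x_i)=\lim_{r\to\infty}p_i(r).$$ Let $0\le\alpha\le1$. There is a constant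 $c_\alpha>0$ depending only on $\alpha$ such that for every $n\ge 1$ and every aggregate $\{x_1,\dots,x_n\}\subset\mathbb R^2$ with property (P) these limits exist and $$\max_{1\le i\le n}\mathbb P(\text{new particle hits }x_i)\le c_\alpha\, n^{\frac{\alpha-1}{2\alpha+2}}.$$ For $\alpha=0$ the resulting rate $n^{-1/2}$ is optimal: there is a constant $c>0$ such that for every $n\ge1$ there is an aggregate $\{x_1,\dots,x_n\}\subset\mathbb R^2$ with property (P) for $\alpha=0$ and an index $i$ for which the limit exists and $\mathbb P(\text{new particle hits }x_i)\ge c\,n^{-1/2}$. -/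

import Mathlib

noncomputable section

namespace GFA

/-- The Euclidean plane. -/
abbrev Plane : Type := EuclideanSpace ℝ (Fin 2)

/-- The energy generated by the particles `x`: `∑ j, 1 / ‖y - x j‖ ^ α` if `α ≠ 0`, and the
logarithmic energy `∑ j, log (1 / ‖y - x j‖)` if `α = 0`. -/
def energy (α : ℝ) {n : ℕ} (x : Fin n → Plane) (y : Plane) : ℝ :=
  if α = 0 then ∑ j, Real.log (1 / ‖y - x j‖) else ∑ j, 1 / ‖y - x j‖ ^ α

/-- The critical points of the energy, in its domain (the plane without the particles). -/
def criticalPoints (α : ℝ) {n : ℕ} (x : Fin n → Plane) : Set Plane :=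
  {y | (∀ j, y ≠ x j) ∧ gradient (energy α x) y = 0}

/-- Property (P): the energy has finitely many critical points. -/
def PropertyP (α : ℝ) {n : ℕ} (x : Fin n → Plane) : Prop :=
  (criticalPoints α x).Finite

/-- An aggregate of disks of radius `1 / 2` with centers `x 0, x 1, …`: the disks do not overlap
(distinct centers have distance at least `1`), and every particle after the first one touches
(has distance exactly `1` from) a particle that was there before it. -/
structure IsAggregate {n : ℕ} (x : Fin n → Plane) : Prop where
  separated : ∀ j k, j ≠ k → 1 ≤ dist (x j) (x k)
  attached : ∀ k : Fin n, 0 < (k : ℕ) → ∃ j < k, dist (x k) (x j) = 1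

/-- The gradient ascent flow started at `y` attaches to `x i`: it reaches distance `1` from `x i`
at some time `T`, and before that it has distance more than `1` from all the particles. -/
def AttachesTo (α : ℝ) {n : ℕ} (x : Fin n → Plane) (i : Fin n) (y : Plane) : Prop :=
  ∃ (T : ℝ) (γ : ℝ → Plane), 0 ≤ T ∧ γ 0 = y ∧
    (∀ t ∈ Set.Icc 0 T,
      HasDerivWithinAt γ (gradient (energy α x) (γ t)) (Set.Icc 0 T) t) ∧
    (∀ t ∈ Set.Ico 0 T, ∀ j, 1 < dist (γ t) (x j)) ∧
    (∀ j, 1 ≤ dist (γ T) (x j)) ∧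
    dist (γ T) (x i) = 1

/-- The point at distance `r` from the origin in the direction with angle `θ`. -/
def circlePoint (r θ : ℝ) : Plane := !₂[r * Real.cos θ, r * Real.sin θ]

/-- The probability that the flow attaches to `x i` if it is started at a uniformly distributed
random point of the circle with radius `r` around the origin. -/
def attachProbFrom (α : ℝ) {n : ℕ} (x : Fin n → Plane) (i : Fin n) (r : ℝ) : ℝ :=
  (MeasureTheory.volume {θ : ℝ | θ ∈ Set.Ico 0 (2 * Real.pi) ∧
    AttachesTo α x i (circlePoint r θ)}).toReal / (2 * Real.pi)

/-- The new particle, coming from a uniformly random direction at infinity, attaches to `x i` with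
probability `p`: the limit as `r → ∞` of the probabilities `attachProbFrom α x i r` exists and
equals `p`. -/
def HasAttachProb (α : ℝ) {n : ℕ} (x : Fin n → Plane) (i : Fin n) (p : ℝ) : Prop :=
  Filter.Tendsto (attachProbFrom α x i) Filter.atTop (nhds p)

end GFA

end

/-! Attachment depends only on the trajectories, so the gradient may be replaced by `drift`, its
quotient by a positive multiple of `weightSum`. By Cauchy–Schwarz the divergence of `drift` is
nonnegative (`trace_fderiv_drift_nonneg`), so its flow never shrinks areas
(`volume_le_volume_flow_image`). Its speed is at most 1 outside the unit discs, and at most `M`, a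
multiple of `n ^ ((α - 1) / 2)`, near a particle (`norm_drift_le_of_dist_le_two`). Far away it pulls
inwards so that the squared norm falls at least at unit rate (`inner_drift_le`).

Upper bound: points hitting `x i` at a time in `[k, k + 1]` lie at time `k` in an annulus of width
`M` around its unit disc, so they fill an area of order `M`; those hitting by time `T` fill an area
of order `M T` (`volume_reachesIn_le`). If the probability is `p`, a portion of order `p R²` of the
disc of radius `R` hits within time about `R²`. Hence `p` is at most of order `M`, which is at least
as strong as the claimed rate.

Limit: as a function of `u = 1 / ‖y‖` the angle of a trajectory solves an equation that is smooth up
to `u = 0`, so the flow identifies large circles almost isometrically (`exists_angle_transport`),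
and the probabilities are Cauchy in the radius.

Optimality: starting points of an annulus that never come close to a particle form a wandering set
of an area-nondecreasing flow in a bounded region, hence a null set; so the probabilities sum to at
least 1 (`one_le_sum_of_hasAttachProb`). In a square block of lattice points only the boundary
particles, of order `√n` many, can be hit. For `α = 0` the critical points are roots of the
derivative of a complex polynomial, so property (P) is automatic. -/

open Set Filter Topology MeasureTheory
open scoped NNReal ENNReal

namespace GFA

/-! ### Ordinary differential equations: Grönwall, global flows, change of time. -/

section ODE

variable {E : Type*} [NormedAddCommGroup E] [NormedSpace ℝ E]

theorem dist_le_of_integralCurves_forward {v : ℝ → E → E} {K : ℝ≥0} {a b : ℝ} {f g : ℝ → E}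
    (hv : ∀ t ∈ Icc a b, LipschitzWith K (v t))
    (hf : ∀ t ∈ Icc a b, HasDerivWithinAt f (v t (f t)) (Icc a b) t)
    (hg : ∀ t ∈ Icc a b, HasDerivWithinAt g (v t (g t)) (Icc a b) t) {s t : ℝ}
    (hs : s ∈ Icc a b) (ht : t ∈ Icc a b) (hst : s ≤ t) :
    dist (f t) (g t) ≤ dist (f s) (g s) * Real.exp (K * (t - s)) := by
  have sub : Icc s t ⊆ Icc a b := Icc_subset_Icc hs.1 ht.2
  have right : ∀ {h : ℝ → E}, (∀ t ∈ Icc a b, HasDerivWithinAt h (v t (h t)) (Icc a b) t) →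
      ∀ u ∈ Ico s t, HasDerivWithinAt h (v u (h u)) (Ici u) u := by
    intro h hh u hu
    refine (hh u (sub ⟨hu.1, hu.2.le⟩)).mono_of_mem_nhdsWithin ?_
    exact Icc_mem_nhdsGE_of_mem ⟨hs.1.trans hu.1, hu.2.trans_le ht.2⟩
  refine dist_le_of_trajectories_ODE_of_mem (s := fun _ => univ) (v := v)
    (fun u hu => (hv u (sub ⟨hu.1, hu.2.le⟩)).lipschitzOnWith)
    (fun u hu => ((hf u (sub hu)).continuousWithinAt).mono sub) (right hf) (fun _ _ => mem_univ _)
    (fun u hu => ((hg u (sub hu)).continuousWithinAt).mono sub) (right hg) (fun _ _ => mem_univ _)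
    le_rfl t ⟨hst, le_rfl⟩

/-- Grönwall's inequality, forward or backward in time. -/
theorem dist_le_of_integralCurves {v : ℝ → E → E} {K : ℝ≥0} {a b : ℝ} {f g : ℝ → E}
    (hv : ∀ t ∈ Icc a b, LipschitzWith K (v t))
    (hf : ∀ t ∈ Icc a b, HasDerivWithinAt f (v t (f t)) (Icc a b) t)
    (hg : ∀ t ∈ Icc a b, HasDerivWithinAt g (v t (g t)) (Icc a b) t) {s t : ℝ}
    (hs : s ∈ Icc a b) (ht : t ∈ Icc a b) :
    dist (f t) (g t) ≤ dist (f s) (g s) * Real.exp (K * |t - s|) := by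
  rcases le_total s t with hst | hts
  · rw [abs_of_nonneg (sub_nonneg.2 hst)]
    exact dist_le_of_integralCurves_forward hv hf hg hs ht hst
  -- Reflecting time turns both curves into integral curves of the negated field, which has the same
  -- Lipschitz constant.
  · have refl : ∀ {h : ℝ → E}, (∀ t ∈ Icc a b, HasDerivWithinAt h (v t (h t)) (Icc a b) t) →
        ∀ u ∈ Icc (-b) (-a), HasDerivWithinAt (fun r => h (-r)) (-(v (-u) (h (-u))))
          (Icc (-b) (-a)) u := by
      intro h hh u hu
      have hm : MapsTo (fun r : ℝ => -r) (Icc (-b) (-a)) (Icc a b) := fun r hr =>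
        ⟨by linarith [hr.2], by linarith [hr.1]⟩
      simpa using! (hh (-u) (hm hu)).scomp u (hasDerivAt_neg u).hasDerivWithinAt hm
    have key := dist_le_of_integralCurves_forward (v := fun r y => -(v (-r) y)) (K := K)
      (fun r hr => (hv (-r) ⟨by linarith [hr.2], by linarith [hr.1]⟩).neg) (refl hf) (refl hg)
      (s := -s) (t := -t) ⟨by linarith [hs.2], by linarith [hs.1]⟩
      ⟨by linarith [ht.2], by linarith [ht.1]⟩ (by linarith)
    simp only [neg_neg] at key
    rw [abs_of_nonpos (sub_nonpos.2 hts)]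
    convert key using 3
    ring

theorem eq_of_integralCurves {v : ℝ → E → E} {K : ℝ≥0} {a b : ℝ} {f g : ℝ → E}
    (hv : ∀ t ∈ Icc a b, LipschitzWith K (v t))
    (hf : ∀ t ∈ Icc a b, HasDerivWithinAt f (v t (f t)) (Icc a b) t)
    (hg : ∀ t ∈ Icc a b, HasDerivWithinAt g (v t (g t)) (Icc a b) t) {s t : ℝ}
    (hs : s ∈ Icc a b) (ht : t ∈ Icc a b) (h : f s = g s) : f t = g t := by
  have := dist_le_of_integralCurves hv hf hg hs ht
  rw [h, dist_self, zero_mul] at this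
  exact dist_le_zero.1 this

/-- The global bound `L` lets Picard–Lindelöf work in a ball of radius `L * (b - a)`, which no
solution can leave, so one application covers the whole interval. -/
theorem exists_integralCurve_Icc [CompleteSpace E] {v : ℝ → E → E} {K L : ℝ≥0} {a b t₀ : ℝ}
    (ht₀ : t₀ ∈ Icc a b) (hv : ∀ t ∈ Icc a b, LipschitzWith K (v t))
    (hc : ∀ y, ContinuousOn (fun t => v t y) (Icc a b))
    (hL : ∀ t ∈ Icc a b, ∀ y, ‖v t y‖ ≤ L) (y : E) :
    ∃ f : ℝ → E, f t₀ = y ∧ ∀ t ∈ Icc a b, HasDerivWithinAt f (v t (f t)) (Icc a b) t := by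
  have hab : 0 ≤ b - a := by linarith [ht₀.1, ht₀.2]
  have hp : IsPicardLindelof v (⟨t₀, ht₀⟩ : Icc a b) y (L * (b - a).toNNReal) 0 L K :=
    { lipschitzOnWith := fun t ht => (hv t ht).lipschitzOnWith
      continuousOn := fun z _ => hc z
      norm_le := fun t ht z _ => hL t ht z
      mul_max_le := by
        simp only [NNReal.coe_mul, Real.coe_toNNReal _ hab, NNReal.coe_zero, sub_zero]
        gcongr
        exact max_le (by linarith [ht₀.1]) (by linarith [ht₀.2]) }
  exact hp.exists_eq_forall_mem_Icc_hasDerivWithinAt₀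

/-- `φ` is the flow of the vector field `W`. -/
structure IsFlow (W : E → E) (φ : ℝ → E → E) : Prop where
  zero : ∀ y, φ 0 y = y
  hasDerivAt : ∀ t y, HasDerivAt (fun s => φ s y) (W (φ t y)) t

theorem exists_isFlow [CompleteSpace E] {W : E → E} {K L : ℝ≥0} (hK : LipschitzWith K W)
    (hL : ∀ y, ‖W y‖ ≤ L) : ∃ φ, IsFlow W φ := by
  have ex : ∀ (y : E) (T : ℝ), ∃ f : ℝ → E, 0 ≤ T → f 0 = y ∧
      ∀ t ∈ Icc (-T) T, HasDerivWithinAt f (W (f t)) (Icc (-T) T) t := by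
    intro y T
    by_cases hT : 0 ≤ T
    · obtain ⟨f, hf⟩ := exists_integralCurve_Icc (v := fun _ => W) (a := -T) (b := T) (t₀ := 0)
        ⟨by linarith, hT⟩ (fun _ _ => hK) (fun _ => continuousOn_const) (fun _ _ => hL) y
      exact ⟨f, fun _ => hf⟩
    · exact ⟨fun _ => y, fun h => absurd h hT⟩
  choose f hf using ex
  have agree : ∀ y T T' t, 0 ≤ T → T ≤ T' → t ∈ Icc (-T) T → f y T t = f y T' t := by
    intro y T T' t hT hTT ht
    have sub : Icc (-T) T ⊆ Icc (-T') T' := Icc_subset_Icc (by linarith) hTT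
    refine eq_of_integralCurves (v := fun _ => W) (fun _ _ => hK) (hf y T hT).2
      (fun t ht => ((hf y T' (hT.trans hTT)).2 t (sub ht)).mono sub) (s := 0)
      ⟨by linarith, hT⟩ ht ?_
    rw [(hf y T hT).1, (hf y T' (hT.trans hTT)).1]
  -- The half-length `|t| + 1` puts `t` in the interior of the interval, where the derivative is
  -- two-sided.
  refine ⟨fun t y => f y (|t| + 1) t, fun y => (hf y _ (by positivity)).1, fun t y => ?_⟩
  set T := |t| + 1 with hTdef
  have hT : 0 ≤ T := by positivity
  have htT : |t| < T := by linarith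
  have hmem : t ∈ Icc (-T) T := ⟨(abs_lt.1 htT).1.le, (abs_lt.1 htT).2.le⟩
  have h1 : HasDerivAt (f y T) (W (f y T t)) t :=
    ((hf y T hT).2 t hmem).hasDerivAt (Icc_mem_nhds (abs_lt.1 htT).1 (abs_lt.1 htT).2)
  refine h1.congr_of_eventuallyEq ?_
  filter_upwards [(continuous_abs.tendsto t).eventually (gt_mem_nhds htT)] with s hs
  have hs' : s ∈ Icc (-|s|) |s| := ⟨neg_abs_le s, le_abs_self s⟩
  rcases le_total (|s| + 1) T with h | h
  · exact agree y _ _ s (by positivity) h ⟨by linarith [hs'.1], by linarith [hs'.2]⟩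
  · exact (agree y _ _ s hT h ⟨by linarith [hs'.1], by linarith [hs'.2]⟩).symm

namespace IsFlow

variable {W : E → E} {φ : ℝ → E → E} {K : ℝ≥0}

theorem dist_le (h : IsFlow W φ) (hK : LipschitzWith K W) (t : ℝ) (y z : E) :
    dist (φ t y) (φ t z) ≤ dist y z * Real.exp (K * |t|) := by
  have key := dist_le_of_integralCurves (v := fun _ => W) (a := -|t|) (b := |t|)
    (f := fun s => φ s y) (g := fun s => φ s z) (fun _ _ => hK)
    (fun s _ => (h.hasDerivAt s y).hasDerivWithinAt)
    (fun s _ => (h.hasDerivAt s z).hasDerivWithinAt) (s := 0) (t := t)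
    ⟨by simp, by simp⟩ ⟨neg_abs_le t, le_abs_self t⟩
  simpa [h.zero] using key

theorem eq_of_curve (h : IsFlow W φ) (hK : LipschitzWith K W) {f : ℝ → E} {a b s t : ℝ}
    (hf : ∀ r ∈ Icc a b, HasDerivWithinAt f (W (f r)) (Icc a b) r) (hs : s ∈ Icc a b)
    (ht : t ∈ Icc a b) : f t = φ (t - s) (f s) := by
  refine eq_of_integralCurves (v := fun _ => W) (fun _ _ => hK) hf
    (g := fun r => φ (r - s) (f s)) (fun r _ => ?_) hs ht (by simp [h.zero])
  exact ((h.hasDerivAt (r - s) (f s)).comp_sub_const r s).hasDerivWithinAt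

theorem add (h : IsFlow W φ) (hK : LipschitzWith K W) (s t : ℝ) (y : E) :
    φ (s + t) y = φ t (φ s y) := by
  have := h.eq_of_curve hK (f := fun r => φ r y) (a := min s (s + t)) (b := max s (s + t))
    (s := s) (t := s + t) (fun r _ => (h.hasDerivAt r y).hasDerivWithinAt)
    ⟨min_le_left _ _, le_max_left _ _⟩ ⟨min_le_right _ _, le_max_right _ _⟩
  simpa using this

theorem neg_apply (h : IsFlow W φ) (hK : LipschitzWith K W) (t : ℝ) (y : E) :
    φ (-t) (φ t y) = y := by
  rw [← h.add hK, add_neg_cancel, h.zero]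

theorem continuous_apply (h : IsFlow W φ) (y : E) : Continuous fun t => φ t y :=
  continuous_iff_continuousAt.2 fun t => (h.hasDerivAt t y).continuousAt

theorem lipschitzWith (h : IsFlow W φ) (hK : LipschitzWith K W) (t : ℝ) :
    LipschitzWith (Real.exp (K * |t|)).toNNReal (φ t) := by
  refine LipschitzWith.of_dist_le_mul fun y z => ?_
  rw [Real.coe_toNNReal _ (Real.exp_pos _).le, mul_comm]
  exact h.dist_le hK t y z

theorem continuous (h : IsFlow W φ) (hK : LipschitzWith K W) (t : ℝ) : Continuous (φ t) :=
  (h.lipschitzWith hK t).continuous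

end IsFlow

/-- A curve whose velocity is a positive multiple of `v` can be reparametrised to an integral curve
of `v`. -/
theorem exists_reparam {γ : ℝ → E} {c : ℝ → ℝ} {v : E → E} {T : ℝ} (hT : 0 ≤ T)
    (hc : ContinuousOn c (Icc 0 T)) (hpos : ∀ t ∈ Icc 0 T, 0 < c t)
    (hγ : ∀ t ∈ Icc 0 T, HasDerivWithinAt γ (c t • v (γ t)) (Icc 0 T) t) :
    ∃ S, 0 ≤ S ∧ ∃ σ : ℝ → ℝ, σ 0 = 0 ∧ σ S = T ∧ MapsTo σ (Icc 0 S) (Icc 0 T) ∧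
      MapsTo σ (Ico 0 S) (Ico 0 T) ∧
      ∀ s ∈ Icc 0 S, HasDerivWithinAt (γ ∘ σ) (v (γ (σ s))) (Icc 0 S) s := by
  -- The new time is `τ t = ∫₀ᵗ c`. Extending `c` by its end values keeps it at least `m > 0`, so
  -- `τ` is an increasing bijection of the line, and its inverse is the reparametrisation.
  set d : ℝ → ℝ := IccExtend hT ((Icc 0 T).domRestrict c) with hd
  have dcont : Continuous d := hc.domRestrict.Icc_extend'
  have dval : ∀ t ∈ Icc 0 T, d t = c t := fun t ht => by
    rw [hd, IccExtend_of_mem hT _ ht]; rfl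
  obtain ⟨t₁, ht₁, hmin⟩ := isCompact_Icc.exists_isMinOn (nonempty_Icc.2 hT) hc
  set m := c t₁ with hm
  have mpos : 0 < m := hpos t₁ ht₁
  have dm : ∀ t, m ≤ d t := fun t => by
    rw [hd]
    exact hmin (projIcc 0 T hT t).2
  set τ : ℝ → ℝ := fun t => ∫ u in (0 : ℝ)..t, d u with hτ
  have τderiv : ∀ t, HasDerivAt τ (d t) t := fun t => (dcont.integral_hasStrictDerivAt 0 t).hasDerivAt
  have τ0 : τ 0 = 0 := by simp [hτ]
  have τmono : StrictMono τ := strictMono_of_hasDerivAt_pos τderiv fun t => mpos.trans_le (dm t)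
  have τcont : Continuous τ := continuous_iff_continuousAt.2 fun t => (τderiv t).continuousAt
  have diffmono : Monotone fun t => τ t - m * t := by
    refine monotone_of_hasDerivAt_nonneg (f' := fun t => d t - m) (fun t => ?_)
      fun t => sub_nonneg.2 (dm t)
    have := (τderiv t).sub ((hasDerivAt_id t).const_mul m)
    rw [mul_one] at this
    exact this
  have τsurj : Function.Surjective τ := by
    refine τcont.surjective ?_ ?_
    · refine tendsto_atTop_mono' _ ?_ (tendsto_id.const_mul_atTop mpos)
      filter_upwards [eventually_ge_atTop 0] with t ht
      have := diffmono ht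
      simp only [τ0, mul_zero, sub_zero, id] at this ⊢
      linarith
    · refine tendsto_atBot_mono' _ ?_ (tendsto_id.const_mul_atBot mpos)
      filter_upwards [eventually_le_atBot 0] with t ht
      have := diffmono ht
      simp only [τ0, mul_zero, sub_zero, id] at this ⊢
      linarith
  set e := StrictMono.orderIsoOfSurjective τ τmono τsurj with he
  have e_apply : ∀ t, e t = τ t := fun t => rfl
  have σ0 : e.symm 0 = 0 := by rw [OrderIso.symm_apply_eq, e_apply, τ0]
  have σS : e.symm (τ T) = T := by rw [OrderIso.symm_apply_eq, e_apply]
  have maps : MapsTo e.symm (Icc 0 (τ T)) (Icc 0 T) := fun s hs =>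
    ⟨by rw [← σ0]; exact e.symm.monotone hs.1, by rw [← σS]; exact e.symm.monotone hs.2⟩
  refine ⟨τ T, by rw [← τ0]; exact τmono.monotone hT, e.symm, σ0, σS, maps, fun s hs =>
    ⟨(maps ⟨hs.1, hs.2.le⟩).1, by rw [← σS]; exact e.symm.strictMono hs.2⟩, fun s hs => ?_⟩
  have σd : HasDerivAt e.symm (d (e.symm s))⁻¹ s := by
    refine HasDerivAt.of_local_left_inverse (f := τ) e.symm.continuous.continuousAt (τderiv _)
      (mpos.trans_le (dm _)).ne' ?_
    filter_upwards with r
    exact e.apply_symm_apply r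
  have h := (hγ _ (maps hs)).scomp s σd.hasDerivWithinAt maps
  rw [dval _ (maps hs), smul_smul, inv_mul_cancel₀ (hpos _ (maps hs)).ne', one_smul] at h
  exact h

end ODE

end GFA

namespace GFA

/-! ### Liouville's theorem as an inequality: nonnegative divergence does not shrink areas. -/

section Liouville

/-- Area is a multiple of two-dimensional Hausdorff measure, which scales by at most `K ^ 2`. No
measurability is needed, which matters for sets of attaching points. -/
theorem volume_image_le_of_lipschitzWith {f : Plane → Plane} {K : ℝ≥0} (hf : LipschitzWith K f)
    (s : Set Plane) : volume (f '' s) ≤ (K : ℝ≥0∞) ^ 2 * volume s := by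
  have h := Measure.isAddLeftInvariant_eq_smul (volume : Measure Plane) (μH[((2 : ℕ) : ℝ)])
  have hle := hf.hausdorffMeasure_image_le (d := ((2 : ℕ) : ℝ)) (by positivity) s
  rw [ENNReal.rpow_natCast] at hle
  rw [h, Measure.smul_apply, Measure.smul_apply, ENNReal.smul_def, ENNReal.smul_def, smul_eq_mul,
    smul_eq_mul, mul_left_comm]
  gcongr

theorem det_id_add_smul (A : Plane →L[ℝ] Plane) (h : ℝ) :
    (ContinuousLinearMap.id ℝ Plane + h • A).det =
      1 + h * LinearMap.trace ℝ Plane A.toLinearMap + h ^ 2 * A.det := by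
  set b := (EuclideanSpace.basisFun (Fin 2) ℝ).toBasis
  rw [ContinuousLinearMap.det, ContinuousLinearMap.det, LinearMap.trace_eq_matrix_trace ℝ b,
    ← LinearMap.det_toMatrix b, ← LinearMap.det_toMatrix b]
  have : LinearMap.toMatrix b b (ContinuousLinearMap.id ℝ Plane + h • A).toLinearMap =
      1 + h • LinearMap.toMatrix b b A.toLinearMap := by
    simp
  rw [this, Matrix.det_fin_two, Matrix.det_fin_two, Matrix.trace_fin_two]
  simp
  ring

variable {W : Plane → Plane} {φ : ℝ → Plane → Plane}

/-- To compare areas, the Euler error must be small in Lipschitz norm, not just in size. Along the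
flow `W` has time derivative `DW · W`, a compactly supported `C¹` and hence Lipschitz field;
integrating twice in time gives the factor `h ^ 2`. -/
theorem lipschitz_flow_sub_euler (hW : ContDiff ℝ 2 W) (hs : HasCompactSupport W)
    (hφ : IsFlow W φ) :
    ∃ C : ℝ, 0 ≤ C ∧ ∀ h ∈ Icc (0 : ℝ) 1, ∀ y z,
      ‖(φ h y - y - h • W y) - (φ h z - z - h • W z)‖ ≤ C * h ^ 2 * ‖y - z‖ := by
  obtain ⟨K, hK⟩ := hW.lipschitzWith_of_hasCompactSupport hs two_ne_zero
  set Y : Plane → Plane := fun y => fderiv ℝ W y (W y) with hY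
  have Ysmooth : ContDiff ℝ 1 Y :=
    (hW.fderiv_right (m := 1) (by norm_num)).clm_apply (hW.of_le (by norm_num))
  have Ysupp : HasCompactSupport Y := hs.mono fun y hy hWy => hy (by simp [hY, hWy])
  obtain ⟨K₂, hK₂⟩ := Ysmooth.lipschitzWith_of_hasCompactSupport Ysupp one_ne_zero
  set C : ℝ := K₂ * Real.exp K with hC
  have C0 : 0 ≤ C := by positivity
  refine ⟨C, C0, fun h hh y z => ?_⟩
  have hD : ∀ s ∈ Icc (0 : ℝ) h,
      ‖(W (φ s y) - W (φ s z)) - (W y - W z)‖ ≤ C * ‖y - z‖ * s := by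
    intro s hs
    have hd : ∀ r ∈ Icc (0 : ℝ) h, HasDerivWithinAt (fun r => W (φ r y) - W (φ r z))
        (Y (φ r y) - Y (φ r z)) (Icc 0 h) r := fun r _ =>
      ((((hW.differentiable two_ne_zero _).hasFDerivAt.comp_hasDerivAt r (hφ.hasDerivAt r y)).sub
        ((hW.differentiable two_ne_zero _).hasFDerivAt.comp_hasDerivAt r
          (hφ.hasDerivAt r z)))).hasDerivWithinAt
    have key := norm_image_sub_le_of_norm_deriv_le_segment' (C := C * ‖y - z‖) hd
      (fun r hr => ?_) s hs
    · simpa [hφ.zero] using key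
    · rw [← dist_eq_norm, ← dist_eq_norm]
      calc dist (Y (φ r y)) (Y (φ r z)) ≤ K₂ * dist (φ r y) (φ r z) := hK₂.dist_le_mul _ _
        _ ≤ K₂ * (dist y z * Real.exp (K * |r|)) := by gcongr; exact hφ.dist_le hK r y z
        _ ≤ K₂ * (dist y z * Real.exp K) := by
          gcongr
          rw [abs_of_nonneg hr.1]
          exact mul_le_of_le_one_right K.2 (hr.2.le.trans hh.2)
        _ = C * dist y z := by rw [hC]; ring
  have hG : ∀ r ∈ Icc (0 : ℝ) h, HasDerivWithinAt
      (fun r => (φ r y - y - r • W y) - (φ r z - z - r • W z))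
      ((W (φ r y) - W (φ r z)) - (W y - W z)) (Icc 0 h) r := by
    intro r _
    have h1 := (((hφ.hasDerivAt r y).sub_const y).sub ((hasDerivAt_id r).smul_const (W y))).sub
      (((hφ.hasDerivAt r z).sub_const z).sub ((hasDerivAt_id r).smul_const (W z)))
    rw [one_smul, one_smul] at h1
    refine (h1.congr_deriv ?_).hasDerivWithinAt
    abel
  have key := norm_image_sub_le_of_norm_deriv_le_segment' (C := C * ‖y - z‖ * h) hG
    (fun r hr => (hD r ⟨hr.1, hr.2.le⟩).trans (by gcongr; exact hr.2.le)) h ⟨hh.1, le_rfl⟩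
  simp only [hφ.zero, sub_self, zero_smul, sub_zero] at key
  calc _ ≤ _ := key
    _ = C * h ^ 2 * ‖y - z‖ := by ring

/-- The Jacobian of the Euler map is `1 + h tr + h² det`, at least `1 - C h²` where the trace is
nonnegative. -/
theorem exists_volume_le_volume_euler_step (hW : ContDiff ℝ 2 W) (hs : HasCompactSupport W) :
    ∃ C : ℝ, 0 ≤ C ∧ ∃ h₀ > (0 : ℝ), ∀ h ∈ Icc (0 : ℝ) h₀, ∀ S : Set Plane,
      (∀ y ∈ S, 0 ≤ LinearMap.trace ℝ Plane (fderiv ℝ W y).toLinearMap) →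
      ENNReal.ofReal (1 - C * h ^ 2) * volume S ≤ volume ((fun y => y + h • W y) '' S) := by
  obtain ⟨K, hK⟩ := hW.lipschitzWith_of_hasCompactSupport hs two_ne_zero
  have dcont : Continuous (fderiv ℝ W) := hW.continuous_fderiv two_ne_zero
  have detcont : Continuous fun y => (fderiv ℝ W y).det :=
    ContinuousLinearMap.continuous_det.comp dcont
  have detsupp : HasCompactSupport fun y => (fderiv ℝ W y).det := by
    refine (hs.fderiv ℝ).mono fun y hy h0 => hy ?_
    simp only [h0]
    exact LinearMap.det_zero'' (M := Plane) (R := ℝ)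
  obtain ⟨C, hC⟩ := detsupp.exists_bound_of_continuous detcont
  have C0 : 0 ≤ C := (norm_nonneg _).trans (hC 0)
  -- Then `h K < 1`, which makes the Euler map injective, as the area formula requires.
  refine ⟨C, C0, (K + 1 : ℝ)⁻¹, by positivity, fun h hh S hS => ?_⟩
  set F : Plane → Plane := fun y => y + h • W y with hF
  have Fcont : Continuous F := continuous_id.add (hW.continuous.const_smul h)
  have hKh : h * K < 1 := by
    have h1 : h * (K + 1) ≤ 1 := by
      have := mul_le_mul_of_nonneg_right hh.2 (show (0 : ℝ) ≤ K + 1 by positivity)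
      rwa [inv_mul_cancel₀ (by positivity)] at this
    rcases hh.1.eq_or_lt with h0 | h0
    · simp [← h0]
    · linarith
  have Finj : Function.Injective F := by
    intro y z hyz
    by_contra hne
    have hpos : 0 < ‖y - z‖ := norm_pos_iff.2 (sub_ne_zero.2 hne)
    have h1 : y - z = h • (W z - W y) := by
      have : y + h • W y = z + h • W z := hyz
      rw [smul_sub, sub_eq_sub_iff_add_eq_add, this, add_comm]
    have h2 : ‖y - z‖ ≤ h * (K * ‖y - z‖) := by
      conv_lhs => rw [h1]
      rw [norm_smul, Real.norm_of_nonneg hh.1, norm_sub_rev y z]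
      exact mul_le_mul_of_nonneg_left (hK.norm_sub_le z y) hh.1
    nlinarith
  set Z : Set Plane := {y | 0 ≤ LinearMap.trace ℝ Plane (fderiv ℝ W y).toLinearMap} with hZ
  have trcont : Continuous fun A : Plane →L[ℝ] Plane =>
      LinearMap.trace ℝ Plane A.toLinearMap :=
    ((LinearMap.trace ℝ Plane).comp (ContinuousLinearMap.coeLM ℝ)).continuous_of_finiteDimensional
  have Zmeas : MeasurableSet Z :=
    (isClosed_le continuous_const (trcont.comp dcont)).measurableSet
  -- `S` need not be measurable; it is enlarged to a measurable set whose image stays in the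
  -- measurable hull of `F '' S`.
  set T := toMeasurable volume (F '' S) with hT
  set S₁ := F ⁻¹' T ∩ Z with hS₁
  have S₁meas : MeasurableSet S₁ :=
    (Fcont.measurable (measurableSet_toMeasurable _ _)).inter Zmeas
  have sub : S ⊆ S₁ := fun y hy =>
    ⟨subset_toMeasurable _ _ (mem_image_of_mem _ hy), hS y hy⟩
  have Fd : ∀ y ∈ S₁, HasFDerivWithinAt F (ContinuousLinearMap.id ℝ Plane + h • fderiv ℝ W y)
      S₁ y := fun y _ =>
    ((hasFDerivAt_id y).add
      ((hW.differentiable two_ne_zero y).hasFDerivAt.const_smul h)).hasFDerivWithinAt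
  calc ENNReal.ofReal (1 - C * h ^ 2) * volume S
      ≤ ENNReal.ofReal (1 - C * h ^ 2) * volume S₁ := by gcongr
    _ = ∫⁻ _ in S₁, ENNReal.ofReal (1 - C * h ^ 2) := by rw [setLIntegral_const]
    _ ≤ ∫⁻ y in S₁, ENNReal.ofReal
          |(ContinuousLinearMap.id ℝ Plane + h • fderiv ℝ W y).det| := by
        refine setLIntegral_mono' S₁meas fun y hy => ENNReal.ofReal_le_ofReal ?_
        refine le_trans ?_ (le_abs_self _)
        rw [det_id_add_smul]
        have h1 : 0 ≤ h * LinearMap.trace ℝ Plane (fderiv ℝ W y).toLinearMap :=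
          mul_nonneg hh.1 hy.2
        have h2 : -C ≤ (fderiv ℝ W y).det := (abs_le.1 (hC y)).1
        nlinarith [sq_nonneg h]
    _ = volume (F '' S₁) :=
        lintegral_abs_det_fderiv_eq_addHaar_image volume S₁meas Fd Finj.injOn
    _ ≤ volume T := measure_mono (image_subset_iff.2 inter_subset_left)
    _ = volume (F '' S) := measure_toMeasurable _

/-- The Euler map is the flow map followed by `y ↦ y - R y`, with `R` the Euler error expressed at
the end point. This correction has Lipschitz constant `1 + O(h²)`, so exchanging Euler images for
flow images costs only a factor `exp (O(h²))`. -/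
theorem exists_volume_le_volume_flow_step (hW : ContDiff ℝ 2 W) (hs : HasCompactSupport W)
    (hφ : IsFlow W φ) :
    ∃ C : ℝ, ∃ h₀ > (0 : ℝ), ∀ h ∈ Icc (0 : ℝ) h₀, ∀ S : Set Plane,
      (∀ y ∈ S, 0 ≤ LinearMap.trace ℝ Plane (fderiv ℝ W y).toLinearMap) →
      volume S ≤ ENNReal.ofReal (Real.exp (C * h ^ 2)) * volume (φ h '' S) := by
  obtain ⟨K, hK⟩ := hW.lipschitzWith_of_hasCompactSupport hs two_ne_zero
  obtain ⟨C₁, hC₁, hg⟩ := lipschitz_flow_sub_euler hW hs hφ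
  obtain ⟨C₂, hC₂, h₀, hh₀, hF⟩ := exists_volume_le_volume_euler_step hW hs
  set B := C₁ * Real.exp K with hB
  have hB0 : 0 ≤ B := by positivity
  refine ⟨2 * B + 2 * C₂, min (min h₀ 1) (2 * C₂ + 1)⁻¹, by positivity, fun h hh S hS => ?_⟩
  have hh1 : h ≤ 1 := hh.2.trans ((min_le_left _ _).trans (min_le_right _ _))
  have hhh₀ : h ≤ h₀ := hh.2.trans ((min_le_left _ _).trans (min_le_left _ _))
  have hhC : h * (2 * C₂ + 1) ≤ 1 := by
    have := mul_le_mul_of_nonneg_right (hh.2.trans (min_le_right _ _))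
      (show (0 : ℝ) ≤ 2 * C₂ + 1 by positivity)
    rwa [inv_mul_cancel₀ (by positivity)] at this
  have hC₂h : C₂ * h ^ 2 ≤ 1 / 2 := by nlinarith [hh.1]
  set R : Plane → Plane := fun y => φ h (φ (-h) y) - φ (-h) y - h • W (φ (-h) y) with hR
  have Rlip : LipschitzWith (1 + B * h ^ 2).toNNReal fun y => y - R y := by
    refine LipschitzWith.of_dist_le_mul fun y z => ?_
    rw [Real.coe_toNNReal _ (by positivity), dist_eq_norm, dist_eq_norm]
    have h1 : ‖R y - R z‖ ≤ B * h ^ 2 * ‖y - z‖ := by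
      calc ‖R y - R z‖ ≤ C₁ * h ^ 2 * ‖φ (-h) y - φ (-h) z‖ := hg h ⟨hh.1, hh1⟩ _ _
        _ ≤ C₁ * h ^ 2 * (‖y - z‖ * Real.exp K) := by
          gcongr
          rw [← dist_eq_norm, ← dist_eq_norm]
          refine (hφ.dist_le hK (-h) y z).trans ?_
          gcongr
          rw [abs_neg, abs_of_nonneg hh.1]
          exact mul_le_of_le_one_right K.2 hh1
        _ = B * h ^ 2 * ‖y - z‖ := by rw [hB]; ring
    calc ‖(y - R y) - (z - R z)‖ = ‖(y - z) - (R y - R z)‖ := by congr 1; abel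
      _ ≤ ‖y - z‖ + ‖R y - R z‖ := norm_sub_le _ _
      _ ≤ (1 + B * h ^ 2) * ‖y - z‖ := by linarith
  have himage : (fun y => y + h • W y) '' S = (fun y => y - R y) '' (φ h '' S) := by
    rw [image_image]
    refine image_congr fun y _ => ?_
    simp only [hR, hφ.neg_apply hK]
    abel
  have h1 := hF h ⟨hh.1, hhh₀⟩ S hS
  rw [himage] at h1
  have h2 := h1.trans (volume_image_le_of_lipschitzWith Rlip (φ h '' S))
  have h3 : (1 : ℝ≥0∞) ≤ ENNReal.ofReal (Real.exp (2 * C₂ * h ^ 2)) *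
      ENNReal.ofReal (1 - C₂ * h ^ 2) := by
    rw [← ENNReal.ofReal_mul (Real.exp_pos _).le, ENNReal.one_le_ofReal]
    have := Real.add_one_le_exp (2 * C₂ * h ^ 2)
    have h5 : 0 ≤ C₂ * h ^ 2 := by positivity
    nlinarith
  have h4 : ((1 + B * h ^ 2).toNNReal : ℝ≥0∞) ^ 2 ≤ ENNReal.ofReal (Real.exp (2 * B * h ^ 2)) := by
    change ENNReal.ofReal (1 + B * h ^ 2) ^ 2 ≤ _
    rw [← ENNReal.ofReal_pow (by positivity)]
    refine ENNReal.ofReal_le_ofReal ?_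
    have : Real.exp (2 * B * h ^ 2) = Real.exp (B * h ^ 2) ^ 2 := by
      rw [← Real.exp_nat_mul]; congr 1; push_cast; ring
    rw [this]
    gcongr
    linarith [Real.add_one_le_exp (B * h ^ 2)]
  calc volume S = 1 * volume S := (one_mul _).symm
    _ ≤ (ENNReal.ofReal (Real.exp (2 * C₂ * h ^ 2)) * ENNReal.ofReal (1 - C₂ * h ^ 2)) *
        volume S := by gcongr
    _ = ENNReal.ofReal (Real.exp (2 * C₂ * h ^ 2)) *
        (ENNReal.ofReal (1 - C₂ * h ^ 2) * volume S) := by rw [mul_assoc]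
    _ ≤ ENNReal.ofReal (Real.exp (2 * C₂ * h ^ 2)) *
        (ENNReal.ofReal (Real.exp (2 * B * h ^ 2)) * volume (φ h '' S)) :=
      mul_le_mul_right (h2.trans (mul_le_mul_left h4 _)) _
    _ = _ := by
      rw [← mul_assoc, ← ENNReal.ofReal_mul (Real.exp_pos _).le, ← Real.exp_add]
      congr 3
      ring

/-- A flow does not decrease areas where the divergence of its vector field is nonnegative. -/
theorem volume_le_volume_flow_image (hW : ContDiff ℝ 2 W) (hs : HasCompactSupport W)
    (hφ : IsFlow W φ) {S : Set Plane} {t : ℝ} (ht : 0 ≤ t)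
    (hS : ∀ y ∈ S, ∀ s ∈ Icc 0 t,
      0 ≤ LinearMap.trace ℝ Plane (fderiv ℝ W (φ s y)).toLinearMap) :
    volume S ≤ volume (φ t '' S) := by
  obtain ⟨K, hK⟩ := hW.lipschitzWith_of_hasCompactSupport hs two_ne_zero
  obtain ⟨C, h₀, hh₀, hstep⟩ := exists_volume_le_volume_flow_step hW hs hφ
  -- `N` steps of length `t / N` lose a factor `exp (C t² / N)` in total, which tends to 1.
  have iter : ∀ N : ℕ, 0 < N → t / N ≤ h₀ → ∀ k ≤ N,
      volume S ≤ ENNReal.ofReal (Real.exp (k * (C * (t / N) ^ 2))) *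
        volume (φ (k * (t / N)) '' S) := by
    intro N hN hle k
    induction k with
    | zero =>
      intro _
      have : φ 0 = id := funext hφ.zero
      simp [this]
    | succ k ih =>
      intro hk
      refine (ih (Nat.le_of_succ_le hk)).trans ?_
      have h1 := hstep (t / N) ⟨by positivity, hle⟩ (φ (k * (t / N)) '' S) (by
        rintro _ ⟨y, hy, rfl⟩
        refine hS y hy _ ⟨by positivity, ?_⟩
        have hN' : (0 : ℝ) < N := by exact_mod_cast hN
        have hk' : (k : ℝ) ≤ N := by exact_mod_cast Nat.le_of_succ_le hk
        calc (k : ℝ) * (t / N) ≤ N * (t / N) := by gcongr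
          _ = t := by field_simp)
      have himage : φ (t / N) '' (φ (k * (t / N)) '' S) = φ ((k + 1 : ℕ) * (t / N)) '' S := by
        rw [image_image]
        refine image_congr fun y _ => ?_
        rw [← hφ.add hK]
        congr 1
        push_cast
        ring
      rw [himage] at h1
      refine (mul_le_mul_right h1 _).trans (le_of_eq ?_)
      rw [← mul_assoc, ← ENNReal.ofReal_mul (Real.exp_pos _).le, ← Real.exp_add]
      congr 3
      push_cast
      ring
  have lim0 : Tendsto (fun N : ℕ => t / (N : ℝ)) atTop (𝓝 0) :=
    tendsto_const_nhds.div_atTop tendsto_natCast_atTop_atTop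
  have ev : ∀ᶠ N : ℕ in atTop, volume S ≤
      ENNReal.ofReal (Real.exp (C * t * (t / N))) * volume (φ t '' S) := by
    filter_upwards [eventually_gt_atTop 0, lim0.eventually (ge_mem_nhds hh₀)] with N hN hle
    have hN' : (N : ℝ) ≠ 0 := by positivity
    have := iter N hN hle N le_rfl
    rw [mul_div_cancel₀ t hN'] at this
    convert this using 4
    field_simp
  have lim : Tendsto (fun N : ℕ => ENNReal.ofReal (Real.exp (C * t * (t / N))) *
      volume (φ t '' S)) atTop (𝓝 (1 * volume (φ t '' S))) := by
    refine ENNReal.Tendsto.mul_const ?_ (Or.inl one_ne_zero)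
    have h1 := (Real.continuous_exp.tendsto _).comp (lim0.const_mul (C * t))
    have h2 := (ENNReal.continuous_ofReal.tendsto _).comp h1
    simpa using! h2
  rw [one_mul] at lim
  exact ge_of_tendsto lim ev

end Liouville

end GFA

namespace GFA

/-! ### The normalised gradient: derivative, divergence, size and direction. -/

section Drift

variable {n : ℕ}

/-- The sum of the `-α`-th powers of the distances to the particles. -/
noncomputable def weightSum (α : ℝ) (x : Fin n → Plane) (y : Plane) : ℝ :=
  ∑ j, ‖y - x j‖ ^ (-α)

/-- The gradient of the energy, up to a constant factor. -/
noncomputable def pull (α : ℝ) (x : Fin n → Plane) (y : Plane) : Plane :=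
  ∑ j, ‖y - x j‖ ^ (-(α + 2)) • (x j - y)

/-- The gradient of the logarithm of the energy, up to a constant factor. -/
noncomputable def drift (α : ℝ) (x : Fin n → Plane) (y : Plane) : Plane :=
  (weightSum α x y)⁻¹ • pull α x y

theorem hasFDerivAt_norm_sub_rpow {a y : Plane} (h : y ≠ a) (p : ℝ) :
    HasFDerivAt (fun z => ‖z - a‖ ^ p) ((p * ‖y - a‖ ^ (p - 2)) • innerSL ℝ (y - a)) y := by
  have hne : ‖y - a‖ ≠ 0 := norm_ne_zero_iff.2 (sub_ne_zero.2 h)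
  have h1 := (((hasFDerivAt_id y).sub_const a).norm_sq).rpow_const (p := p / 2)
    (Or.inl (pow_ne_zero 2 hne))
  have h2 : (fun z : Plane => (‖id z - a‖ ^ 2) ^ (p / 2)) = fun z => ‖z - a‖ ^ p := by
    funext z
    rw [id, ← Real.rpow_natCast, ← Real.rpow_mul (norm_nonneg _)]
    congr 1
    push_cast
    ring
  rw [h2] at h1
  refine h1.congr_fderiv ?_
  ext v
  have h3 : (‖id y - a‖ ^ 2) ^ (p / 2 - 1) = ‖y - a‖ ^ (p - 2) := by
    rw [id, ← Real.rpow_natCast, ← Real.rpow_mul (norm_nonneg _)]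
    congr 1
    push_cast
    ring
  rw [h3]
  simp
  ring

theorem hasFDerivAt_log_norm_sub {a y : Plane} (h : y ≠ a) :
    HasFDerivAt (fun z => Real.log ‖z - a‖) (‖y - a‖ ^ (-2 : ℝ) • innerSL ℝ (y - a)) y := by
  have hne : ‖y - a‖ ≠ 0 := norm_ne_zero_iff.2 (sub_ne_zero.2 h)
  have h1 := (hasFDerivAt_norm_sub_rpow h 1).log (by simpa using hne)
  simp only [Real.rpow_one, one_mul] at h1
  refine h1.congr_fderiv ?_
  rw [smul_smul]
  congr 1
  rw [← Real.rpow_neg_one, ← Real.rpow_add (norm_pos_iff.2 (sub_ne_zero.2 h))]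
  norm_num

theorem weightSum_pos {α : ℝ} {x : Fin n → Plane} {y : Plane} (hn : 0 < n)
    (hy : ∀ j, y ≠ x j) : 0 < weightSum α x y := by
  have : Nonempty (Fin n) := ⟨⟨0, hn⟩⟩
  exact Finset.sum_pos (fun j _ => Real.rpow_pos_of_pos (norm_pos_iff.2 (sub_ne_zero.2 (hy j))) _)
    Finset.univ_nonempty

theorem hasGradientAt_energy {α : ℝ} {x : Fin n → Plane} {y : Plane} (hy : ∀ j, y ≠ x j) :
    HasGradientAt (energy α x) ((if α = 0 then 1 else α) • pull α x y) y := by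
  rw [hasGradientAt_iff_hasFDerivAt]
  by_cases hα : α = 0
  · have h1 : HasFDerivAt (fun z => ∑ j, -Real.log ‖z - x j‖)
        (∑ j, -(‖y - x j‖ ^ (-2 : ℝ) • innerSL ℝ (y - x j))) y :=
      HasFDerivAt.fun_sum fun j _ => (hasFDerivAt_log_norm_sub (hy j)).neg
    have h2 : energy α x = fun z => ∑ j, -Real.log ‖z - x j‖ := by
      funext z
      simp [energy, hα]
    rw [h2]
    refine h1.congr_fderiv ?_
    ext v
    simp [hα, pull]
    rw [← Finset.sum_neg_distrib]
    exact Finset.sum_congr rfl fun j _ => by ring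
  · have h1 : HasFDerivAt (fun z => ∑ j, ‖z - x j‖ ^ (-α))
        (∑ j, ((-α) * ‖y - x j‖ ^ (-α - 2)) • innerSL ℝ (y - x j)) y :=
      HasFDerivAt.fun_sum fun j _ => hasFDerivAt_norm_sub_rpow (hy j) (-α)
    have h2 : energy α x = fun z => ∑ j, ‖z - x j‖ ^ (-α) := by
      funext z
      simp [energy, hα, Real.rpow_neg]
    rw [h2]
    refine h1.congr_fderiv ?_
    ext v
    simp only [hα, pull, if_false, map_smul, sum_apply,
      InnerProductSpace.toDual_apply_apply, smul_apply, smul_eq_mul, sum_inner,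
      inner_smul_left, inner_sub_left, Finset.mul_sum, innerSL_apply_apply]
    refine Finset.sum_congr rfl fun j _ => ?_
    rw [show -α - 2 = -(α + 2) by ring]
    simp
    ring

theorem gradient_energy {α : ℝ} {x : Fin n → Plane} {y : Plane} (hn : 0 < n)
    (hy : ∀ j, y ≠ x j) :
    gradient (energy α x) y = ((if α = 0 then 1 else α) * weightSum α x y) • drift α x y := by
  rw [(hasGradientAt_energy hy).gradient, drift, smul_smul, mul_assoc,
    mul_inv_cancel₀ (weightSum_pos hn hy).ne', mul_one]

theorem hasFDerivAt_weightSum {α : ℝ} {x : Fin n → Plane} {y : Plane} (hy : ∀ j, y ≠ x j) :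
    HasFDerivAt (weightSum α x) (α • innerSL ℝ (pull α x y)) y := by
  have h1 : HasFDerivAt (fun z => ∑ j, ‖z - x j‖ ^ (-α))
      (∑ j, ((-α) * ‖y - x j‖ ^ (-α - 2)) • innerSL ℝ (y - x j)) y :=
    HasFDerivAt.fun_sum fun j _ => hasFDerivAt_norm_sub_rpow (hy j) (-α)
  refine h1.congr_fderiv ?_
  ext v
  simp only [pull, sum_apply,
    smul_apply, smul_eq_mul, sum_inner,
    inner_smul_left, inner_sub_left, Finset.mul_sum, innerSL_apply_apply]
  refine Finset.sum_congr rfl fun j _ => ?_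
  rw [show -α - 2 = -(α + 2) by ring]
  simp
  ring

theorem hasFDerivAt_pull {α : ℝ} {x : Fin n → Plane} {y : Plane} (hy : ∀ j, y ≠ x j) :
    HasFDerivAt (pull α x) (∑ j, (‖y - x j‖ ^ (-(α + 2)) • (-ContinuousLinearMap.id ℝ Plane) +
      ((-(α + 2) * ‖y - x j‖ ^ (-(α + 2) - 2)) • innerSL ℝ (y - x j)).smulRight (x j - y))) y :=
  HasFDerivAt.fun_sum fun j _ =>
    (hasFDerivAt_norm_sub_rpow (hy j) (-(α + 2))).smul ((hasFDerivAt_id y).const_sub (x j))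

theorem norm_pull_le {α : ℝ} {x : Fin n → Plane} {y : Plane} (hy : ∀ j, y ≠ x j) :
    ‖pull α x y‖ ≤ ∑ j, ‖y - x j‖ ^ (-(α + 1)) := by
  refine (norm_sum_le _ _).trans (Finset.sum_le_sum fun j _ => le_of_eq ?_)
  have hpos : 0 < ‖y - x j‖ := norm_pos_iff.2 (sub_ne_zero.2 (hy j))
  rw [norm_smul, Real.norm_of_nonneg (Real.rpow_nonneg hpos.le _), norm_sub_rev (x j) y]
  nth_rw 2 [← Real.rpow_one ‖y - x j‖]
  rw [← Real.rpow_add hpos]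
  congr 1
  ring

/-- Cauchy–Schwarz with the exponent split as `-(α + 1) = -α / 2 - (α + 2) / 2`; this is what gives
the divergence of `drift` its sign. -/
theorem norm_pull_sq_le {α : ℝ} {x : Fin n → Plane} {y : Plane} (hy : ∀ j, y ≠ x j) :
    ‖pull α x y‖ ^ 2 ≤ weightSum α x y * ∑ j, ‖y - x j‖ ^ (-(α + 2)) := by
  have hpos : ∀ j, 0 < ‖y - x j‖ := fun j => norm_pos_iff.2 (sub_ne_zero.2 (hy j))
  have h1 := Finset.sum_mul_sq_le_sq_mul_sq Finset.univ (fun j => ‖y - x j‖ ^ (-α / 2))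
    (fun j => ‖y - x j‖ ^ (-(α + 2) / 2))
  have e1 : ∀ j, ‖y - x j‖ ^ (-α / 2) * ‖y - x j‖ ^ (-(α + 2) / 2) = ‖y - x j‖ ^ (-(α + 1)) := by
    intro j
    rw [← Real.rpow_add (hpos j)]
    congr 1
    ring
  have e2 : ∀ p : ℝ, ∀ j, (‖y - x j‖ ^ (p / 2)) ^ 2 = ‖y - x j‖ ^ p := by
    intro p j
    rw [← Real.rpow_natCast, ← Real.rpow_mul (hpos j).le]
    congr 1
    push_cast
    ring
  simp only [e1, e2] at h1
  refine le_trans ?_ h1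
  gcongr
  exact norm_pull_le hy

/-- In the plane each summand of `pull` has divergence `(-2 + (α + 2)) ‖y - x j‖ ^ (-(α + 2))`. With
`E` the weight sum and `Q` the sum of these powers, the divergence of `drift` is therefore `α (E Q -
‖pull‖²) / E²`. -/
theorem trace_fderiv_drift_nonneg {α : ℝ} (hα : 0 ≤ α) {x : Fin n → Plane} {y : Plane}
    (hn : 0 < n) (hy : ∀ j, y ≠ x j) :
    0 ≤ LinearMap.trace ℝ Plane (fderiv ℝ (drift α x) y).toLinearMap := by
  have hE := weightSum_pos (α := α) hn hy
  have h1 : HasFDerivAt (drift α x) _ y :=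
    ((hasDerivAt_inv hE.ne').comp_hasFDerivAt y (hasFDerivAt_weightSum hy)).smul
      (hasFDerivAt_pull (α := α) hy)
  have hpos : ∀ j, 0 < ‖y - x j‖ := fun j => norm_pos_iff.2 (sub_ne_zero.2 (hy j))
  rw [h1.fderiv]
  have tr_right : ∀ (f : Plane →L[ℝ] ℝ) (v : Plane),
      LinearMap.trace ℝ Plane (f.smulRight v).toLinearMap = f v := fun f v =>
    LinearMap.trace_smulRight f.toLinearMap v
  have tr_id : LinearMap.trace ℝ Plane (ContinuousLinearMap.id ℝ Plane).toLinearMap = 2 := by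
    simp
  have tr_pull : LinearMap.trace ℝ Plane (∑ j, (‖y - x j‖ ^ (-(α + 2)) •
      (-ContinuousLinearMap.id ℝ Plane) + ((-(α + 2) * ‖y - x j‖ ^ (-(α + 2) - 2)) •
        innerSL ℝ (y - x j)).smulRight (x j - y)) : Plane →L[ℝ] Plane).toLinearMap =
      α * ∑ j, ‖y - x j‖ ^ (-(α + 2)) := by
    rw [ContinuousLinearMap.toLinearMap_sum, map_sum, Finset.mul_sum]
    refine Finset.sum_congr rfl fun j _ => ?_
    rw [ContinuousLinearMap.toLinearMap_add, map_add, tr_right, ContinuousLinearMap.toLinearMap_smul,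
      map_smul, ContinuousLinearMap.toLinearMap_neg, map_neg, tr_id]
    have e : ‖y - x j‖ ^ (-(α + 2) - 2) * ‖y - x j‖ ^ 2 = ‖y - x j‖ ^ (-(α + 2)) := by
      rw [← Real.rpow_natCast, ← Real.rpow_add (hpos j)]
      congr 1
      push_cast
      ring
    have e' : inner ℝ (y - x j) (x j - y) = -‖y - x j‖ ^ 2 := by
      rw [← neg_sub y (x j), inner_neg_right, real_inner_self_eq_norm_sq]
    simp only [smul_apply, innerSL_apply_apply, e', smul_eq_mul]
    linear_combination (α + 2) * e
  rw [ContinuousLinearMap.toLinearMap_add, map_add, tr_right, ContinuousLinearMap.toLinearMap_smul,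
    map_smul, tr_pull]
  simp only [Function.comp_apply, smul_apply, innerSL_apply_apply,
    real_inner_self_eq_norm_sq, smul_eq_mul]
  have key := norm_pull_sq_le (α := α) hy
  set Q := ∑ j, ‖y - x j‖ ^ (-(α + 2))
  set E := weightSum α x y
  have : E⁻¹ * (α * Q) + -(E ^ 2)⁻¹ * (α * ‖pull α x y‖ ^ 2) =
      α * (E ^ 2)⁻¹ * (E * Q - ‖pull α x y‖ ^ 2) := by
    field_simp
    ring
  rw [this]
  have : 0 ≤ E * Q - ‖pull α x y‖ ^ 2 := sub_nonneg.2 key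
  positivity

theorem norm_drift_le_one {α : ℝ} {x : Fin n → Plane} {y : Plane} (hn : 0 < n)
    (hy : ∀ j, 1 ≤ dist y (x j)) : ‖drift α x y‖ ≤ 1 := by
  have hy' : ∀ j, y ≠ x j := fun j h => by
    have := hy j
    rw [h, dist_self] at this
    linarith
  have hE := weightSum_pos (α := α) hn hy'
  rw [drift, norm_smul, Real.norm_of_nonneg (inv_nonneg.2 hE.le), inv_mul_le_iff₀ hE, mul_one]
  refine (norm_pull_le hy').trans (Finset.sum_le_sum fun j _ => ?_)
  refine Real.rpow_le_rpow_of_exponent_le ?_ (by linarith)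
  rw [← dist_eq_norm]
  exact hy j

/-- Beyond `3 * D` every distance to a particle exceeds `2 * D`, so each particle pulls inwards with
at least half of its weight `‖y - x j‖ ^ (-α)`. Division by `weightSum` makes the bound independent
of `α` and `n`. -/
theorem inner_drift_le {α : ℝ} {x : Fin n → Plane} {y : Plane} {D : ℝ} (hn : 0 < n)
    (hD : ∀ j, ‖x j‖ ≤ D) (hy : 3 * D < ‖y‖) : inner ℝ (drift α x y) y ≤ -(1 / 2) := by
  have hD0 : 0 ≤ D := (norm_nonneg _).trans (hD ⟨0, hn⟩)
  have hr : ∀ j, 2 * D < ‖y - x j‖ := fun j => by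
    have := norm_sub_norm_le y (x j)
    linarith [hD j]
  have hpos : ∀ j, 0 < ‖y - x j‖ := fun j => by linarith [hr j]
  have hy' : ∀ j, y ≠ x j := fun j => sub_ne_zero.1 (norm_pos_iff.1 (hpos j))
  have hE := weightSum_pos (α := α) hn hy'
  rw [drift, real_inner_smul_left, inv_mul_le_iff₀ hE, pull, sum_inner, weightSum, Finset.sum_mul]
  refine Finset.sum_le_sum fun j _ => ?_
  rw [real_inner_smul_left]
  have h1 : inner ℝ (x j - y) y ≤ -(1 / 2) * ‖y - x j‖ ^ 2 := by
    have h2 : inner ℝ (x j - y) y = -‖y - x j‖ ^ 2 - inner ℝ (y - x j) (x j) := by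
      rw [← real_inner_self_eq_norm_sq, ← neg_sub y (x j), inner_neg_left]
      simp only [inner_sub_right]
      ring
    have h3 := (abs_le.1 (abs_real_inner_le_norm (y - x j) (x j))).1
    rw [h2]
    nlinarith [hr j, hD j, hpos j, norm_nonneg (x j)]
  have e : ‖y - x j‖ ^ (-(α + 2)) * ‖y - x j‖ ^ 2 = ‖y - x j‖ ^ (-α) := by
    rw [← Real.rpow_natCast, ← Real.rpow_add (hpos j)]
    congr 1
    push_cast
    ring
  calc _ ≤ ‖y - x j‖ ^ (-(α + 2)) * (-(1 / 2) * ‖y - x j‖ ^ 2) :=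
        mul_le_mul_of_nonneg_left h1 (Real.rpow_nonneg (norm_nonneg _) _)
    _ = _ := by rw [← e]; ring

theorem contDiffAt_norm_sub_rpow {a y : Plane} (h : y ≠ a) (p : ℝ) {k : WithTop ℕ∞} :
    ContDiffAt ℝ k (fun z => ‖z - a‖ ^ p) y :=
  ((contDiffAt_id.sub contDiffAt_const).norm ℝ (sub_ne_zero.2 h)).rpow_const_of_ne
    (norm_ne_zero_iff.2 (sub_ne_zero.2 h))

theorem contDiffAt_drift {α : ℝ} {x : Fin n → Plane} {y : Plane} (hn : 0 < n)
    (hy : ∀ j, y ≠ x j) {k : WithTop ℕ∞} : ContDiffAt ℝ k (drift α x) y := by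
  refine ContDiffAt.smul (ContDiffAt.inv ?_ (weightSum_pos hn hy).ne') ?_
  · exact ContDiffAt.sum fun j _ => contDiffAt_norm_sub_rpow (hy j) _
  · exact ContDiffAt.sum fun j _ => (contDiffAt_norm_sub_rpow (hy j) _).smul
      (contDiffAt_const.sub contDiffAt_id)

/-- The drift can be cut off to a globally smooth vector field with compact support. -/
theorem exists_cutoff_drift (α : ℝ) (x : Fin n → Plane) (hn : 0 < n) (R : ℝ) :
    ∃ W : Plane → Plane, ContDiff ℝ 2 W ∧ HasCompactSupport W ∧
      (∀ y, ∃ χ : ℝ, 0 ≤ χ ∧ W y = χ • drift α x y) ∧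
      ∀ y, ‖y‖ ≤ R → (∀ j, 1 ≤ dist y (x j)) → W =ᶠ[𝓝 y] drift α x := by
  let f₀ : ContDiffBump (0 : Plane) :=
    { rIn := |R| + 1, rOut := |R| + 2, rIn_pos := by positivity, rIn_lt_rOut := by linarith }
  let f : ∀ j, ContDiffBump (x j) := fun _ =>
    { rIn := 1 / 4, rOut := 1 / 2, rIn_pos := by norm_num, rIn_lt_rOut := by norm_num }
  -- `χ` vanishes near the particles, where `drift` is singular, and equals 1 on the closed ball of
  -- radius `|R| + 1` outside the discs of radius `1 / 2`.
  let χ : Plane → ℝ := fun y => f₀ y * ∏ j, (1 - f j y)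
  have χsmooth : ContDiff ℝ 2 χ := by
    refine f₀.contDiff.mul (contDiff_prod fun j _ => contDiff_const.sub (f j).contDiff)
  refine ⟨fun y => χ y • drift α x y, ?_, ?_, fun y => ⟨χ y, ?_, rfl⟩, ?_⟩
  · refine contDiff_iff_contDiffAt.2 fun y => ?_
    by_cases hy : ∀ j, y ≠ x j
    · exact χsmooth.contDiffAt.smul (contDiffAt_drift hn hy)
    · push Not at hy
      obtain ⟨j, rfl⟩ := hy
      refine (contDiffAt_const (c := (0 : Plane))).congr_of_eventuallyEq ?_
      filter_upwards [(f j).eventuallyEq_one] with z hz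
      have : χ z = 0 := by
        refine mul_eq_zero_of_right _ (Finset.prod_eq_zero (Finset.mem_univ j) ?_)
        rw [hz]
        simp
      simp [this]
  · refine f₀.hasCompactSupport.mono fun y hy h0 => hy ?_
    simp [χ, h0]
  · exact mul_nonneg f₀.nonneg (Finset.prod_nonneg fun j _ => sub_nonneg.2 (f j).le_one)
  · intro y hy hd
    have h0 : ∀ᶠ z in 𝓝 y, z ∈ Metric.closedBall (0 : Plane) (|R| + 1) := by
      refine mem_of_superset (Metric.isOpen_ball.mem_nhds ?_) Metric.ball_subset_closedBall
      rw [mem_ball_zero_iff]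
      linarith [le_abs_self R]
    have hj : ∀ᶠ z in 𝓝 y, ∀ j, 1 / 2 ≤ dist z (x j) := by
      refine eventually_all.2 fun j => ?_
      have : Tendsto (fun z => dist z (x j)) (𝓝 y) (𝓝 (dist y (x j))) :=
        (continuous_id.dist continuous_const).tendsto y
      filter_upwards [this.eventually (lt_mem_nhds (show (1 / 2 : ℝ) < dist y (x j) by
        linarith [hd j]))] with z hz
      exact hz.le
    filter_upwards [h0, hj] with z hz0 hzj
    have h1 : f₀ z = 1 := f₀.one_of_mem_closedBall hz0
    have h2 : ∀ j, f j z = 0 := fun j => (f j).zero_of_le_dist (hzj j)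
    simp [χ, h1, h2]

end Drift

end GFA

namespace GFA

/-! ### Packing estimates and the small speed near a particle. -/

section Packing

variable {n : ℕ}

/-- The disjoint discs of radius `1 / 2` fit into a disc of radius `k + 1 / 2`, so there are at most
`(2 k + 1)² ≤ 9 k²`. -/
theorem card_dist_lt_le {x : Fin n → Plane} (hx : ∀ j k, j ≠ k → 1 ≤ dist (x j) (x k))
    (y : Plane) {k : ℝ} (hk : 1 ≤ k) :
    ((Finset.univ.filter fun j => dist y (x j) < k).card : ℝ) ≤ 9 * k ^ 2 := by
  set J := Finset.univ.filter fun j => dist y (x j) < k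
  set ω := volume (Metric.ball (0 : Plane) 1) with hω
  have ω0 : ω ≠ 0 := (Metric.measure_ball_pos _ _ one_pos).ne'
  have ωt : ω ≠ ⊤ := measure_ball_lt_top.ne
  have hfr : Module.finrank ℝ Plane = 2 := by simp
  have hdisj : (J : Set (Fin n)).PairwiseDisjoint fun j => Metric.ball (x j) (1 / 2) :=
    fun i _ j _ hij => Metric.ball_disjoint_ball (by linarith [hx i j hij])
  have h1 : (J.card : ℝ≥0∞) * (ENNReal.ofReal ((1 / 2) ^ 2) * ω) ≤
      ENNReal.ofReal ((k + 1 / 2) ^ 2) * ω := by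
    calc (J.card : ℝ≥0∞) * (ENNReal.ofReal ((1 / 2) ^ 2) * ω)
        = ∑ j ∈ J, volume (Metric.ball (x j) (1 / 2)) := by
          rw [Finset.sum_congr rfl fun j _ => Measure.addHaar_ball volume (x j)
            (show (0 : ℝ) ≤ 1 / 2 by norm_num), hfr, Finset.sum_const, nsmul_eq_mul]
      _ = volume (⋃ j ∈ J, Metric.ball (x j) (1 / 2)) :=
          (measure_biUnion_finset hdisj fun _ _ => measurableSet_ball).symm
      _ ≤ volume (Metric.ball y (k + 1 / 2)) := by
          refine measure_mono (iUnion₂_subset fun j hj => Metric.ball_subset_ball' ?_)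
          have := (Finset.mem_filter.1 hj).2
          rw [dist_comm]
          linarith
      _ = _ := by rw [Measure.addHaar_ball volume y (by linarith), hfr]
  rw [← mul_assoc, ENNReal.mul_le_mul_iff_left ω0 ωt, ← ENNReal.ofReal_natCast,
    ← ENNReal.ofReal_mul (by positivity), ENNReal.ofReal_le_ofReal_iff (by positivity)] at h1
  nlinarith

/-- Summation by layers: passing from `k` to `k + 1` raises only the terms with distance below `k +
1`, at most `9 (k + 1)²` of them, each by at most `1 / (k (k + 1))`; that is at most 18 altogether.
-/
theorem sum_max_inv_dist_sub_le {x : Fin n → Plane} (hx : ∀ j k, j ≠ k → 1 ≤ dist (x j) (x k))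
    {y : Plane} (hy : ∀ j, 1 ≤ dist y (x j)) {k : ℕ} (hk : 1 ≤ k) :
    ∑ j, max ((dist y (x j))⁻¹ - (k : ℝ)⁻¹) 0 ≤ 18 * k := by
  induction k, hk using Nat.le_induction with
  | base =>
    rw [Finset.sum_eq_zero]
    · simp
    · intro j _
      have := inv_le_one_of_one_le₀ (hy j)
      simpa using this
  | succ k hk ih =>
    have hk1 : (1 : ℝ) ≤ k := by exact_mod_cast hk
    have step : ∀ j, max ((dist y (x j))⁻¹ - ((k + 1 : ℕ) : ℝ)⁻¹) 0 ≤
        max ((dist y (x j))⁻¹ - (k : ℝ)⁻¹) 0 +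
          if dist y (x j) < ((k + 1 : ℕ) : ℝ) then (k : ℝ)⁻¹ - ((k + 1 : ℕ) : ℝ)⁻¹ else 0 := by
      intro j
      have hle : ((k + 1 : ℕ) : ℝ)⁻¹ ≤ (k : ℝ)⁻¹ := by
        gcongr
        linarith
      split_ifs with h
      · refine max_le ?_ (add_nonneg (le_max_right _ _) (sub_nonneg.2 hle))
        linarith [le_max_left ((dist y (x j))⁻¹ - (k : ℝ)⁻¹) 0]
      · push Not at h
        have : (dist y (x j))⁻¹ ≤ ((k + 1 : ℕ) : ℝ)⁻¹ := by gcongr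
        rw [add_zero]
        exact max_le ((sub_nonpos.2 this).trans (le_max_right _ _)) (le_max_right _ _)
    refine (Finset.sum_le_sum fun j _ => step j).trans ?_
    rw [Finset.sum_add_distrib, ← Finset.sum_filter, Finset.sum_const, nsmul_eq_mul]
    have hc := card_dist_lt_le hx y (k := ((k + 1 : ℕ) : ℝ)) (by push_cast; linarith)
    have h2 : (k : ℝ)⁻¹ - ((k + 1 : ℕ) : ℝ)⁻¹ = ((k : ℝ) * (k + 1))⁻¹ := by
      push_cast
      field_simp
      ring
    have h3 : (9 * ((k + 1 : ℕ) : ℝ) ^ 2) * ((k : ℝ) * (k + 1))⁻¹ ≤ 18 := by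
      push_cast
      rw [← div_eq_mul_inv, div_le_iff₀ (by positivity)]
      nlinarith
    calc _ ≤ 18 * (k : ℝ) + (9 * ((k + 1 : ℕ) : ℝ) ^ 2) * ((k : ℝ) * (k + 1))⁻¹ := by
          rw [h2]
          gcongr
      _ ≤ 18 * (k : ℝ) + 18 := by gcongr
      _ = _ := by push_cast; ring

/-- A particle at distance `d` contributes at most `d ^ (-α) / d` to `pull`. Replacing `1 / d` by `1
/ k` yields the first term; the excess comes from particles nearer than `k`, has weight at most 1,
and is bounded by packing. The scale `k` stays free for optimisation. -/
theorem norm_drift_le_inv_add {α : ℝ} (hα : 0 ≤ α) (hn : 0 < n) {x : Fin n → Plane}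
    (hx : ∀ j k, j ≠ k → 1 ≤ dist (x j) (x k)) {y : Plane} (hy : ∀ j, 1 ≤ dist y (x j)) {k : ℕ}
    (hk : 1 ≤ k) : ‖drift α x y‖ ≤ (k : ℝ)⁻¹ + 18 * k / weightSum α x y := by
  have hy' : ∀ j, y ≠ x j := fun j h => by
    have := hy j
    rw [h, dist_self] at this
    linarith
  have hE := weightSum_pos (α := α) hn hy'
  rw [drift, norm_smul, Real.norm_of_nonneg (inv_nonneg.2 hE.le), inv_mul_le_iff₀ hE, mul_add,
    mul_div_cancel₀ _ hE.ne']
  refine (norm_pull_le hy').trans ?_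
  have h1 : ∀ j, ‖y - x j‖ ^ (-(α + 1)) ≤ ‖y - x j‖ ^ (-α) * (k : ℝ)⁻¹ +
      max ((dist y (x j))⁻¹ - (k : ℝ)⁻¹) 0 := by
    intro j
    have hr : 1 ≤ ‖y - x j‖ := by rw [← dist_eq_norm]; exact hy j
    have hle : ‖y - x j‖ ^ (-α) ≤ 1 := Real.rpow_le_one_of_one_le_of_nonpos hr (by linarith)
    have h0 : 0 ≤ ‖y - x j‖ ^ (-α) := Real.rpow_nonneg (norm_nonneg _) _
    have e : ‖y - x j‖ ^ (-(α + 1)) = ‖y - x j‖ ^ (-α) * (dist y (x j))⁻¹ := by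
      rw [dist_eq_norm, ← Real.rpow_neg_one, ← Real.rpow_add (by linarith)]
      congr 1
      ring
    rw [e]
    have hm := le_max_left ((dist y (x j))⁻¹ - (k : ℝ)⁻¹) 0
    have hm' := le_max_right ((dist y (x j))⁻¹ - (k : ℝ)⁻¹) 0
    nlinarith
  refine (Finset.sum_le_sum fun j _ => h1 j).trans ?_
  rw [Finset.sum_add_distrib, ← Finset.sum_mul]
  exact add_le_add_right (sum_max_inv_dist_sub_le hx hy hk) _

/-- Following the chain of attachments, the particle with index `m` lies within distance `m` of the
first. -/
theorem IsAggregate.dist_le {x : Fin n → Plane} (hx : IsAggregate x) (j k : Fin n) :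
    dist (x j) (x k) ≤ 2 * n := by
  have hn : 0 < n := j.pos
  have key : ∀ m : ℕ, ∀ h : m < n, dist (x ⟨m, h⟩) (x ⟨0, hn⟩) ≤ m := by
    intro m
    induction m using Nat.strong_induction_on with
    | _ m ih =>
      intro h
      rcases Nat.eq_zero_or_pos m with rfl | hm
      · simp
      · obtain ⟨l, hl, hd⟩ := hx.attached ⟨m, h⟩ hm
        have hlm : (l : ℕ) < m := hl
        have h1 := ih l hlm l.2
        have h2 := dist_triangle (x ⟨m, h⟩) (x l) (x ⟨0, hn⟩)
        have h3 : ((l : ℕ) : ℝ) + 1 ≤ m := by exact_mod_cast hlm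
        have h4 : x ⟨(l : ℕ), l.2⟩ = x l := rfl
        rw [h4] at h1
        linarith
  have h1 := key j j.2
  have h2 := key k k.2
  have h3 : ((j : ℕ) : ℝ) ≤ n := by exact_mod_cast j.2.le
  have h4 : ((k : ℕ) : ℝ) ≤ n := by exact_mod_cast k.2.le
  have h5 := dist_triangle_right (x j) (x k) (x ⟨0, hn⟩)
  have h6 : x ⟨(j : ℕ), j.2⟩ = x j := rfl
  have h7 : x ⟨(k : ℕ), k.2⟩ = x k := rfl
  rw [h6] at h1
  rw [h7] at h2
  linarith

/-- The drift is small near a particle of a large aggregate. -/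
theorem norm_drift_le_of_dist_le_two {α : ℝ} (hα : 0 ≤ α) (hα1 : α ≤ 1) {x : Fin n → Plane}
    (hx : IsAggregate x) (i : Fin n) {y : Plane} (hy : ∀ j, 1 ≤ dist y (x j))
    (hyi : dist y (x i) ≤ 2) : ‖drift α x y‖ ≤ 145 * (n : ℝ) ^ ((α - 1) / 2) := by
  have hn : 0 < n := i.pos
  have hn1 : (1 : ℝ) ≤ n := by exact_mod_cast hn
  -- All particles are within `2 + 2 n ≤ 4 n` of `y`, so `weightSum` is at least `n (4 n) ^ (-α) ≥
  -- s² / 4`; the scale `k ≈ s` balances `1 / k` against `18 k / weightSum`.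
  set s : ℝ := (n : ℝ) ^ ((1 - α) / 2) with hs
  have hs1 : 1 ≤ s := Real.one_le_rpow hn1 (by linarith)
  have hsinv : (n : ℝ) ^ ((α - 1) / 2) = s⁻¹ := by
    rw [hs, ← Real.rpow_neg (by linarith)]
    congr 1
    ring
  have hE : s ^ 2 / 4 ≤ weightSum α x y := by
    have h1 : ∀ j, (4 * n : ℝ) ^ (-α) ≤ ‖y - x j‖ ^ (-α) := fun j => by
      refine Real.rpow_le_rpow_of_nonpos ?_ ?_ (by linarith)
      · rw [← dist_eq_norm]
        linarith [hy j]
      · rw [← dist_eq_norm]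
        have := dist_triangle y (x i) (x j)
        have := hx.dist_le i j
        linarith
    have h2 : (n : ℝ) * (4 * n : ℝ) ^ (-α) ≤ weightSum α x y := by
      refine le_trans (le_of_eq ?_) (Finset.sum_le_sum fun j _ => h1 j)
      simp
    refine le_trans ?_ h2
    have h3 : s ^ 2 = n * (n : ℝ) ^ (-α) := by
      rw [hs, ← Real.rpow_natCast, ← Real.rpow_mul (by linarith)]
      nth_rw 2 [← Real.rpow_one (n : ℝ)]
      rw [← Real.rpow_add (by linarith)]
      congr 1
      push_cast
      ring
    rw [Real.mul_rpow (by norm_num) (by linarith), h3]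
    have h4 : (4 : ℝ)⁻¹ ≤ 4 ^ (-α) := by
      rw [← Real.rpow_neg_one]
      exact Real.rpow_le_rpow_of_exponent_le (by norm_num) (by linarith)
    have h5 : 0 ≤ (n : ℝ) * (n : ℝ) ^ (-α) := by positivity
    nlinarith
  set k := ⌈s⌉₊ with hk
  have hk1 : 1 ≤ k := Nat.one_le_ceil_iff.2 (by linarith)
  have hsk : s ≤ k := Nat.le_ceil s
  have hks : (k : ℝ) ≤ 2 * s := by
    have := Nat.ceil_lt_add_one (show 0 ≤ s by linarith)
    rw [← hk] at this
    linarith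
  have h1 := norm_drift_le_inv_add hα hn hx.separated hy hk1
  rw [hsinv]
  have h2 : (k : ℝ)⁻¹ ≤ s⁻¹ := by gcongr
  have h3 : 18 * (k : ℝ) / weightSum α x y ≤ 144 * s⁻¹ := by
    calc 18 * (k : ℝ) / weightSum α x y ≤ 18 * (2 * s) / (s ^ 2 / 4) := by gcongr
      _ = 144 * s⁻¹ := by
        field_simp
        norm_num
  linarith

end Packing

end GFA

namespace GFA

/-! ### Hitting times of the drift, and the area of the points that hit a particle early. -/

section Reach

variable {n : ℕ} {α : ℝ} {x : Fin n → Plane} {i : Fin n}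

/-- The drift takes `y` in time `T` to a point at distance `1` from `x i`; before that it has
distance more than `1` from all the particles. -/
def ReachesIn (α : ℝ) (x : Fin n → Plane) (i : Fin n) (y : Plane) (T : ℝ) : Prop :=
  0 ≤ T ∧ ∃ γ : ℝ → Plane, γ 0 = y ∧
    (∀ t ∈ Icc 0 T, HasDerivWithinAt γ (drift α x (γ t)) (Icc 0 T) t) ∧
    (∀ t ∈ Ico 0 T, ∀ j, 1 < dist (γ t) (x j)) ∧
    (∀ j, 1 ≤ dist (γ T) (x j)) ∧ dist (γ T) (x i) = 1

theorem ne_of_one_le_dist {y : Plane} (hy : ∀ j, 1 ≤ dist y (x j)) (j : Fin n) : y ≠ x j :=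
  fun h => by
    have := hy j
    rw [h, dist_self] at this
    linarith

theorem one_le_dist_of_Icc {γ : ℝ → Plane} {T : ℝ} (h1 : ∀ t ∈ Ico 0 T, ∀ j, 1 < dist (γ t) (x j))
    (h2 : ∀ j, 1 ≤ dist (γ T) (x j)) {t : ℝ} (ht : t ∈ Icc 0 T) (j : Fin n) :
    1 ≤ dist (γ t) (x j) := by
  rcases ht.2.eq_or_lt with rfl | h
  · exact h2 j
  · exact (h1 t ⟨ht.1, h⟩ j).le

theorem exists_reaching_reparam {u v : Plane → Plane} {c : Plane → ℝ}
    (huv : ∀ y, (∀ j, y ≠ x j) → u y = c y • v y) (hc : ∀ y, (∀ j, y ≠ x j) → 0 < c y)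
    (hcc : ∀ y, (∀ j, y ≠ x j) → ContinuousAt c y) {γ : ℝ → Plane} {T : ℝ} (hT : 0 ≤ T)
    (hγ : ∀ t ∈ Icc 0 T, HasDerivWithinAt γ (u (γ t)) (Icc 0 T) t)
    (h1 : ∀ t ∈ Ico 0 T, ∀ j, 1 < dist (γ t) (x j)) (h2 : ∀ j, 1 ≤ dist (γ T) (x j)) :
    ∃ S, 0 ≤ S ∧ ∃ η : ℝ → Plane, η 0 = γ 0 ∧ η S = γ T ∧
      (∀ t ∈ Icc 0 S, HasDerivWithinAt η (v (η t)) (Icc 0 S) t) ∧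
      (∀ t ∈ Ico 0 S, ∀ j, 1 < dist (η t) (x j)) := by
  have hne : ∀ t ∈ Icc 0 T, ∀ j, γ t ≠ x j := fun t ht =>
    ne_of_one_le_dist (one_le_dist_of_Icc h1 h2 ht)
  obtain ⟨S, hS, σ, σ0, σS, -, σ2, hσ⟩ := exists_reparam (γ := γ) (c := fun t => c (γ t)) (v := v)
    hT (fun t ht => (hcc _ (hne t ht)).comp_continuousWithinAt (hγ t ht).continuousWithinAt)
    (fun t ht => hc _ (hne t ht)) (fun t ht => by rw [← huv _ (hne t ht)]; exact hγ t ht)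
  exact ⟨S, hS, γ ∘ σ, by simp [σ0], by simp [σS], hσ, fun t ht j => h1 _ (σ2 ht) j⟩

/-- Off the particles the gradient and the drift are positive continuous multiples of each other, so
a change of time converts one trajectory into the other. -/
theorem attachesTo_iff (hα : 0 ≤ α) {y : Plane} :
    AttachesTo α x i y ↔ ∃ T, ReachesIn α x i y T := by
  have hn : 0 < n := i.pos
  set a : ℝ := if α = 0 then 1 else α with ha
  have apos : 0 < a := by
    rw [ha]
    split_ifs with h
    · exact one_pos
    · exact lt_of_le_of_ne hα (Ne.symm h)
  have cpos : ∀ z, (∀ j, z ≠ x j) → 0 < a * weightSum α x z := fun z hz =>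
    mul_pos apos (weightSum_pos hn hz)
  have ccont : ∀ z, (∀ j, z ≠ x j) → ContinuousAt (fun z => a * weightSum α x z) z :=
    fun z hz => (hasFDerivAt_weightSum hz).continuousAt.const_mul a
  constructor
  · rintro ⟨T, γ, hT, h0, hγ, h1, h2, h3⟩
    obtain ⟨S, hS, η, η0, ηS, hη, h4⟩ := exists_reaching_reparam (u := gradient (energy α x))
      (v := drift α x) (fun z hz => gradient_energy hn hz) cpos ccont hT hγ h1 h2
    exact ⟨S, hS, η, by rw [η0, h0], hη, h4, by rwa [ηS], by rwa [ηS]⟩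
  · rintro ⟨T, hT, γ, h0, hγ, h1, h2, h3⟩
    obtain ⟨S, hS, η, η0, ηS, hη, h4⟩ := exists_reaching_reparam (v := gradient (energy α x))
      (u := drift α x) (c := fun z => (a * weightSum α x z)⁻¹)
      (fun z hz => by rw [gradient_energy hn hz, smul_smul, inv_mul_cancel₀ (cpos z hz).ne',
        one_smul]) (fun z hz => inv_pos.2 (cpos z hz))
      (fun z hz => (ccont z hz).inv₀ (cpos z hz).ne') hT hγ h1 h2
    exact ⟨S, η, hS, by rw [η0, h0], hη, h4, by rwa [ηS], by rwa [ηS]⟩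

theorem norm_sub_le_of_drift_curve (hn : 0 < n) {γ : ℝ → Plane} {T : ℝ}
    (hγ : ∀ t ∈ Icc 0 T, HasDerivWithinAt γ (drift α x (γ t)) (Icc 0 T) t)
    (h : ∀ t ∈ Icc 0 T, ∀ j, 1 ≤ dist (γ t) (x j)) {t : ℝ} (ht : t ∈ Icc 0 T) :
    ‖γ t‖ ≤ ‖γ 0‖ + T := by
  have key := norm_image_sub_le_of_norm_deriv_le_segment' (C := 1) hγ
    (fun s hs => norm_drift_le_one hn (h s ⟨hs.1, hs.2.le⟩)) t ht
  have := norm_sub_norm_le (γ t) (γ 0)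
  linarith [ht.2]

/-- `W` is a cut-off of the drift that agrees with it near the points with norm at most `R` which
have distance at least `1` from all the particles, and `φ` is its flow. -/
structure IsCutoffFlow (α : ℝ) (x : Fin n → Plane) (R : ℝ) (W : Plane → Plane)
    (φ : ℝ → Plane → Plane) : Prop where
  contDiff : ContDiff ℝ 2 W
  hasCompactSupport : HasCompactSupport W
  exists_eq_smul : ∀ y, ∃ χ : ℝ, 0 ≤ χ ∧ W y = χ • drift α x y
  eventuallyEq : ∀ y, ‖y‖ ≤ R → (∀ j, 1 ≤ dist y (x j)) → W =ᶠ[𝓝 y] drift α x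
  isFlow : IsFlow W φ

theorem exists_isCutoffFlow (α : ℝ) (x : Fin n → Plane) (hn : 0 < n) (R : ℝ) :
    ∃ W φ, IsCutoffFlow α x R W φ := by
  obtain ⟨W, h1, h2, h3, h4⟩ := exists_cutoff_drift α x hn R
  obtain ⟨K, hK⟩ := h1.lipschitzWith_of_hasCompactSupport h2 two_ne_zero
  obtain ⟨L, hL⟩ := h2.exists_bound_of_continuous h1.continuous
  obtain ⟨φ, hφ⟩ := exists_isFlow hK (L := L.toNNReal) fun y => (hL y).trans (Real.le_coe_toNNReal L)
  exact ⟨W, φ, h1, h2, h3, h4, hφ⟩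

namespace IsCutoffFlow

variable {R : ℝ} {W : Plane → Plane} {φ : ℝ → Plane → Plane}

theorem exists_lipschitzWith (h : IsCutoffFlow α x R W φ) : ∃ K, LipschitzWith K W :=
  h.contDiff.lipschitzWith_of_hasCompactSupport h.hasCompactSupport two_ne_zero

theorem eq_drift (h : IsCutoffFlow α x R W φ) {y : Plane} (hR : ‖y‖ ≤ R)
    (hy : ∀ j, 1 ≤ dist y (x j)) : W y = drift α x y :=
  (h.eventuallyEq y hR hy).eq_of_nhds

theorem trace_nonneg (h : IsCutoffFlow α x R W φ) (hα : 0 ≤ α) (hn : 0 < n) {y : Plane}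
    (hR : ‖y‖ ≤ R) (hy : ∀ j, 1 ≤ dist y (x j)) :
    0 ≤ LinearMap.trace ℝ Plane (fderiv ℝ W y).toLinearMap := by
  rw [(h.eventuallyEq y hR hy).fderiv_eq]
  exact trace_fderiv_drift_nonneg hα hn (ne_of_one_le_dist hy)

theorem eq_of_drift_curve (h : IsCutoffFlow α x R W φ) {γ : ℝ → Plane} {T : ℝ}
    (hγ : ∀ t ∈ Icc 0 T, HasDerivWithinAt γ (drift α x (γ t)) (Icc 0 T) t)
    (hd : ∀ t ∈ Icc 0 T, ∀ j, 1 ≤ dist (γ t) (x j)) (hR : ∀ t ∈ Icc 0 T, ‖γ t‖ ≤ R) {t : ℝ}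
    (ht : t ∈ Icc 0 T) : γ t = φ t (γ 0) := by
  obtain ⟨K, hK⟩ := h.exists_lipschitzWith
  have := h.isFlow.eq_of_curve hK (f := γ) (a := 0) (b := T) (s := 0) (t := t)
    (fun r hr => by rw [h.eq_drift (hR r hr) (hd r hr)]; exact hγ r hr)
    ⟨le_rfl, ht.1.trans ht.2⟩ ht
  simpa using this

theorem hasDerivAt_drift (h : IsCutoffFlow α x R W φ) {y : Plane} {t : ℝ} (hR : ‖φ t y‖ ≤ R)
    (hd : ∀ j, 1 ≤ dist (φ t y) (x j)) : HasDerivAt (fun s => φ s y) (drift α x (φ t y)) t := by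
  rw [← h.eq_drift hR hd]
  exact h.isFlow.hasDerivAt t y

theorem reachesIn (h : IsCutoffFlow α x R W φ) {y : Plane} {T : ℝ} (hT : 0 ≤ T)
    (hR : ∀ t ∈ Icc 0 T, ‖φ t y‖ ≤ R) (h1 : ∀ t ∈ Ico 0 T, ∀ j, 1 < dist (φ t y) (x j))
    (h2 : ∀ j, 1 ≤ dist (φ T y) (x j)) (h3 : dist (φ T y) (x i) = 1) : ReachesIn α x i y T :=
  ⟨hT, fun t => φ t y, h.isFlow.zero y, fun t ht =>
    (h.hasDerivAt_drift (hR t ht) (one_le_dist_of_Icc (γ := fun t => φ t y) h1 h2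
      ht)).hasDerivWithinAt, h1, h2, h3⟩

/-- Speed at most 1 keeps the trajectory inside radius `‖y‖ + T ≤ R`, where the cut-off is not felt,
and uniqueness identifies it with `φ`. -/
theorem of_reachesIn (h : IsCutoffFlow α x R W φ) {y : Plane} {T : ℝ} (hy : ReachesIn α x i y T)
    (hR : ‖y‖ + T ≤ R) : (∀ t ∈ Icc 0 T, ‖φ t y‖ ≤ R) ∧
      (∀ t ∈ Ico 0 T, ∀ j, 1 < dist (φ t y) (x j)) ∧ (∀ j, 1 ≤ dist (φ T y) (x j)) ∧
      dist (φ T y) (x i) = 1 := by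
  obtain ⟨hT, γ, h0, hγ, h1, h2, h3⟩ := hy
  have hn : 0 < n := i.pos
  have hd : ∀ t ∈ Icc 0 T, ∀ j, 1 ≤ dist (γ t) (x j) := fun t ht => one_le_dist_of_Icc h1 h2 ht
  have hR' : ∀ t ∈ Icc 0 T, ‖γ t‖ ≤ R := fun t ht =>
    (norm_sub_le_of_drift_curve hn hγ hd ht).trans (by rwa [h0])
  have heq : ∀ t ∈ Icc 0 T, γ t = φ t y := fun t ht => by
    rw [← h0]
    exact h.eq_of_drift_curve hγ hd hR' ht
  have hTm : T ∈ Icc 0 T := ⟨hT, le_rfl⟩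
  refine ⟨fun t ht => heq t ht ▸ hR' t ht, fun t ht => heq t ⟨ht.1, ht.2.le⟩ ▸ h1 t ht,
    heq T hTm ▸ h2, heq T hTm ▸ h3⟩

end IsCutoffFlow

theorem volume_closedBall_diff_ball_le (z : Plane) {M : ℝ} (hM0 : 0 ≤ M) (hM1 : M ≤ 1) :
    volume (Metric.closedBall z (1 + M) \ Metric.ball z 1) ≤
      ENNReal.ofReal (3 * M) * volume (Metric.ball (0 : Plane) 1) := by
  have hfr : Module.finrank ℝ Plane = 2 := by simp
  have sub : Metric.ball z 1 ⊆ Metric.closedBall z (1 + M) :=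
    Metric.ball_subset_closedBall.trans (Metric.closedBall_subset_closedBall (by linarith))
  rw [measure_sdiff sub measurableSet_ball.nullMeasurableSet measure_ball_lt_top.ne,
    Measure.addHaar_closedBall volume z (by linarith), Measure.addHaar_ball volume z zero_le_one,
    hfr, tsub_le_iff_right, ← add_mul, ← ENNReal.ofReal_add (by positivity) (by positivity)]
  gcongr
  nlinarith

/-- Few points can reach a particle fast if the drift is small near it. -/
theorem volume_reachesIn_le (hα : 0 ≤ α) {M : ℝ} (hM0 : 0 ≤ M) (hM1 : M ≤ 1)
    (hM : ∀ y, (∀ j, 1 ≤ dist y (x j)) → dist y (x i) ≤ 2 → ‖drift α x y‖ ≤ M) {S : Set Plane}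
    {R T : ℝ} (hT : 1 ≤ T) (hS : ∀ y ∈ S, ‖y‖ ≤ R ∧ ∃ t ≤ T, ReachesIn α x i y t) :
    volume S ≤ ENNReal.ofReal (6 * M * T) * volume (Metric.ball (0 : Plane) 1) := by
  have hn : 0 < n := i.pos
  obtain ⟨W, φ, h⟩ := exists_isCutoffFlow α x hn (R + T)
  set ω := volume (Metric.ball (0 : Plane) 1)
  -- Points are sorted by hitting time. At time `k` at most unit time remains: speed at most 1
  -- places the point within 2 of `x i`, and there speed at most `M` places it within `1 + M`. So
  -- the flow at time `k` carries `H k`, without loss of area, into an annulus of area at most `3 M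
  -- ω`.
  set H : ℕ → Set Plane := fun k => {y ∈ S | ∃ t ≤ T, (k : ℝ) ≤ t ∧ t ≤ k + 1 ∧ ReachesIn α x i y t}
    with hH
  have hHk : ∀ k, volume (H k) ≤ ENNReal.ofReal (3 * M) * ω := by
    intro k
    refine (volume_le_volume_flow_image h.contDiff h.hasCompactSupport h.isFlow
      (t := (k : ℝ)) (by positivity) ?_).trans ((measure_mono ?_).trans
        (volume_closedBall_diff_ball_le (x i) hM0 hM1))
    · rintro y ⟨hyS, t, htT, hkt, -, hyt⟩ s hs
      obtain ⟨h1, h2, h3, -⟩ := h.of_reachesIn hyt (by linarith [(hS y hyS).1])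
      have hst : s ∈ Icc 0 t := ⟨hs.1, hs.2.trans hkt⟩
      exact h.trace_nonneg hα hn (h1 s hst) (one_le_dist_of_Icc (γ := fun t => φ t y) h2 h3 hst)
    · rintro _ ⟨y, ⟨hyS, t, htT, hkt, htk, hyt⟩, rfl⟩
      obtain ⟨h1, h2, h3, h4⟩ := h.of_reachesIn hyt (by linarith [(hS y hyS).1])
      have hk0 : (0 : ℝ) ≤ k := by positivity
      have hd : ∀ s ∈ Icc (k : ℝ) t, ∀ j, 1 ≤ dist (φ s y) (x j) := fun s hs =>
        one_le_dist_of_Icc (γ := fun t => φ t y) h2 h3 ⟨hk0.trans hs.1, hs.2⟩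
      have hder : ∀ s ∈ Icc (k : ℝ) t, HasDerivWithinAt (fun s => φ s y) (drift α x (φ s y))
          (Icc (k : ℝ) t) s := fun s hs =>
        (h.hasDerivAt_drift (h1 s ⟨hk0.trans hs.1, hs.2⟩) (hd s hs)).hasDerivWithinAt
      have htm : t ∈ Icc (k : ℝ) t := ⟨hkt, le_rfl⟩
      have hkm : (k : ℝ) ∈ Icc (k : ℝ) t := ⟨le_rfl, hkt⟩
      have near : ∀ s ∈ Icc (k : ℝ) t, dist (φ s y) (x i) ≤ 2 := by
        intro s hs
        have := (convex_Icc (k : ℝ) t).norm_image_sub_le_of_norm_hasDerivWithin_le (C := 1) hder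
          (fun r hr => norm_drift_le_one hn (hd r hr)) htm hs
        rw [← dist_eq_norm, Real.norm_eq_abs, abs_of_nonpos (by linarith [hs.2])] at this
        linarith [dist_triangle (φ s y) (φ t y) (x i), hs.1]
      have key := (convex_Icc (k : ℝ) t).norm_image_sub_le_of_norm_hasDerivWithin_le (C := M) hder
        (fun r hr => hM _ (hd r hr) (near r hr)) htm hkm
      rw [← dist_eq_norm, Real.norm_eq_abs, abs_of_nonpos (by linarith)] at key
      refine ⟨?_, ?_⟩
      · rw [Metric.mem_closedBall]
        have : M * -(k - t) ≤ M := by nlinarith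
        linarith [dist_triangle (φ k y) (φ t y) (x i)]
      · rw [Metric.mem_ball, not_lt]
        exact hd k hkm i
  set N := ⌊T⌋₊ + 1 with hN
  have hcover : S ⊆ ⋃ k ∈ Finset.range N, H k := by
    intro y hy
    obtain ⟨t, htT, hyt⟩ := (hS y hy).2
    refine mem_biUnion (x := ⌊t⌋₊) ?_ ⟨hy, t, htT, Nat.floor_le hyt.1, (Nat.lt_floor_add_one t).le,
      hyt⟩
    exact Finset.mem_coe.2 (Finset.mem_range.2 (Nat.lt_succ_of_le (Nat.floor_mono htT)))
  calc volume S ≤ ∑ k ∈ Finset.range N, volume (H k) :=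
        (measure_mono hcover).trans (measure_biUnion_finset_le _ _)
    _ ≤ ∑ _k ∈ Finset.range N, ENNReal.ofReal (3 * M) * ω := Finset.sum_le_sum fun k _ => hHk k
    _ = ENNReal.ofReal (N * (3 * M)) * ω := by
        rw [Finset.sum_const, Finset.card_range, nsmul_eq_mul, ← mul_assoc,
          ENNReal.ofReal_mul (p := (N : ℝ)) (by positivity), ENNReal.ofReal_natCast]
    _ ≤ ENNReal.ofReal (6 * M * T) * ω := by
        refine mul_le_mul_left (ENNReal.ofReal_le_ofReal ?_) _
        have h1 : (N : ℝ) ≤ 2 * T := by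
          have := Nat.floor_le (show 0 ≤ T by linarith)
          rw [hN]
          push_cast
          linarith
        nlinarith

end Reach

end GFA

namespace GFA

/-! ### Moving the starting point along a trajectory. -/

section Concatenation

variable {n : ℕ} {α : ℝ} {x : Fin n → Plane} {i : Fin n}

/-- The drift takes `y` to `z` in time `s`, at distance more than `1` from all the particles. -/
def FlowsIn (α : ℝ) (x : Fin n → Plane) (y z : Plane) (s : ℝ) : Prop :=
  0 ≤ s ∧ ∃ γ : ℝ → Plane, γ 0 = y ∧ γ s = z ∧
    (∀ t ∈ Icc 0 s, HasDerivWithinAt γ (drift α x (γ t)) (Icc 0 s) t) ∧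
    (∀ t ∈ Icc 0 s, ∀ j, 1 < dist (γ t) (x j))

theorem IsCutoffFlow.of_flowsIn {R : ℝ} {W : Plane → Plane} {φ : ℝ → Plane → Plane}
    (h : IsCutoffFlow α x R W φ) (hn : 0 < n) {y z : Plane} {s : ℝ} (hyz : FlowsIn α x y z s)
    (hR : ‖y‖ + s ≤ R) : φ s y = z ∧ ‖z‖ ≤ ‖y‖ + s ∧ (∀ t ∈ Icc 0 s, ‖φ t y‖ ≤ R) ∧
      (∀ t ∈ Icc 0 s, ∀ j, 1 < dist (φ t y) (x j)) := by
  obtain ⟨hs, γ, h0, hγs, hγ, h1⟩ := hyz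
  have hb : ∀ t ∈ Icc 0 s, ‖γ t‖ ≤ ‖y‖ + s := fun t ht => by
    rw [← h0]
    exact norm_sub_le_of_drift_curve hn hγ (fun r hr j => (h1 r hr j).le) ht
  have heq : ∀ t ∈ Icc 0 s, γ t = φ t y := fun t ht => by
    rw [← h0]
    exact h.eq_of_drift_curve hγ (fun r hr j => (h1 r hr j).le) (fun r hr => (hb r hr).trans hR) ht
  have hsm : s ∈ Icc 0 s := ⟨hs, le_rfl⟩
  exact ⟨by rw [← heq s hsm, hγs], by rw [← hγs]; exact hb s hsm,
    fun t ht => heq t ht ▸ (hb t ht).trans hR, fun t ht => heq t ht ▸ h1 t ht⟩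

theorem ReachesIn.prepend {y z : Plane} {s T : ℝ} (hyz : FlowsIn α x y z s)
    (hz : ReachesIn α x i z T) : ReachesIn α x i y (s + T) := by
  have hn : 0 < n := i.pos
  obtain ⟨W, φ, h⟩ := exists_isCutoffFlow α x hn (‖y‖ + s + T)
  obtain ⟨K, hK⟩ := h.exists_lipschitzWith
  have hs := hyz.1
  have hT := hz.1
  obtain ⟨rfl, hzn, hR1, hd1⟩ := h.of_flowsIn hn hyz (by linarith)
  obtain ⟨hR2, hd2, hd3, hd4⟩ := h.of_reachesIn hz (by linarith)
  have hφ : ∀ t, φ t y = φ (t - s) (φ s y) := fun t => by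
    rw [← h.isFlow.add hK, add_sub_cancel]
  refine h.reachesIn (by linarith) (fun t ht => ?_) (fun t ht => ?_) ?_ ?_
  · rcases le_total t s with hts | hst
    · exact hR1 t ⟨ht.1, hts⟩
    · rw [hφ]
      exact hR2 _ ⟨by linarith, by linarith [ht.2]⟩
  · rcases le_total t s with hts | hst
    · exact hd1 t ⟨ht.1, hts⟩
    · rw [hφ]
      exact hd2 _ ⟨by linarith, by linarith [ht.2]⟩
  · rwa [hφ, add_sub_cancel_left]
  · rwa [hφ, add_sub_cancel_left]

/-- All distances exceed 1 up to time `s`, so the hit cannot occur before. Together with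
`ReachesIn.prepend` this lets the start move along the trajectory in either direction. -/
theorem ReachesIn.drop {y z : Plane} {s T : ℝ} (hyz : FlowsIn α x y z s)
    (hy : ReachesIn α x i y T) : s ≤ T ∧ ReachesIn α x i z (T - s) := by
  have hn : 0 < n := i.pos
  obtain ⟨W, φ, h⟩ := exists_isCutoffFlow α x hn (‖y‖ + s + T)
  obtain ⟨K, hK⟩ := h.exists_lipschitzWith
  have hs := hyz.1
  have hT := hy.1
  obtain ⟨rfl, hzn, hR1, hd1⟩ := h.of_flowsIn hn hyz (by linarith)
  obtain ⟨hR2, hd2, hd3, hd4⟩ := h.of_reachesIn hy (by linarith)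
  have hsT : s ≤ T := by
    by_contra hlt
    push Not at hlt
    have := hd1 T ⟨hT, hlt.le⟩ i
    linarith
  have hφ : ∀ t, φ t (φ s y) = φ (s + t) y := fun t => by rw [← h.isFlow.add hK]
  refine ⟨hsT, h.reachesIn (by linarith) (fun t ht => ?_) (fun t ht => ?_) ?_ ?_⟩
  · rw [hφ]
    exact hR2 _ ⟨by linarith [ht.1], by linarith [ht.2]⟩
  · rw [hφ]
    exact hd2 _ ⟨by linarith [ht.1], by linarith [ht.2]⟩
  · rwa [hφ, add_sub_cancel]
  · rwa [hφ, add_sub_cancel]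

/-- Far from the particles the squared norm decreases at least at unit rate along the drift. -/
theorem le_norm_sq_of_drift_curve (hn : 0 < n) {D : ℝ} (hD : ∀ j, ‖x j‖ ≤ D) {γ : ℝ → Plane}
    {T : ℝ} (hT : 0 ≤ T) (hγ : ∀ t ∈ Icc 0 T, HasDerivWithinAt γ (drift α x (γ t)) (Icc 0 T) t)
    (hfar : ∀ t ∈ Icc 0 T, 3 * D < ‖γ t‖) : T ≤ ‖γ 0‖ ^ 2 := by
  have hder : ∀ t ∈ Icc 0 T, HasDerivWithinAt (fun t => ‖γ t‖ ^ 2 + t)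
      (2 * inner ℝ (γ t) (drift α x (γ t)) + 1) (Icc 0 T) t := fun t ht =>
    (hγ t ht).norm_sq.add (hasDerivWithinAt_id t _)
  have anti : AntitoneOn (fun t => ‖γ t‖ ^ 2 + t) (Icc 0 T) := by
    refine antitoneOn_of_hasDerivWithinAt_nonpos (convex_Icc 0 T)
      (fun t ht => (hder t ht).continuousWithinAt)
      (fun t ht => (hder t (interior_subset ht)).mono interior_subset) fun t ht => ?_
    have := inner_drift_le (α := α) hn hD (hfar t (interior_subset ht))
    rw [real_inner_comm] at this
    linarith
  have := anti (left_mem_Icc.2 hT) (right_mem_Icc.2 hT) hT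
  simp only [add_zero] at this
  nlinarith [sq_nonneg ‖γ T‖]

end Concatenation

/-! ### Trajectories in polar coordinates, with the inverse radius as the variable. -/

section Polar

/-- The unit vector with angle `θ`. -/
noncomputable def dir (θ : ℝ) : Plane := !₂[Real.cos θ, Real.sin θ]

/-- The unit vector orthogonal to `dir θ`. -/
noncomputable def dirPerp (θ : ℝ) : Plane := !₂[-Real.sin θ, Real.cos θ]

theorem circlePoint_eq (r θ : ℝ) : circlePoint r θ = r • dir θ := by
  ext k
  fin_cases k <;> simp [circlePoint, dir]

theorem norm_dir (θ : ℝ) : ‖dir θ‖ = 1 := by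
  rw [EuclideanSpace.norm_eq]
  simp [dir, Fin.sum_univ_two]

theorem norm_circlePoint {r : ℝ} (hr : 0 ≤ r) (θ : ℝ) : ‖circlePoint r θ‖ = r := by
  rw [circlePoint_eq, norm_smul, norm_dir, mul_one, Real.norm_of_nonneg hr]

theorem hasDerivAt_dir (θ : ℝ) : HasDerivAt dir (dirPerp θ) θ := by
  rw [hasDerivAt_iff_hasFDerivAt, ← hasFDerivWithinAt_univ, hasFDerivWithinAt_euclidean]
  intro k
  rw [hasFDerivWithinAt_univ]
  fin_cases k
  · exact (Real.hasDerivAt_cos θ).hasFDerivAt.congr_fderiv (by ext; simp [dirPerp])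
  · exact (Real.hasDerivAt_sin θ).hasFDerivAt.congr_fderiv (by ext; simp [dirPerp])

theorem inner_dir_self (θ : ℝ) : inner ℝ (dir θ) (dir θ) = 1 := by
  rw [real_inner_self_eq_norm_sq, norm_dir, one_pow]

theorem inner_dir_dirPerp (θ : ℝ) : inner ℝ (dir θ) (dirPerp θ) = 0 := by
  simp [dir, dirPerp, PiLp.inner_apply, Fin.sum_univ_two]
  ring

theorem eq_inner_dir_add (v : Plane) (θ : ℝ) :
    v = (inner ℝ v (dir θ) : ℝ) • dir θ + (inner ℝ v (dirPerp θ) : ℝ) • dirPerp θ := by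
  have h := Real.sin_sq_add_cos_sq θ
  ext k
  fin_cases k
  · simp [dir, dirPerp, PiLp.inner_apply, Fin.sum_univ_two]
    linear_combination (-v 0) * h
  · simp [dir, dirPerp, PiLp.inner_apply, Fin.sum_univ_two]
    linear_combination (-v 1) * h

theorem contDiff_dir {k : WithTop ℕ∞} : ContDiff ℝ k dir := by
  rw [contDiff_euclidean]
  intro j
  fin_cases j
  · simpa [dir] using Real.contDiff_cos
  · simpa [dir] using Real.contDiff_sin

theorem contDiff_dirPerp {k : WithTop ℕ∞} : ContDiff ℝ k dirPerp := by
  rw [contDiff_euclidean]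
  intro j
  fin_cases j
  · simpa [dirPerp] using Real.contDiff_sin.neg
  · simpa [dirPerp] using Real.contDiff_cos

variable {n : ℕ}

/-- The derivative of the angle of a drift curve with respect to the inverse `u` of its norm. -/
noncomputable def angularSpeed (α : ℝ) (x : Fin n → Plane) (u θ : ℝ) : ℝ :=
  (∑ j, ‖dir θ - u • x j‖ ^ (-(α + 2)) * inner ℝ (x j) (dirPerp θ)) /
    ∑ j, ‖dir θ - u • x j‖ ^ (-(α + 2)) * (1 - u * inner ℝ (x j) (dir θ))

variable {α : ℝ} {x : Fin n → Plane} {D : ℝ}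

theorem dir_sub_ne_zero (hD : ∀ j, ‖x j‖ ≤ D) {u : ℝ} (hu : 0 ≤ u) (huD : u * (3 * D) < 1)
    (θ : ℝ) (j : Fin n) : dir θ - u • x j ≠ 0 := by
  intro h
  have h1 : ‖dir θ‖ = ‖u • x j‖ := by rw [sub_eq_zero.1 h]
  rw [norm_dir, norm_smul, Real.norm_of_nonneg hu] at h1
  have := mul_le_mul_of_nonneg_left (hD j) hu
  nlinarith

theorem angularSpeed_denom_pos (hn : 0 < n) (hD : ∀ j, ‖x j‖ ≤ D) {u : ℝ} (hu : 0 ≤ u)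
    (huD : u * (3 * D) < 1) (θ : ℝ) :
    0 < ∑ j, ‖dir θ - u • x j‖ ^ (-(α + 2)) * (1 - u * inner ℝ (x j) (dir θ)) := by
  have : Nonempty (Fin n) := ⟨⟨0, hn⟩⟩
  refine Finset.sum_pos (fun j _ => mul_pos (Real.rpow_pos_of_pos
    (norm_pos_iff.2 (dir_sub_ne_zero hD hu huD θ j)) _) ?_) Finset.univ_nonempty
  have h1 := (le_abs_self _).trans (abs_real_inner_le_norm (x j) (dir θ))
  rw [norm_dir, mul_one] at h1
  have h2 := mul_le_mul_of_nonneg_left (h1.trans (hD j)) hu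
  have h3 : 0 ≤ u * D := mul_nonneg hu ((norm_nonneg _).trans (hD j))
  linarith

/-- The domain includes `u = 0`, the circle at infinity; regularity there is the source of the limit
of the probabilities. -/
theorem contDiffOn_angularSpeed (hn : 0 < n) (hD : ∀ j, ‖x j‖ ≤ D) {k : WithTop ℕ∞} :
    ContDiffOn ℝ k (fun p : ℝ × ℝ => angularSpeed α x p.1 p.2)
      {p | 0 ≤ p.1 ∧ p.1 * (3 * D) < 1} := by
  intro p hp
  refine ContDiffAt.contDiffWithinAt ?_
  have hN : ∀ j, ContDiffAt ℝ k (fun p : ℝ × ℝ => ‖dir p.2 - p.1 • x j‖ ^ (-(α + 2))) p := by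
    intro j
    have hne := dir_sub_ne_zero hD hp.1 hp.2 p.2 j
    refine ContDiffAt.rpow_const_of_ne (ContDiffAt.norm ℝ ?_ hne) (norm_ne_zero_iff.2 hne)
    exact ((contDiff_dir.comp contDiff_snd).sub (contDiff_fst.smul contDiff_const)).contDiffAt
  refine ContDiffAt.div (ContDiffAt.sum fun j _ => (hN j).mul ?_)
    (ContDiffAt.sum fun j _ => (hN j).mul ?_) (angularSpeed_denom_pos hn hD hp.1 hp.2 p.2).ne'
  · exact (contDiff_const.inner ℝ (contDiff_dirPerp.comp contDiff_snd)).contDiffAt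
  · exact (contDiff_const.sub (contDiff_fst.mul
      (contDiff_const.inner ℝ (contDiff_dir.comp contDiff_snd)))).contDiffAt

/-- The power of `u` comes out of every distance through `u⁻¹ • dir θ - x j = u⁻¹ • (dir θ - u • x
j)`. The tangential component has the same singular factor `u ^ (α + 1)`, which cancels in the
quotient defining `angularSpeed`. -/
theorem inner_pull_dir {u : ℝ} (hu : 0 < u) (θ : ℝ) :
    inner ℝ (pull α x (u⁻¹ • dir θ)) (dir θ) = -(u ^ (α + 1) *
      ∑ j, ‖dir θ - u • x j‖ ^ (-(α + 2)) * (1 - u * inner ℝ (x j) (dir θ))) := by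
  rw [pull, sum_inner, Finset.mul_sum, ← Finset.sum_neg_distrib]
  refine Finset.sum_congr rfl fun j _ => ?_
  have e1 : u⁻¹ • dir θ - x j = u⁻¹ • (dir θ - u • x j) := by
    rw [smul_sub, smul_smul, inv_mul_cancel₀ hu.ne', one_smul]
  have e2 : (u⁻¹) ^ (-(α + 2)) = u ^ (α + 1) * u := by
    rw [Real.inv_rpow hu.le, ← Real.rpow_neg hu.le, neg_neg, ← Real.rpow_add_one hu.ne']
    congr 1
    ring
  rw [real_inner_smul_left, e1, norm_smul, Real.norm_of_nonneg (inv_nonneg.2 hu.le),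
    Real.mul_rpow (inv_nonneg.2 hu.le) (norm_nonneg _), e2, inner_sub_left, real_inner_smul_left,
    inner_dir_self]
  field_simp
  ring

theorem inner_pull_dirPerp {u : ℝ} (hu : 0 < u) (θ : ℝ) :
    inner ℝ (pull α x (u⁻¹ • dir θ)) (dirPerp θ) = u ^ (α + 1) * u *
      ∑ j, ‖dir θ - u • x j‖ ^ (-(α + 2)) * inner ℝ (x j) (dirPerp θ) := by
  rw [pull, sum_inner, Finset.mul_sum]
  refine Finset.sum_congr rfl fun j _ => ?_
  have e1 : u⁻¹ • dir θ - x j = u⁻¹ • (dir θ - u • x j) := by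
    rw [smul_sub, smul_smul, inv_mul_cancel₀ hu.ne', one_smul]
  have e2 : (u⁻¹) ^ (-(α + 2)) = u ^ (α + 1) * u := by
    rw [Real.inv_rpow hu.le, ← Real.rpow_neg hu.le, neg_neg, ← Real.rpow_add_one hu.ne']
    congr 1
    ring
  rw [real_inner_smul_left, e1, norm_smul, Real.norm_of_nonneg (inv_nonneg.2 hu.le),
    Real.mul_rpow (inv_nonneg.2 hu.le) (norm_nonneg _), e2, inner_sub_left, real_inner_smul_left,
    inner_dir_dirPerp]
  ring

/-- A solution of the equation for the angle gives a curve with the direction of the drift. -/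
theorem polar_velocity_eq (hn : 0 < n) (hD : ∀ j, ‖x j‖ ≤ D) {u : ℝ} (hu : 0 < u)
    (huD : u * (3 * D) < 1) (θ : ℝ) :
    -(u ^ 2)⁻¹ • dir θ + u⁻¹ • angularSpeed α x u θ • dirPerp θ =
      ((u ^ 3)⁻¹ * (-inner ℝ (drift α x (u⁻¹ • dir θ)) (u⁻¹ • dir θ))⁻¹) •
        drift α x (u⁻¹ • dir θ) := by
  have hB := angularSpeed_denom_pos (α := α) hn hD hu.le huD θ
  set v := drift α x (u⁻¹ • dir θ) with hv
  have hy : ∀ j, u⁻¹ • dir θ ≠ x j := fun j h => by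
    refine dir_sub_ne_zero hD hu.le huD θ j ?_
    rw [← h, smul_smul, mul_inv_cancel₀ hu.ne', one_smul, sub_self]
  have hE := weightSum_pos (α := α) hn hy
  set E := weightSum α x (u⁻¹ • dir θ)
  set A := ∑ j, ‖dir θ - u • x j‖ ^ (-(α + 2)) * inner ℝ (x j) (dirPerp θ) with hA
  set B := ∑ j, ‖dir θ - u • x j‖ ^ (-(α + 2)) * (1 - u * inner ℝ (x j) (dir θ)) with hBdef
  have h1 : inner ℝ v (dir θ) = -(E⁻¹ * (u ^ (α + 1) * B)) := by
    rw [hv, drift, real_inner_smul_left, inner_pull_dir hu]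
    ring
  have h2 : inner ℝ v (dirPerp θ) = E⁻¹ * (u ^ (α + 1) * u * A) := by
    rw [hv, drift, real_inner_smul_left, inner_pull_dirPerp hu]
  have hs : angularSpeed α x u θ = A / B := rfl
  have hp : 0 < u ^ (α + 1) := Real.rpow_pos_of_pos hu _
  rw [hs, real_inner_smul_right, h1]
  conv_rhs => rw [eq_inner_dir_add v θ, h1, h2]
  rw [smul_add, smul_smul, smul_smul, smul_smul]
  congr 2
  · field_simp
  · field_simp

end Polar

end GFA

namespace GFA

/-! ### Transport of angles between large circles. -/

section AngleTransport

variable {n : ℕ} {α : ℝ} {x : Fin n → Plane} {D : ℝ}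

/-- Increasing `u` moves the point inwards in the direction of the drift, so a change of time gives
an integral curve. The condition on `u₀` keeps its norm at least `3 * D + 2`, where the drift points
inwards and all particles are further than 1 away; `le_norm_sq_of_drift_curve` bounds the time. -/
theorem exists_flowsIn_of_angle (hn : 0 < n) (hD : ∀ j, ‖x j‖ ≤ D) {u₀ u₁ u₂ : ℝ}
    (hu₀ : u₀ * (3 * D + 2) ≤ 1) (h2 : 0 < u₂) (h21 : u₂ ≤ u₁) (h10 : u₁ ≤ u₀) {Θ : ℝ → ℝ}
    (hΘ : ∀ v ∈ Icc 0 u₀, HasDerivWithinAt Θ (angularSpeed α x v (Θ v)) (Icc 0 u₀) v) :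
    ∃ s ≤ (u₂⁻¹) ^ 2, FlowsIn α x (u₂⁻¹ • dir (Θ u₂)) (u₁⁻¹ • dir (Θ u₁)) s := by
  have hD0 : 0 ≤ D := (norm_nonneg _).trans (hD ⟨0, hn⟩)
  have hsmall : ∀ v ∈ Icc u₂ u₁, 0 < v ∧ v * (3 * D) < 1 ∧ 3 * D + 2 ≤ v⁻¹ := by
    intro v hv
    have hv0 : 0 < v := h2.trans_le hv.1
    have h3 : v * (3 * D + 2) ≤ 1 := by nlinarith [hv.2]
    refine ⟨hv0, by nlinarith, ?_⟩
    rw [le_inv_comm₀ (by linarith) hv0, ← one_div, le_div_iff₀ (by linarith)]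
    exact h3
  have hnorm : ∀ v, 0 < v → ∀ θ, ‖v⁻¹ • dir θ‖ = v⁻¹ := fun v hv θ => by
    rw [norm_smul, norm_dir, mul_one, Real.norm_of_nonneg (inv_nonneg.2 hv.le)]
  set γ : ℝ → Plane := fun t => (u₂ + t)⁻¹ • dir (Θ (u₂ + t)) with hγ
  have hmaps : MapsTo (fun t => u₂ + t) (Icc 0 (u₁ - u₂)) (Icc u₂ u₁) := fun t ht =>
    ⟨by linarith [ht.1], by linarith [ht.2]⟩
  have hin : ∀ t ∈ Icc 0 (u₁ - u₂), inner ℝ (drift α x (γ t)) (γ t) < 0 := fun t ht => by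
    obtain ⟨a, b, c⟩ := hsmall _ (hmaps ht)
    have := inner_drift_le (α := α) hn hD (y := γ t) (by rw [hγ, hnorm _ a]; linarith)
    linarith
  have hne : ∀ t ∈ Icc 0 (u₁ - u₂), ∀ j, γ t ≠ x j := fun t ht j h => by
    obtain ⟨a, b, c⟩ := hsmall _ (hmaps ht)
    have h1 := hnorm _ a (Θ (u₂ + t))
    have h3 := hD j
    rw [← h, hγ, h1] at h3
    linarith
  have hder : ∀ t ∈ Icc 0 (u₁ - u₂), HasDerivWithinAt γ
      ((((u₂ + t) ^ 3)⁻¹ * (-inner ℝ (drift α x (γ t)) (γ t))⁻¹) • drift α x (γ t))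
      (Icc 0 (u₁ - u₂)) t := by
    intro t ht
    obtain ⟨a, b, c⟩ := hsmall _ (hmaps ht)
    have hv := hmaps ht
    have sub : Icc u₂ u₁ ⊆ Icc 0 u₀ := Icc_subset_Icc h2.le h10
    have hd := (hasDerivAt_dir (Θ (u₂ + t))).scomp_hasDerivWithinAt (u₂ + t)
      ((hΘ (u₂ + t) (sub hv)).mono sub)
    have hprod := (hasDerivAt_inv a.ne').hasDerivWithinAt.smul hd
    have hcomp := hprod.scomp t ((hasDerivAt_id t).const_add u₂).hasDerivWithinAt hmaps
    rw [one_smul] at hcomp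
    refine hcomp.congr_deriv ?_
    rw [← polar_velocity_eq hn hD a b, add_comm]
    rfl
  have hcont : ContinuousOn (fun t => ((u₂ + t) ^ 3)⁻¹ * (-inner ℝ (drift α x (γ t)) (γ t))⁻¹)
      (Icc 0 (u₁ - u₂)) := by
    intro t ht
    have hγc := (hder t ht).continuousWithinAt
    have hdc : ContinuousWithinAt (fun t => drift α x (γ t)) (Icc 0 (u₁ - u₂)) t :=
      ((contDiffAt_drift (k := 1) hn (hne t ht)).continuousAt).comp_continuousWithinAt hγc
    refine ContinuousWithinAt.mul (ContinuousWithinAt.inv₀ ?_ ?_)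
      (ContinuousWithinAt.inv₀ ((hdc.inner (𝕜 := ℝ) hγc).neg) ?_)
    · fun_prop
    · exact pow_ne_zero 3 (hsmall _ (hmaps ht)).1.ne'
    · linarith [hin t ht]
  have hpos : ∀ t ∈ Icc 0 (u₁ - u₂),
      0 < ((u₂ + t) ^ 3)⁻¹ * (-inner ℝ (drift α x (γ t)) (γ t))⁻¹ := by
    intro t ht
    have := (hsmall _ (hmaps ht)).1
    have := neg_pos.2 (hin t ht)
    positivity
  obtain ⟨S, hS, σ, σ0, σS, σ1, -, hσ⟩ :=
    exists_reparam (γ := γ) (v := drift α x) (sub_nonneg.2 h21) hcont hpos hder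
  have hfar : ∀ t ∈ Icc 0 S, 3 * D + 2 ≤ ‖γ (σ t)‖ := fun t ht => by
    obtain ⟨a, b, c⟩ := hsmall _ (hmaps (σ1 ht))
    rwa [hγ, hnorm _ a]
  refine ⟨S, ?_, hS, γ ∘ σ, by simp [hγ, σ0], by simp [hγ, σS], hσ, fun t ht j => ?_⟩
  · have := le_norm_sq_of_drift_curve (γ := γ ∘ σ) hn hD hS hσ
      (fun t ht => by linarith [hfar t ht, show ‖(γ ∘ σ) t‖ = ‖γ (σ t)‖ from rfl])
    simpa only [Function.comp_apply, σ0, hγ, add_zero, hnorm _ h2] using this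
  · rw [dist_eq_norm]
    have := norm_sub_norm_le (γ (σ t)) (x j)
    have := hfar t ht
    have := hD j
    change 1 < ‖γ (σ t) - x j‖
    linarith

/-- Clamping the angle to a compact interval makes the field globally bounded and Lipschitz. The
interval `[-1, 8]` contains every angle within 1 of `[0, 2π)`. -/
theorem exists_clamped_angularSpeed (α : ℝ) (hn : 0 < n) (hD : ∀ j, ‖x j‖ ≤ D) {u₀ : ℝ}
    (hu₀ : u₀ * (3 * D) < 1) : ∃ (C K : ℝ≥0) (g : ℝ → ℝ → ℝ),
      (∀ u ∈ Icc 0 u₀, ∀ θ ∈ Icc (-1 : ℝ) 8, g u θ = angularSpeed α x u θ) ∧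
      (∀ u ∈ Icc 0 u₀, LipschitzWith K (g u)) ∧ (∀ u ∈ Icc 0 u₀, ∀ θ, ‖g u θ‖ ≤ C) ∧
      ∀ θ, ContinuousOn (fun u => g u θ) (Icc 0 u₀) := by
  have hD0 : 0 ≤ D := (norm_nonneg _).trans (hD ⟨0, hn⟩)
  set Q : Set (ℝ × ℝ) := Icc 0 u₀ ×ˢ Icc (-1) 8 with hQ
  have Qc : IsCompact Q := isCompact_Icc.prod isCompact_Icc
  have hsm : ContDiffOn ℝ 1 (fun p : ℝ × ℝ => angularSpeed α x p.1 p.2) Q :=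
    (contDiffOn_angularSpeed hn hD).mono fun p hp =>
      ⟨hp.1.1, (mul_le_mul_of_nonneg_right hp.1.2 (by positivity)).trans_lt hu₀⟩
  obtain ⟨K, hK⟩ := hsm.exists_lipschitzOnWith one_ne_zero ((convex_Icc _ _).prod (convex_Icc _ _))
    Qc
  obtain ⟨C, hC⟩ := Qc.exists_bound_of_continuousOn hsm.continuousOn
  have h18 : (-1 : ℝ) ≤ 8 := by norm_num
  refine ⟨C.toNNReal, K, fun u θ => angularSpeed α x u (projIcc (-1) 8 h18 θ), ?_, ?_, ?_, ?_⟩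
  · intro u _ θ hθ
    simp only [projIcc_of_mem h18 hθ]
  · intro u hu
    refine LipschitzWith.of_dist_le_mul fun θ θ' => ?_
    have h1 := hK.dist_le_mul (u, (projIcc (-1) 8 h18 θ : ℝ)) ⟨hu, (projIcc (-1) 8 h18 θ).2⟩
      (u, (projIcc (-1) 8 h18 θ' : ℝ)) ⟨hu, (projIcc (-1) 8 h18 θ').2⟩
    refine h1.trans (mul_le_mul_of_nonneg_left ?_ K.2)
    rw [Prod.dist_eq, dist_self, max_eq_right dist_nonneg]
    have := (LipschitzWith.projIcc h18).dist_le_mul θ θ'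
    rwa [NNReal.coe_one, one_mul] at this
  · intro u hu θ
    exact (hC (u, (projIcc (-1) 8 h18 θ : ℝ)) ⟨hu, (projIcc (-1) 8 h18 θ).2⟩).trans
      (Real.le_coe_toNNReal C)
  · intro θ
    exact hsm.continuousOn.comp (f := fun u => (u, (projIcc (-1) 8 h18 θ : ℝ)))
      (by fun_prop) fun u hu => ⟨hu, (projIcc (-1) 8 h18 θ).2⟩

/-- Following the drift from one large circle to another changes angles and angular distances only
a little. -/
theorem exists_angle_transport (α : ℝ) (x : Fin n → Plane) (hn : 0 < n) :
    ∃ C u₀ : ℝ, 0 ≤ C ∧ 0 < u₀ ∧ ∀ ε ∈ Ioc 0 u₀, ∀ r r', ε⁻¹ ≤ r → ε⁻¹ ≤ r' → ∃ h : ℝ → ℝ,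
      (∀ θ ∈ Ico 0 (2 * Real.pi), |h θ - θ| ≤ C * ε) ∧
      (∀ θ ∈ Ico 0 (2 * Real.pi), ∀ θ' ∈ Ico 0 (2 * Real.pi),
        |θ - θ'| ≤ Real.exp (C * ε) * |h θ - h θ'|) ∧
      ∀ θ ∈ Ico 0 (2 * Real.pi), ∀ i T, ReachesIn α x i (circlePoint r θ) T →
        ∃ T' ≤ T + r' ^ 2, ReachesIn α x i (circlePoint r' (h θ)) T' := by
  obtain ⟨D, hD⟩ : ∃ D, ∀ j, ‖x j‖ ≤ D :=
    ⟨∑ j, ‖x j‖, fun j => Finset.single_le_sum (f := fun j => ‖x j‖) (fun _ _ => norm_nonneg _)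
      (Finset.mem_univ j)⟩
  have hD0 : 0 ≤ D := (norm_nonneg _).trans (hD ⟨0, hn⟩)
  have hu₁ : (3 * D + 2)⁻¹ * (3 * D) < 1 := by
    rw [inv_mul_lt_iff₀ (by linarith)]
    linarith
  obtain ⟨C, K, g, hg, hgK, hgC, hgc⟩ := exists_clamped_angularSpeed α hn hD hu₁
  -- The first bound keeps the circles far from the particles; the second limits the change of angle
  -- to 1, so the clamp is never active.
  set u₀ := min (3 * D + 2)⁻¹ (C + 1 : ℝ)⁻¹ with hu₀def
  have hu₀ : 0 < u₀ := by positivity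
  have hu₀D : u₀ * (3 * D + 2) ≤ 1 := by
    have := mul_le_mul_of_nonneg_right (min_le_left (3 * D + 2)⁻¹ (C + 1 : ℝ)⁻¹)
      (show 0 ≤ 3 * D + 2 by linarith)
    rwa [inv_mul_cancel₀ (by linarith)] at this
  have hu₀C : C * u₀ ≤ 1 := by
    have := mul_le_mul_of_nonneg_right (min_le_right (3 * D + 2)⁻¹ (C + 1 : ℝ)⁻¹)
      (show (0 : ℝ) ≤ C + 1 by positivity)
    rw [inv_mul_cancel₀ (by positivity)] at this
    linarith
  have sub : Icc 0 u₀ ⊆ Icc 0 (3 * D + 2)⁻¹ := Icc_subset_Icc_right (min_le_left _ _)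
  refine ⟨max C K, u₀, le_max_of_le_left C.2, hu₀, fun ε hε r r' hr hr' => ?_⟩
  have hu : ∀ {ρ : ℝ}, ε⁻¹ ≤ ρ → 0 < ρ ∧ 0 < ρ⁻¹ ∧ ρ⁻¹ ≤ ε := fun {ρ} hρ => by
    have h1 : 0 < ρ := (inv_pos.2 hε.1).trans_le hρ
    exact ⟨h1, inv_pos.2 h1, inv_le_of_inv_le₀ hε.1 hρ⟩
  obtain ⟨hr0, hru, hrε⟩ := hu hr
  obtain ⟨hr0', hru', hrε'⟩ := hu hr'
  have hm : r⁻¹ ∈ Icc 0 u₀ := ⟨hru.le, hrε.trans hε.2⟩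
  have hm' : r'⁻¹ ∈ Icc 0 u₀ := ⟨hru'.le, hrε'.trans hε.2⟩
  have hdiff : |r'⁻¹ - r⁻¹| ≤ ε := abs_le.2 ⟨by linarith, by linarith⟩
  choose Θ hΘ₀ hΘ using fun θ : ℝ => exists_integralCurve_Icc (v := g) (a := 0) (b := u₀)
    (t₀ := r⁻¹) hm (fun t ht => hgK t (sub ht)) (fun y => (hgc y).mono sub)
    (fun t ht y => hgC t (sub ht) y) θ
  have hmove : ∀ θ, ∀ v ∈ Icc 0 u₀, |Θ θ v - θ| ≤ C * |v - r⁻¹| := by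
    intro θ v hv
    have := (convex_Icc 0 u₀).norm_image_sub_le_of_norm_hasDerivWithin_le (C := C) (hΘ θ)
      (fun w hw => hgC w (sub hw) _) hm hv
    rwa [hΘ₀] at this
  refine ⟨fun θ => Θ θ r'⁻¹, fun θ _ => ?_, fun θ _ θ' _ => ?_, fun θ hθ i T hreach => ?_⟩
  · refine (hmove θ _ hm').trans ?_
    exact mul_le_mul (le_max_left _ _) hdiff (abs_nonneg _) (le_max_of_le_left C.2)
  · have := dist_le_of_integralCurves (v := g) (a := 0) (b := u₀)
      (fun t ht => hgK t (sub ht)) (hΘ θ) (hΘ θ') hm' hm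
    rw [hΘ₀, hΘ₀, Real.dist_eq, Real.dist_eq, mul_comm] at this
    refine this.trans (mul_le_mul_of_nonneg_right (Real.exp_le_exp.2 ?_) (abs_nonneg _))
    rw [abs_sub_comm]
    exact mul_le_mul (le_max_right _ _) hdiff (abs_nonneg _) (le_max_of_le_left C.2)
  · have hpi := Real.pi_lt_d2
    have hsol : ∀ v ∈ Icc 0 u₀,
        HasDerivWithinAt (Θ θ) (angularSpeed α x v (Θ θ v)) (Icc 0 u₀) v := by
      intro v hv
      have h1 := abs_le.1 (hmove θ v hv)
      have h2 : (C : ℝ) * |v - r⁻¹| ≤ 1 := by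
        refine le_trans (mul_le_mul_of_nonneg_left ?_ C.2) hu₀C
        exact abs_le.2 ⟨by linarith [hv.1, hm.2], by linarith [hv.2, hm.1]⟩
      rw [← hg v (sub hv) (Θ θ v) ⟨by linarith [hθ.1, h1.1], by linarith [hθ.2, h1.2]⟩]
      exact hΘ θ v hv
    have e1 : circlePoint r θ = (r⁻¹)⁻¹ • dir (Θ θ r⁻¹) := by
      rw [circlePoint_eq, inv_inv, hΘ₀]
    have e2 : circlePoint r' (Θ θ r'⁻¹) = (r'⁻¹)⁻¹ • dir (Θ θ r'⁻¹) := by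
      rw [circlePoint_eq, inv_inv]
    rw [e1] at hreach
    simp only [e2]
    -- Transport inwards cuts off an initial piece of the trajectory; transport outwards prepends
    -- one that takes time at most `r' ^ 2`.
    rcases le_total r⁻¹ r'⁻¹ with hle | hle
    · obtain ⟨s, -, hs⟩ := exists_flowsIn_of_angle hn hD hu₀D hru hle hm'.2 hsol
      obtain ⟨hsT, hz⟩ := hreach.drop hs
      exact ⟨T - s, by nlinarith [hs.1, sq_nonneg r'], hz⟩
    · obtain ⟨s, hs2, hs⟩ := exists_flowsIn_of_angle hn hD hu₀D hru' hle hm.2 hsol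
      rw [inv_inv] at hs2
      exact ⟨s + T, by linarith, hreach.prepend hs⟩

end AngleTransport

/-! ### Existence of the attachment probabilities. -/

section Limit

variable {n : ℕ} {α : ℝ} {x : Fin n → Plane} {i : Fin n}

/-- On the image the inverse of `h` is `L`-Lipschitz, and Lebesgue measure on the line is
one-dimensional Hausdorff measure, so `A` may be arbitrary. -/
theorem volume_le_mul_volume_image {h : ℝ → ℝ} {A : Set ℝ} {L : ℝ}
    (hL : ∀ a ∈ A, ∀ b ∈ A, |a - b| ≤ L * |h a - h b|) :
    volume A ≤ ENNReal.ofReal L * volume (h '' A) := by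
  rcases A.eq_empty_or_nonempty with rfl | ⟨a₀, ha₀⟩
  · simp
  have inj : InjOn h A := fun a ha b hb hab => by
    have := hL a ha b hb
    rw [hab, sub_self, abs_zero, mul_zero] at this
    exact sub_eq_zero.1 (abs_nonpos_iff.1 this)
  have : Nonempty ℝ := ⟨a₀⟩
  have hinv : LeftInvOn (Function.invFunOn h A) h A := inj.leftInvOn_invFunOn
  have hlip : LipschitzOnWith L.toNNReal (Function.invFunOn h A) (h '' A) := by
    refine LipschitzOnWith.of_dist_le_mul ?_
    rintro _ ⟨a, ha, rfl⟩ _ ⟨b, hb, rfl⟩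
    rw [hinv ha, hinv hb, Real.dist_eq, Real.dist_eq]
    exact (hL a ha b hb).trans (mul_le_mul_of_nonneg_right (Real.le_coe_toNNReal L) (abs_nonneg _))
  have key := hlip.hausdorffMeasure_image_le zero_le_one
  rw [hinv.image_image, hausdorffMeasure_real, ENNReal.rpow_one] at key
  exact key

/-- The angles in `[0, 2π)` from which the circle of radius `r` is connected to `x i`, in time at
most `T`. -/
def reachAngles (α : ℝ) (x : Fin n → Plane) (i : Fin n) (r T : ℝ) : Set ℝ :=
  {θ | θ ∈ Ico 0 (2 * Real.pi) ∧ ∃ t ≤ T, ReachesIn α x i (circlePoint r θ) t}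

/-- Angles may leave `[0, 2π)` by at most `δ` at each end, which accounts for the term `2 * δ`. -/
theorem volume_le_of_angle_transport {P Q : ℝ → Prop} {h : ℝ → ℝ} {L δ : ℝ} (hδ : 0 ≤ δ)
    (h1 : ∀ θ ∈ Ico 0 (2 * Real.pi), |h θ - θ| ≤ δ)
    (h2 : ∀ θ ∈ Ico 0 (2 * Real.pi), ∀ θ' ∈ Ico 0 (2 * Real.pi), |θ - θ'| ≤ L * |h θ - h θ'|)
    (h3 : ∀ θ ∈ Ico 0 (2 * Real.pi), P θ → Q (h θ)) :
    volume {θ | θ ∈ Ico 0 (2 * Real.pi) ∧ P θ} ≤ ENNReal.ofReal L *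
      (volume {θ | θ ∈ Ico 0 (2 * Real.pi) ∧ Q θ} + ENNReal.ofReal (2 * δ)) := by
  refine (volume_le_mul_volume_image (h := h) (L := L) fun a ha b hb => h2 a ha.1 b hb.1).trans ?_
  gcongr
  have hsub : h '' {θ | θ ∈ Ico 0 (2 * Real.pi) ∧ P θ} ⊆
      {θ | θ ∈ Ico 0 (2 * Real.pi) ∧ Q θ} ∪
        (Icc (-δ) 0 ∪ Icc (2 * Real.pi) (2 * Real.pi + δ)) := by
    rintro _ ⟨θ, ⟨hθ, hP⟩, rfl⟩
    have hab := abs_le.1 (h1 θ hθ)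
    by_cases hm : h θ ∈ Ico 0 (2 * Real.pi)
    · exact Or.inl ⟨hm, h3 θ hθ hP⟩
    · refine Or.inr ?_
      rw [mem_Ico, not_and_or, not_le, not_lt] at hm
      rcases hm with hm | hm
      · exact Or.inl ⟨by linarith [hθ.1, hab.1], hm.le⟩
      · exact Or.inr ⟨hm, by linarith [hθ.2, hab.2]⟩
  refine (measure_mono hsub).trans ((measure_union_le _ _).trans ?_)
  gcongr
  refine (measure_union_le _ _).trans (le_of_eq ?_)
  rw [Real.volume_Icc, Real.volume_Icc, ← ENNReal.ofReal_add (by linarith) (by linarith)]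
  congr 1
  ring

theorem volume_angles_ne_top (P : ℝ → Prop) :
    volume {θ | θ ∈ Ico 0 (2 * Real.pi) ∧ P θ} ≠ ⊤ :=
  ((measure_mono fun _ h => h.1).trans_lt measure_Ico_lt_top).ne

theorem toReal_volume_angles_le (P : ℝ → Prop) :
    (volume {θ | θ ∈ Ico 0 (2 * Real.pi) ∧ P θ}).toReal ≤ 2 * Real.pi := by
  refine ENNReal.toReal_le_of_le_ofReal (by positivity) ((measure_mono fun _ h => h.1).trans ?_)
  rw [Real.volume_Ico, sub_zero]

/-- The attachment probabilities have a limit, for every configuration of particles. -/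
theorem exists_hasAttachProb (hα : 0 ≤ α) (x : Fin n → Plane) (i : Fin n) :
    ∃ p, HasAttachProb α x i p := by
  obtain ⟨C, u₀, hC, hu₀, hT⟩ := exists_angle_transport α x i.pos
  -- The roles of `r` and `r'` can be exchanged, so any two circles beyond `ε⁻¹` have nearly equal
  -- probabilities.
  have step : ∀ ε ∈ Ioc 0 u₀, ∀ r r', ε⁻¹ ≤ r → ε⁻¹ ≤ r' →
      attachProbFrom α x i r ≤ attachProbFrom α x i r' +
        ((Real.exp (C * ε) - 1) + Real.exp (C * ε) * (2 * (C * ε))) := by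
    intro ε hε r r' hr hr'
    have hCε : 0 ≤ C * ε := mul_nonneg hC hε.1.le
    obtain ⟨h, h1, h2, h3⟩ := hT ε hε r r' hr hr'
    have key := volume_le_of_angle_transport (P := fun θ => AttachesTo α x i (circlePoint r θ))
      (Q := fun θ => AttachesTo α x i (circlePoint r' θ)) hCε h1 h2 (fun θ hθ hP => by
        rw [attachesTo_iff hα] at hP ⊢
        obtain ⟨T, hP⟩ := hP
        obtain ⟨T', -, hT'⟩ := h3 θ hθ i T hP
        exact ⟨T', hT'⟩)
    set a := volume {θ | θ ∈ Ico 0 (2 * Real.pi) ∧ AttachesTo α x i (circlePoint r θ)}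
    set b := volume {θ | θ ∈ Ico 0 (2 * Real.pi) ∧ AttachesTo α x i (circlePoint r' θ)} with hb
    have hbt : b ≠ ⊤ := volume_angles_ne_top _
    have hb2 : b.toReal ≤ 2 * Real.pi := toReal_volume_angles_le _
    have key' : a.toReal ≤ Real.exp (C * ε) * (b.toReal + 2 * (C * ε)) := by
      have := ENNReal.toReal_mono (ENNReal.mul_ne_top ENNReal.ofReal_ne_top
        (ENNReal.add_ne_top.2 ⟨hbt, ENNReal.ofReal_ne_top⟩)) key
      rwa [ENNReal.toReal_mul, ENNReal.toReal_add hbt ENNReal.ofReal_ne_top,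
        ENNReal.toReal_ofReal (Real.exp_pos _).le, ENNReal.toReal_ofReal (by positivity)] at this
    have hpi : 1 ≤ 2 * Real.pi := by linarith [Real.pi_gt_three]
    change a.toReal / (2 * Real.pi) ≤ b.toReal / (2 * Real.pi) + _
    rw [div_le_iff₀ (by positivity), add_mul, div_mul_cancel₀ _ (by positivity)]
    have he : 1 ≤ Real.exp (C * ε) := Real.one_le_exp hCε
    have h5 : (Real.exp (C * ε) - 1) * b.toReal ≤ (Real.exp (C * ε) - 1) * (2 * Real.pi) :=
      mul_le_mul_of_nonneg_left hb2 (by linarith)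
    have h6 : Real.exp (C * ε) * (2 * (C * ε)) ≤
        Real.exp (C * ε) * (2 * (C * ε)) * (2 * Real.pi) :=
      le_mul_of_one_le_right (by positivity) hpi
    nlinarith
  have lim : Tendsto (fun ε : ℝ => (Real.exp (C * ε) - 1) + Real.exp (C * ε) * (2 * (C * ε)))
      (𝓝[>] 0) (𝓝 0) := by
    have hc : Continuous fun ε : ℝ =>
        (Real.exp (C * ε) - 1) + Real.exp (C * ε) * (2 * (C * ε)) := by fun_prop
    have := hc.tendsto 0
    simp only [mul_zero, Real.exp_zero, sub_self, add_zero] at this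
    exact this.mono_left nhdsWithin_le_nhds
  have hcauchy : CauchySeq (attachProbFrom α x i) := by
    refine Metric.cauchySeq_iff.2 fun δ hδ => ?_
    have hev : ∀ᶠ ε : ℝ in 𝓝[>] 0, ε ∈ Ioc 0 u₀ := Ioc_mem_nhdsGT hu₀
    obtain ⟨ε, hε, hlt⟩ := (hev.and (lim.eventually (gt_mem_nhds hδ))).exists
    refine ⟨ε⁻¹, fun r hr r' hr' => ?_⟩
    rw [Real.dist_eq, abs_lt]
    constructor
    · linarith [step ε hε r' r hr' hr]
    · linarith [step ε hε r r' hr hr']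
  exact cauchySeq_tendsto_of_complete hcauchy

end Limit

end GFA

namespace GFA

/-! ### Area from angular slices. -/

section PolarArea

/-- `polarCoord` has angles in `(-π, π)`; negating the point shifts them to `(0, 2π)`. -/
theorem measurePreserving_neg_vec :
    MeasurePreserving (fun p : ℝ × ℝ => -(!₂[p.1, p.2] : Plane)) volume volume := by
  have h1 : MeasurePreserving (fun p : ℝ × ℝ => (!₂[p.1, p.2] : Plane)) volume volume := by
    have := (PiLp.volume_preserving_toLp (Fin 2)).comp (volume_preserving_finTwoArrow ℝ).symm
    exact this
  exact (LinearIsometryEquiv.neg ℝ (E := Plane)).measurePreserving.comp h1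

theorem neg_vec_polarCoord_symm (ρ φ : ℝ) :
    -(!₂[(polarCoord.symm (ρ, φ)).1, (polarCoord.symm (ρ, φ)).2] : Plane) =
      circlePoint ρ (φ + Real.pi) := by
  ext k
  fin_cases k <;> simp [circlePoint, Real.cos_add_pi, Real.sin_add_pi]

theorem continuous_circlePoint : Continuous fun p : ℝ × ℝ => circlePoint p.1 p.2 := by
  have : (fun p : ℝ × ℝ => circlePoint p.1 p.2) = fun p => p.1 • dir p.2 :=
    funext fun p => circlePoint_eq p.1 p.2
  rw [this]
  exact continuous_fst.smul ((contDiff_dir (k := 0)).continuous.comp continuous_snd)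

/-- A lower bound for the area of a set that meets every circle of an annulus in many angles. -/
theorem le_volume_of_le_volume_angles {S : Set Plane} {a b c : ℝ} (ha : 0 ≤ a) (hab : a ≤ b)
    (hc : 0 ≤ c) (h : ∀ ρ ∈ Icc a b,
      ENNReal.ofReal c ≤ volume {θ | θ ∈ Ico 0 (2 * Real.pi) ∧ circlePoint ρ θ ∈ S}) :
    ENNReal.ofReal (c * ((b ^ 2 - a ^ 2) / 2)) ≤ volume S := by
  -- Tonelli needs measurability; the hull has the same area as `S`, and its slices are only larger.
  set T := toMeasurable volume S with hT
  have Tm : MeasurableSet T := measurableSet_toMeasurable _ _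
  set m : ℝ × ℝ → Plane := fun p => -(!₂[p.1, p.2] : Plane) with hm
  have mp : MeasurePreserving m volume volume := measurePreserving_neg_vec
  set ind : Plane → ℝ≥0∞ := T.indicator 1 with hind
  have indm : Measurable ind := measurable_one.indicator Tm
  have cm : Measurable fun p : ℝ × ℝ => circlePoint p.1 (p.2 + Real.pi) :=
    (continuous_circlePoint.comp
      (continuous_fst.prodMk (continuous_snd.add continuous_const))).measurable
  have hslice : ∀ ρ ∈ Icc a b, ENNReal.ofReal c ≤
      ∫⁻ φ in Ioo (-Real.pi) Real.pi, ind (circlePoint ρ (φ + Real.pi)) := by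
    intro ρ hρ
    set U : Set ℝ := {θ | circlePoint ρ θ ∈ T} with hU
    have Um : MeasurableSet U :=
      (continuous_circlePoint.comp (continuous_const.prodMk continuous_id)).measurable Tm
    have e1 : ∀ φ, ind (circlePoint ρ (φ + Real.pi)) =
        ((fun φ => φ + Real.pi) ⁻¹' U).indicator 1 φ := fun φ => rfl
    simp_rw [e1]
    have Vm : MeasurableSet ((fun φ => φ + Real.pi) ⁻¹' U) :=
      (measurable_id.add_const Real.pi) Um
    rw [lintegral_indicator_one Vm, Measure.restrict_apply Vm]
    have e2 : (fun φ => φ + Real.pi) ⁻¹' U ∩ Ioo (-Real.pi) Real.pi =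
        (fun φ => φ + Real.pi) ⁻¹' (U ∩ Ioo 0 (2 * Real.pi)) := by
      ext φ
      simp only [mem_inter_iff, mem_preimage, mem_Ioo]
      refine and_congr_right fun _ => ⟨fun hφ => ⟨by linarith [hφ.1], by linarith [hφ.2]⟩,
        fun hφ => ⟨by linarith [hφ.1], by linarith [hφ.2]⟩⟩
    rw [e2, measure_preimage_add_right]
    refine (h ρ hρ).trans ?_
    have e3 : volume (U ∩ Ioo 0 (2 * Real.pi)) = volume (U ∩ Ico 0 (2 * Real.pi)) :=
      measure_congr ((ae_eq_refl U).inter Ioo_ae_eq_Ico)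
    rw [e3]
    exact measure_mono fun θ hθ => ⟨subset_toMeasurable _ _ hθ.2, hθ.1⟩
  have hconst : ∫⁻ ρ in Ioc a b, ENNReal.ofReal ρ * ENNReal.ofReal c =
      ENNReal.ofReal (c * ((b ^ 2 - a ^ 2) / 2)) := by
    have hnn : 0 ≤ᵐ[volume.restrict (Ioc a b)] fun ρ : ℝ => ρ * c := by
      filter_upwards [ae_restrict_mem measurableSet_Ioc] with ρ hρ
      exact mul_nonneg (ha.trans hρ.1.le) hc
    have hint : Integrable (fun ρ : ℝ => ρ * c) (volume.restrict (Ioc a b)) :=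
      ((continuous_id.mul continuous_const).integrableOn_Icc).mono_set Ioc_subset_Icc_self
    have := ofReal_integral_eq_lintegral_ofReal hint hnn
    rw [← intervalIntegral.integral_of_le hab, intervalIntegral.integral_mul_const, integral_id]
      at this
    rw [mul_comm c, this]
    refine lintegral_congr fun ρ => ?_
    rw [ENNReal.ofReal_mul' hc]
  have hvol : volume S = ∫⁻ p in polarCoord.target,
      ENNReal.ofReal p.1 * ind (circlePoint p.1 (p.2 + Real.pi)) := by
    rw [← measure_toMeasurable S, ← mp.measure_preimage Tm.nullMeasurableSet,
      ← lintegral_indicator_one (mp.measurable Tm), ← lintegral_comp_polarCoord_symm]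
    refine lintegral_congr fun p => ?_
    rw [smul_eq_mul]
    congr 1
    rw [hind, ← neg_vec_polarCoord_symm]
    rfl
  have fm : Measurable fun p : ℝ × ℝ =>
      ENNReal.ofReal p.1 * ind (circlePoint p.1 (p.2 + Real.pi)) :=
    (measurable_fst.ennreal_ofReal).mul (indm.comp cm)
  rw [hvol, polarCoord_target, Measure.volume_eq_prod, ← Measure.prod_restrict,
    lintegral_prod _ fm.aemeasurable, ← hconst]
  refine le_trans ?_ (lintegral_mono_set (fun ρ hρ => ha.trans_lt hρ.1 :
    Ioc a b ⊆ Ioi 0))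
  refine setLIntegral_mono' measurableSet_Ioc fun ρ hρ => ?_
  have gm : Measurable fun φ : ℝ => ind (circlePoint ρ (φ + Real.pi)) :=
    indm.comp (cm.comp (measurable_const.prodMk measurable_id))
  change _ ≤ ∫⁻ φ in Ioo (-Real.pi) Real.pi, ENNReal.ofReal ρ * ind (circlePoint ρ (φ + Real.pi))
  rw [lintegral_const_mul _ gm]
  exact mul_le_mul_right (hslice ρ ⟨hρ.1.le, hρ.2⟩) _

end PolarArea

/-! ### The upper bound for the attachment probabilities. -/

section UpperBound

variable {n : ℕ} {α : ℝ} {x : Fin n → Plane} {i : Fin n}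

/-- By `htr`, at least the measure `c` of angles on each larger circle of radius `ρ` hits within `T
+ ρ ^ 2`. Comparing the swept area with `volume_reachesIn_le` gives `c (R² - r²) / 2 ≤ 6 M (T + R²)
w` for all `R ≥ r`, and large `R` leaves `c ≤ 12 M w`. -/
theorem volume_reachAngles_le (hα : 0 ≤ α) {M : ℝ} (hM0 : 0 ≤ M) (hM1 : M ≤ 1)
    (hM : ∀ y, (∀ j, 1 ≤ dist y (x j)) → dist y (x i) ≤ 2 → ‖drift α x y‖ ≤ M) {r T L δ : ℝ}
    (hr : 1 ≤ r) (hT : 0 ≤ T) (hL : 1 ≤ L) (hδ : 0 ≤ δ)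
    (htr : ∀ r' ≥ r, volume (reachAngles α x i r T) ≤
      ENNReal.ofReal L * (volume (reachAngles α x i r' (T + r' ^ 2)) + ENNReal.ofReal δ)) :
    (volume (reachAngles α x i r T)).toReal ≤
      L * (12 * M * (volume (Metric.ball (0 : Plane) 1)).toReal + δ) := by
  set w := (volume (Metric.ball (0 : Plane) 1)).toReal with hw
  have hwt : volume (Metric.ball (0 : Plane) 1) = ENNReal.ofReal w :=
    (ENNReal.ofReal_toReal measure_ball_lt_top.ne).symm
  have hw0 : 0 ≤ w := ENNReal.toReal_nonneg
  set c₀ := (volume (reachAngles α x i r T)).toReal with hc₀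
  have hL0 : 0 < L := by linarith
  set c := c₀ / L - δ with hc
  suffices h : c ≤ 12 * M * w by
    have : c₀ / L ≤ 12 * M * w + δ := by linarith
    rw [div_le_iff₀ hL0] at this
    linarith
  by_contra hlt
  push Not at hlt
  have hMw : 0 ≤ 12 * M * w := by positivity
  have hc0 : 0 ≤ c := hMw.trans hlt.le
  have harea : ∀ R ≥ r, c * ((R ^ 2 - r ^ 2) / 2) ≤ 6 * M * (T + R ^ 2) * w := by
    intro R hR
    set S : Set Plane := {y | ‖y‖ ≤ R ∧ ∃ t ≤ T + R ^ 2, ReachesIn α x i y t} with hS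
    have h1 : volume S ≤ ENNReal.ofReal (6 * M * (T + R ^ 2)) * ENNReal.ofReal w := by
      rw [← hwt]
      exact volume_reachesIn_le hα hM0 hM1 hM (R := R) (by nlinarith) fun y hy => hy
    have h2 : ENNReal.ofReal (c * ((R ^ 2 - r ^ 2) / 2)) ≤ volume S := by
      refine le_volume_of_le_volume_angles (by linarith) hR hc0 fun ρ hρ => ?_
      have hρ0 : 0 ≤ ρ := by linarith [hρ.1]
      have h3 : volume (reachAngles α x i ρ (T + ρ ^ 2)) ≤
          volume {θ | θ ∈ Ico 0 (2 * Real.pi) ∧ circlePoint ρ θ ∈ S} := by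
        refine measure_mono fun θ hθ => ⟨hθ.1, ?_, ?_⟩
        · rw [norm_circlePoint hρ0]
          exact hρ.2
        · obtain ⟨t, ht, hreach⟩ := hθ.2
          have : ρ ^ 2 ≤ R ^ 2 := by gcongr; exact hρ.2
          exact ⟨t, by linarith, hreach⟩
      refine le_trans ?_ h3
      have h4 := htr ρ hρ.1
      have hfin : volume (reachAngles α x i ρ (T + ρ ^ 2)) ≠ ⊤ := volume_angles_ne_top _
      have h5 := ENNReal.toReal_mono (ENNReal.mul_ne_top ENNReal.ofReal_ne_top
        (ENNReal.add_ne_top.2 ⟨hfin, ENNReal.ofReal_ne_top⟩)) h4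
      rw [ENNReal.toReal_mul, ENNReal.toReal_add hfin ENNReal.ofReal_ne_top,
        ENNReal.toReal_ofReal hL0.le, ENNReal.toReal_ofReal hδ, ← hc₀] at h5
      refine ENNReal.ofReal_le_of_le_toReal ?_
      have h6 : c₀ / L ≤ (volume (reachAngles α x i ρ (T + ρ ^ 2))).toReal + δ := by
        rw [div_le_iff₀ hL0]
        linarith
      linarith
    have h3 := h2.trans h1
    rw [← ENNReal.ofReal_mul (by positivity)] at h3
    exact (ENNReal.ofReal_le_ofReal_iff (by positivity)).1 h3
  set g := c - 12 * M * w with hg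
  have hg0 : 0 < g := by linarith
  set B := c * r ^ 2 + 12 * M * T * w with hB
  have hB0 : 0 ≤ B := by positivity
  -- The area inequality rearranges to `g R² ≤ B`, which this `R` violates.
  set R := max r (B / g + 1) with hR
  have h1 := harea R (le_max_left _ _)
  have h2 : B / g + 1 ≤ R := le_max_right _ _
  have h3 : B < g * R := by
    rw [← div_lt_iff₀' hg0]
    linarith
  have h4 : 1 ≤ R := hr.trans (le_max_left _ _)
  have h5 : g * R ≤ g * R ^ 2 := by nlinarith
  nlinarith

/-- If the drift is bounded by `M` near a particle, its attachment probability is at most a multiple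
of `M`. -/
theorem HasAttachProb.le_of_norm_drift_le (hα : 0 ≤ α) {M p : ℝ} (hM0 : 0 ≤ M) (hM1 : M ≤ 1)
    (hM : ∀ y, (∀ j, 1 ≤ dist y (x j)) → dist y (x i) ≤ 2 → ‖drift α x y‖ ≤ M)
    (hp : HasAttachProb α x i p) :
    p ≤ 12 * M * (volume (Metric.ball (0 : Plane) 1)).toReal := by
  set w := (volume (Metric.ball (0 : Plane) 1)).toReal
  have hw0 : 0 ≤ w := ENNReal.toReal_nonneg
  obtain ⟨C, u₀, hC, hu₀, htr⟩ := exists_angle_transport α x i.pos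
  have hbound : ∀ r ≥ max 1 u₀⁻¹, attachProbFrom α x i r ≤
      Real.exp (C * r⁻¹) * (12 * M * w + 2 * (C * r⁻¹)) := by
    intro r hr
    have hr1 : 1 ≤ r := (le_max_left _ _).trans hr
    have hr0 : 0 < r := by linarith
    have hε : r⁻¹ ∈ Ioc 0 u₀ := ⟨inv_pos.2 hr0, inv_le_of_inv_le₀ hu₀ ((le_max_right _ _).trans hr)⟩
    have hCr : 0 ≤ C * r⁻¹ := mul_nonneg hC hε.1.le
    -- The hitting time stays below a fixed `N` while the outer radius grows. The bound does not
    -- involve `N`, so it passes to the increasing union over `N`.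
    have hT : ∀ N : ℕ, volume (reachAngles α x i r N) ≤
        ENNReal.ofReal (Real.exp (C * r⁻¹) * (12 * M * w + 2 * (C * r⁻¹))) := by
      intro N
      refine (ENNReal.le_ofReal_iff_toReal_le (volume_angles_ne_top _) (by positivity)).2 ?_
      refine volume_reachAngles_le hα hM0 hM1 hM hr1 (by positivity) (Real.one_le_exp hCr)
        (by positivity) fun r' hr' => ?_
      obtain ⟨h, h1, h2, h3⟩ := htr r⁻¹ hε r r' (by rw [inv_inv]) (by rwa [inv_inv])
      refine volume_le_of_angle_transport (P := fun θ => ∃ t ≤ (N : ℝ),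
        ReachesIn α x i (circlePoint r θ) t) (Q := fun θ => ∃ t ≤ (N : ℝ) + r' ^ 2,
        ReachesIn α x i (circlePoint r' θ) t) hCr h1 h2 fun θ hθ ⟨t, htN, ht⟩ => ?_
      obtain ⟨T', hT', h4⟩ := h3 θ hθ i t ht
      exact ⟨T', by linarith, h4⟩
    have hunion : {θ | θ ∈ Ico 0 (2 * Real.pi) ∧ AttachesTo α x i (circlePoint r θ)} =
        ⋃ N : ℕ, reachAngles α x i r N := by
      ext θ
      simp only [mem_ofPred_eq, mem_iUnion, reachAngles]
      constructor
      · rintro ⟨hθ, hatt⟩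
        obtain ⟨t, ht⟩ := (attachesTo_iff hα).1 hatt
        obtain ⟨N, hN⟩ := exists_nat_ge t
        exact ⟨N, hθ, t, hN, ht⟩
      · rintro ⟨N, hθ, t, -, ht⟩
        exact ⟨hθ, (attachesTo_iff hα).2 ⟨t, ht⟩⟩
    have hmono : Monotone fun N : ℕ => reachAngles α x i r N := fun N N' hN θ hθ => by
      obtain ⟨hm, t, ht, hreach⟩ := hθ
      exact ⟨hm, t, ht.trans (by exact_mod_cast hN), hreach⟩
    have hle : volume {θ | θ ∈ Ico 0 (2 * Real.pi) ∧ AttachesTo α x i (circlePoint r θ)} ≤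
        ENNReal.ofReal (Real.exp (C * r⁻¹) * (12 * M * w + 2 * (C * r⁻¹))) := by
      rw [hunion, hmono.measure_iUnion]
      exact iSup_le hT
    rw [attachProbFrom, div_le_iff₀ (by positivity)]
    refine (ENNReal.toReal_le_of_le_ofReal (by positivity) hle).trans
      (le_mul_of_one_le_right (by positivity) ?_)
    linarith [Real.pi_gt_three]
  have hlim : Tendsto (fun r : ℝ => Real.exp (C * r⁻¹) * (12 * M * w + 2 * (C * r⁻¹))) atTop
      (𝓝 (12 * M * w)) := by
    have h1 : Tendsto (fun r : ℝ => C * r⁻¹) atTop (𝓝 0) := by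
      simpa using tendsto_inv_atTop_zero.const_mul C
    have h2 := ((Real.continuous_exp.tendsto 0).comp h1).mul
      ((h1.const_mul 2).const_add (12 * M * w))
    simpa using! h2
  refine le_of_tendsto_of_tendsto hp hlim ?_
  filter_upwards [eventually_ge_atTop (max 1 u₀⁻¹)] with r hr using hbound r hr

theorem beurling_estimate (hα : 0 ≤ α) (hα1 : α ≤ 1) (hx : IsAggregate x) {p : ℝ}
    (hp : HasAttachProb α x i p) :
    p ≤ 12 * 145 * (volume (Metric.ball (0 : Plane) 1)).toReal *
      (n : ℝ) ^ ((α - 1) / (2 * α + 2)) := by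
  set w := (volume (Metric.ball (0 : Plane) 1)).toReal
  have hw0 : 0 ≤ w := ENNReal.toReal_nonneg
  have hn1 : (1 : ℝ) ≤ n := by exact_mod_cast i.pos
  -- The cap at 1 meets the requirement `M ≤ 1` of the annulus estimate; the drift never exceeds 1
  -- anyway.
  set M := min (145 * (n : ℝ) ^ ((α - 1) / 2)) 1 with hM
  have h1 := hp.le_of_norm_drift_le hα (M := M) (by positivity) (min_le_right _ _)
    fun y hy hyi => le_min (norm_drift_le_of_dist_le_two hα hα1 hx i hy hyi)
      (norm_drift_le_one i.pos hy)
  -- As `α - 1 ≤ 0` and `2 * α + 2 ≥ 2`, the exponent obtained is at most the claimed one.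
  have h2 : (n : ℝ) ^ ((α - 1) / 2) ≤ (n : ℝ) ^ ((α - 1) / (2 * α + 2)) := by
    refine Real.rpow_le_rpow_of_exponent_le hn1 ?_
    rw [div_le_div_iff₀ (by norm_num) (by linarith)]
    nlinarith
  calc p ≤ 12 * M * w := h1
    _ ≤ 12 * (145 * (n : ℝ) ^ ((α - 1) / (2 * α + 2))) * w := by
      gcongr
      exact (min_le_left _ _).trans (by gcongr)
    _ = _ := by ring

end UpperBound

end GFA

namespace GFA

/-! ### Almost every trajectory attaches to some particle. -/

section Absorption

/-- After the last time with `f ≤ a` the function could only decrease, so it cannot end above `a`.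
-/
theorem le_of_hasDerivAt_nonpos_above {f f' : ℝ → ℝ} {a s t : ℝ} (hst : s ≤ t)
    (hf : ∀ u ∈ Icc s t, HasDerivAt f (f' u) u) (h : ∀ u ∈ Icc s t, a < f u → f' u ≤ 0)
    (hs : f s ≤ a) : f t ≤ a := by
  by_contra hlt
  push Not at hlt
  have hc : ContinuousOn f (Icc s t) := fun u hu => (hf u hu).continuousAt.continuousWithinAt
  have Ac : IsCompact (Icc s t ∩ f ⁻¹' Iic a) :=
    isCompact_Icc.of_isClosed_subset (hc.preimage_isClosed_of_isClosed isClosed_Icc isClosed_Iic)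
      inter_subset_left
  obtain ⟨u, ⟨hu, hua⟩, hmax⟩ := Ac.exists_isGreatest ⟨s, ⟨le_rfl, hst⟩, hs⟩
  have sub : Icc u t ⊆ Icc s t := Icc_subset_Icc_left hu.1
  have above : ∀ v ∈ Ioo u t, a < f v := fun v hv => by
    by_contra hle
    push Not at hle
    exact absurd (hmax ⟨sub ⟨hv.1.le, hv.2.le⟩, hle⟩) (not_le.2 hv.1)
  have anti : AntitoneOn f (Icc u t) := by
    refine antitoneOn_of_hasDerivWithinAt_nonpos (convex_Icc u t) (hc.mono sub)
      (fun v hv => (hf v (sub (interior_subset hv))).hasDerivWithinAt) fun v hv => ?_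
    rw [interior_Icc] at hv
    exact h v (sub ⟨hv.1.le, hv.2.le⟩) (above v hv)
  have := anti (left_mem_Icc.2 hu.2) (right_mem_Icc.2 hu.2) hu.2
  exact absurd (this.trans hua) (not_le.2 hlt)

variable {n : ℕ} {α : ℝ} {x : Fin n → Plane} {D : ℝ}

namespace IsCutoffFlow

variable {R : ℝ} {W : Plane → Plane} {φ : ℝ → Plane → Plane}

theorem hasDerivAt_norm_sq (h : IsCutoffFlow α x R W φ) (y : Plane) (t : ℝ) :
    HasDerivAt (fun s => ‖φ s y‖ ^ 2) (2 * inner ℝ (φ t y) (W (φ t y))) t :=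
  (h.isFlow.hasDerivAt t y).norm_sq

theorem inner_nonpos (h : IsCutoffFlow α x R W φ) (hn : 0 < n) (hD : ∀ j, ‖x j‖ ≤ D) {y : Plane}
    (hy : 3 * D < ‖y‖) : inner ℝ y (W y) ≤ 0 := by
  obtain ⟨χ, hχ, hW⟩ := h.exists_eq_smul y
  rw [hW, real_inner_smul_right, real_inner_comm]
  have := inner_drift_le (α := α) hn hD hy
  exact mul_nonpos_of_nonneg_of_nonpos hχ (by linarith)

theorem norm_le_of_le (h : IsCutoffFlow α x R W φ) (hn : 0 < n) (hD : ∀ j, ‖x j‖ ≤ D) {a s t : ℝ}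
    (ha : 3 * D < a) (hst : s ≤ t) {y : Plane} (hs : ‖φ s y‖ ≤ a) : ‖φ t y‖ ≤ a := by
  have hD0 : 0 ≤ D := (norm_nonneg _).trans (hD ⟨0, hn⟩)
  have key : ‖φ t y‖ ^ 2 ≤ a ^ 2 := by
    refine le_of_hasDerivAt_nonpos_above (f := fun s => ‖φ s y‖ ^ 2) hst
      (fun u _ => h.hasDerivAt_norm_sq y u) (fun u _ hu => ?_) ?_
    · have h1 : a < ‖φ u y‖ := lt_of_pow_lt_pow_left₀ 2 (norm_nonneg _) hu
      have := h.inner_nonpos hn hD (ha.trans h1)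
      linarith
    · exact pow_le_pow_left₀ (norm_nonneg _) hs 2
  exact le_of_sq_le_sq key (by linarith)

/-- A trajectory outside radius `a` at time `t` was outside all along, and the unit decay of the
squared norm would then give `t < ‖y‖ ^ 2 ≤ R ^ 2`. -/
theorem norm_le_after (h : IsCutoffFlow α x R W φ) (hn : 0 < n) (hD : ∀ j, ‖x j‖ ≤ D) {a t : ℝ}
    (ha : 3 * D + 1 ≤ a) (hR : 3 * D < R) (ht : R ^ 2 ≤ t) {y : Plane} (hy : ‖y‖ ≤ R) :
    ‖φ t y‖ ≤ a := by
  have hD0 : 0 ≤ D := (norm_nonneg _).trans (hD ⟨0, hn⟩)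
  have ht0 : 0 ≤ t := (sq_nonneg R).trans ht
  have hle : ∀ s, 0 ≤ s → ‖φ s y‖ ≤ R := fun s hs =>
    h.norm_le_of_le hn hD hR hs (by rwa [h.isFlow.zero])
  by_contra hlt
  push Not at hlt
  have hfar : ∀ s ∈ Icc 0 t, a < ‖φ s y‖ := fun s hs => by
    by_contra hsa
    push Not at hsa
    exact absurd (h.norm_le_of_le hn hD (by linarith) hs.2 hsa) (not_le.2 hlt)
  have hd : ∀ s ∈ Icc 0 t, ∀ j, 1 ≤ dist (φ s y) (x j) := fun s hs j => by
    rw [dist_eq_norm]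
    have := norm_sub_norm_le (φ s y) (x j)
    linarith [hfar s hs, hD j]
  have hder : ∀ s ∈ Icc 0 t, HasDerivAt (fun s => ‖φ s y‖ ^ 2 + s)
      (2 * inner ℝ (φ s y) (W (φ s y)) + 1) s := fun s hs =>
    (h.hasDerivAt_norm_sq y s).add (hasDerivAt_id s)
  have anti : AntitoneOn (fun s => ‖φ s y‖ ^ 2 + s) (Icc 0 t) := by
    refine antitoneOn_of_hasDerivWithinAt_nonpos (convex_Icc 0 t)
      (fun s hs => (hder s hs).continuousAt.continuousWithinAt)
      (fun s hs => (hder s (interior_subset hs)).hasDerivWithinAt) fun s hs => ?_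
    have hs' := interior_subset hs
    rw [h.eq_drift (hle s hs'.1) (hd s hs'), real_inner_comm]
    have := inner_drift_le (α := α) hn hD (y := φ s y) (by linarith [hfar s hs'])
    linarith
  have key := anti (left_mem_Icc.2 ht0) (right_mem_Icc.2 ht0) ht0
  simp only [add_zero, h.isFlow.zero] at key
  have h1 : ‖y‖ ^ 2 ≤ R ^ 2 := pow_le_pow_left₀ (norm_nonneg _) hy 2
  have h2 : 0 < ‖φ t y‖ ^ 2 := by
    have := hfar t ⟨ht0, le_rfl⟩
    have : 0 < ‖φ t y‖ := by linarith
    positivity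
  linarith

/-- Almost every point of an annulus around the particles comes close to a particle. -/
theorem volume_never_close_eq_zero (h : IsCutoffFlow α x R W φ) (hα : 0 ≤ α) (hn : 0 < n)
    (hD : ∀ j, ‖x j‖ ≤ D) {r : ℝ} (hr : 3 * D + 2 ≤ r) (hrR : r ≤ R) :
    volume {y | (r ≤ ‖y‖ ∧ ‖y‖ ≤ R) ∧ ∀ t, 0 ≤ t → ∀ j, 1 ≤ dist (φ t y) (x j)} = 0 := by
  obtain ⟨K, hK⟩ := h.exists_lipschitzWith
  set Z : Set Plane := {y | (r ≤ ‖y‖ ∧ ‖y‖ ≤ R) ∧ ∀ t, 0 ≤ t → ∀ j, 1 ≤ dist (φ t y) (x j)} with hZ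
  have hR : 3 * D < R := by linarith
  have Zcl : IsClosed Z := by
    have e : Z = ({y | r ≤ ‖y‖} ∩ {y | ‖y‖ ≤ R}) ∩
        ⋂ t : ℝ, ⋂ (_ : 0 ≤ t), ⋂ j, {y | 1 ≤ dist (φ t y) (x j)} := by
      ext y
      simp [hZ]
    rw [e]
    refine ((isClosed_le continuous_const continuous_norm).inter
      (isClosed_le continuous_norm continuous_const)).inter ?_
    exact isClosed_iInter fun t => isClosed_iInter fun _ => isClosed_iInter fun j =>
      isClosed_le continuous_const ((h.isFlow.continuous hK t).dist continuous_const)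
  have Zball : ∀ y ∈ Z, ∀ t, 0 ≤ t → ‖φ t y‖ ≤ R := fun y hy t ht =>
    h.norm_le_of_le hn hD hR ht (by rw [h.isFlow.zero]; exact hy.1.2)
  have Zc : IsCompact Z := (isCompact_closedBall (0 : Plane) R).of_isClosed_subset Zcl fun y hy => by
    rw [mem_closedBall_zero_iff]
    exact hy.1.2
  set τ := R ^ 2 with hτ
  have hτ0 : 0 ≤ τ := sq_nonneg R
  set Zk : ℕ → Set Plane := fun k => φ (k * τ) '' Z with hZk
  have Zkm : ∀ k, MeasurableSet (Zk k) := fun k =>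
    (Zc.image (h.isFlow.continuous hK _)).measurableSet
  have Zkle : ∀ k, volume Z ≤ volume (Zk k) := fun k =>
    volume_le_volume_flow_image h.contDiff h.hasCompactSupport h.isFlow (by positivity)
      fun y hy s hs => h.trace_nonneg hα hn (Zball y hy s hs.1) (hy.2 s hs.1)
  -- After time `τ = R ^ 2` the flow is inside radius `r - 1` and so never back in `Z`. Infinitely
  -- many disjoint images, none of smaller area than `Z`, lie in one ball, which forces area zero.
  have Zkdisj : ∀ k l : ℕ, k < l → Disjoint (Zk k) (Zk l) := by
    intro k l hkl
    rw [Set.disjoint_left]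
    rintro _ ⟨a, ha, rfl⟩ ⟨b, hb, hab⟩
    have h1 : a = φ ((l - k : ℝ) * τ) b := by
      have h2 : φ (-(k * τ)) (φ (l * τ) b) = φ (-(k * τ)) (φ (k * τ) a) := by rw [hab]
      rw [h.isFlow.neg_apply hK, ← h.isFlow.add hK] at h2
      rw [← h2]
      congr 1
      ring
    have hkl' : (k : ℝ) + 1 ≤ l := by exact_mod_cast hkl
    have h2 := h.norm_le_after hn hD (a := r - 1) (t := (l - k : ℝ) * τ) (by linarith) hR
      (by nlinarith) hb.1.2
    rw [← h1] at h2
    linarith [ha.1.1]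
  have Zkpair : Pairwise (Function.onFun Disjoint Zk) := fun k l hkl => by
    rcases lt_or_gt_of_ne hkl with h1 | h1
    · exact Zkdisj k l h1
    · exact (Zkdisj l k h1).symm
  by_contra hne
  have htop : volume (⋃ k, Zk k) = ⊤ := by
    rw [measure_iUnion Zkpair Zkm]
    refine top_le_iff.1 ?_
    rw [← ENNReal.tsum_const_eq_top_of_ne_zero (α := ℕ) hne]
    exact ENNReal.tsum_le_tsum Zkle
  have hlt : volume (⋃ k, Zk k) < ⊤ := by
    refine (measure_mono (iUnion_subset fun k => ?_)).trans_lt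
      (measure_closedBall_lt_top (x := (0 : Plane)) (r := R))
    rintro _ ⟨y, hy, rfl⟩
    rw [mem_closedBall_zero_iff]
    exact Zball y hy _ (by positivity)
  exact hlt.ne htop

/-- At the first time some distance is at most 1, the intermediate value theorem shows that none is
below 1, so the flow attaches there. -/
theorem never_close_of_not_attachesTo (h : IsCutoffFlow α x R W φ) (hα : 0 ≤ α) (hn : 0 < n)
    (hD : ∀ j, ‖x j‖ ≤ D) {y : Plane} (hy : 3 * D + 2 ≤ ‖y‖) (hyR : ‖y‖ ≤ R)
    (hna : ∀ i, ¬ AttachesTo α x i y) {t : ℝ} (ht : 0 ≤ t) (j : Fin n) :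
    1 ≤ dist (φ t y) (x j) := by
  by_contra hlt
  push Not at hlt
  have hc : ∀ j, Continuous fun s => dist (φ s y) (x j) := fun j =>
    (h.isFlow.continuous_apply y).dist continuous_const
  have hD0 : 0 ≤ D := (norm_nonneg _).trans (hD ⟨0, hn⟩)
  have h0 : ∀ j, 1 < dist (φ 0 y) (x j) := fun j => by
    rw [h.isFlow.zero, dist_eq_norm]
    have := norm_sub_norm_le y (x j)
    linarith [hD j]
  have Acl : IsClosed {s | ∃ j, dist (φ s y) (x j) ≤ 1} := by
    have e : {s | ∃ j, dist (φ s y) (x j) ≤ 1} = ⋃ j, {s | dist (φ s y) (x j) ≤ 1} := by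
      ext s
      simp
    rw [e]
    exact isClosed_iUnion_of_finite fun j => isClosed_le (hc j) continuous_const
  obtain ⟨T, ⟨hT, i, hi⟩, hmin⟩ := (isCompact_Icc.inter_right Acl).exists_isLeast
    (⟨t, ⟨ht, le_rfl⟩, j, hlt.le⟩ : (Icc 0 t ∩ {s | ∃ j, dist (φ s y) (x j) ≤ 1}).Nonempty)
  have hbefore : ∀ s ∈ Ico 0 T, ∀ j, 1 < dist (φ s y) (x j) := fun s hs j => by
    by_contra hle
    push Not at hle
    exact absurd (hmin ⟨⟨hs.1, hs.2.le.trans hT.2⟩, j, hle⟩) (not_le.2 hs.2)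
  have hat : ∀ j, 1 ≤ dist (φ T y) (x j) := fun j => by
    by_contra hj
    push Not at hj
    obtain ⟨s, hs, hs1⟩ := intermediate_value_Icc' hT.1 (hc j).continuousOn ⟨hj.le, (h0 j).le⟩
    have hTs : T ≤ s := hmin ⟨⟨hs.1, hs.2.trans hT.2⟩, j, hs1.le⟩
    have : s = T := le_antisymm hs.2 hTs
    rw [this] at hs1
    exact hj.ne hs1
  refine hna i ((attachesTo_iff hα).2 ⟨T, h.reachesIn hT.1 (fun s hs => ?_) hbefore hat
    (le_antisymm hi (hat i))⟩)
  exact h.norm_le_of_le hn hD (by linarith) hs.1 (by rwa [h.isFlow.zero])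

end IsCutoffFlow

/-- A null set in the annulus between `r` and `2 r` gives a good circle somewhere in it, not on
every radius. Arbitrarily large good radii suffice, since the limits are known to exist. -/
theorem frequently_volume_not_attachesTo_le (hα : 0 ≤ α) (hn : 0 < n) (x : Fin n → Plane) {c : ℝ}
    (hc : 0 < c) : ∃ᶠ r in atTop, volume {θ | θ ∈ Ico 0 (2 * Real.pi) ∧
      ∀ i, ¬ AttachesTo α x i (circlePoint r θ)} ≤ ENNReal.ofReal c := by
  obtain ⟨D, hD⟩ : ∃ D, ∀ j, ‖x j‖ ≤ D :=
    ⟨∑ j, ‖x j‖, fun j => Finset.single_le_sum (f := fun j => ‖x j‖) (fun _ _ => norm_nonneg _)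
      (Finset.mem_univ j)⟩
  have hD0 : 0 ≤ D := (norm_nonneg _).trans (hD ⟨0, hn⟩)
  refine frequently_atTop.2 fun r₀ => ?_
  set r := max r₀ (3 * D + 2) with hr
  have hr2 : 3 * D + 2 ≤ r := le_max_right _ _
  by_contra hcon
  push Not at hcon
  obtain ⟨W, φ, h⟩ := exists_isCutoffFlow α x hn (2 * r)
  have hnull := h.volume_never_close_eq_zero hα hn hD hr2 (by linarith)
  have key := le_volume_of_le_volume_angles (a := r) (b := 2 * r) (by linarith) (by linarith) hc.le
    (S := {y | (r ≤ ‖y‖ ∧ ‖y‖ ≤ 2 * r) ∧ ∀ t, 0 ≤ t → ∀ j, 1 ≤ dist (φ t y) (x j)})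
    fun ρ hρ => by
      refine (hcon ρ ((le_max_left _ _).trans hρ.1)).le.trans (measure_mono fun θ hθ => ⟨hθ.1, ?_⟩)
      have hnorm := norm_circlePoint (r := ρ) (by linarith [hρ.1]) θ
      refine ⟨by rw [hnorm]; exact hρ, fun t ht j => ?_⟩
      exact h.never_close_of_not_attachesTo hα hn hD (by rw [hnorm]; linarith [hρ.1])
        (by rw [hnorm]; exact hρ.2) hθ.2 ht j
  rw [hnull, nonpos_iff_eq_zero, ENNReal.ofReal_eq_zero] at key
  have : 0 < c * (((2 * r) ^ 2 - r ^ 2) / 2) := by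
    have : 0 < r := by linarith
    have : 0 < (2 * r) ^ 2 - r ^ 2 := by nlinarith
    positivity
  linarith

/-- The attachment probabilities of the particles add up to at least `1`. -/
theorem one_le_sum_of_hasAttachProb (hα : 0 ≤ α) (hn : 0 < n) {p : Fin n → ℝ}
    (hp : ∀ i, HasAttachProb α x i (p i)) : 1 ≤ ∑ i, p i := by
  have hlim : Tendsto (fun r => ∑ i, attachProbFrom α x i r) atTop (𝓝 (∑ i, p i)) :=
    tendsto_finsetSum _ fun i _ => hp i
  refine le_of_forall_pos_le_add fun c hc => ?_
  suffices hh : 1 - c ≤ ∑ i, p i by linarith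
  refine ge_of_tendsto_of_frequently hlim ?_
  refine (frequently_volume_not_attachesTo_le hα hn x hc).mono fun r hr => ?_
  set N := {θ | θ ∈ Ico 0 (2 * Real.pi) ∧ ∀ i, ¬ AttachesTo α x i (circlePoint r θ)}
  set A : Fin n → Set ℝ := fun i =>
    {θ | θ ∈ Ico 0 (2 * Real.pi) ∧ AttachesTo α x i (circlePoint r θ)} with hA
  have Afin : ∀ i, volume (A i) ≠ ⊤ := fun i => volume_angles_ne_top _
  have hsub : Ico 0 (2 * Real.pi) ⊆ N ∪ ⋃ i, A i := by
    intro θ hθ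
    by_cases hcase : ∃ i, AttachesTo α x i (circlePoint r θ)
    · obtain ⟨i, hi⟩ := hcase
      exact Or.inr (mem_iUnion.2 ⟨i, hθ, hi⟩)
    · exact Or.inl ⟨hθ, not_exists.1 hcase⟩
  have h1 : ENNReal.ofReal (2 * Real.pi) ≤ ENNReal.ofReal c + ∑ i, volume (A i) := by
    calc ENNReal.ofReal (2 * Real.pi) = volume (Ico 0 (2 * Real.pi)) := by
          rw [Real.volume_Ico, sub_zero]
      _ ≤ volume N + volume (⋃ i, A i) := (measure_mono hsub).trans (measure_union_le _ _)
      _ ≤ ENNReal.ofReal c + ∑ i, volume (A i) := by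
          gcongr
          exact measure_iUnion_fintype_le _ _
  have hfin : ∑ i, volume (A i) ≠ ⊤ := ENNReal.sum_ne_top.2 fun i _ => Afin i
  have h2 := ENNReal.toReal_mono (ENNReal.add_ne_top.2 ⟨ENNReal.ofReal_ne_top, hfin⟩) h1
  rw [ENNReal.toReal_ofReal (by positivity), ENNReal.toReal_add ENNReal.ofReal_ne_top hfin,
    ENNReal.toReal_ofReal hc.le, ENNReal.toReal_sum fun i _ => Afin i] at h2
  have h3 : ∑ i, attachProbFrom α x i r = (∑ i, (volume (A i)).toReal) / (2 * Real.pi) := by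
    rw [Finset.sum_div]
    rfl
  rw [h3, le_div_iff₀ (by positivity)]
  nlinarith [Real.pi_gt_three]

end Absorption

end GFA

namespace GFA

/-! ### Property (P) for the logarithmic energy. -/

section LogarithmicCriticalPoints

variable {n : ℕ}

/-- A point of the plane as a complex number. -/
noncomputable def toComplex (y : Plane) : ℂ := ⟨y 0, y 1⟩

theorem toComplex_injective : Function.Injective toComplex := by
  intro y z h
  have h0 := congrArg Complex.re h
  have h1 := congrArg Complex.im h
  ext k
  fin_cases k
  · exact h0
  · exact h1

theorem normSq_toComplex (y : Plane) : Complex.normSq (toComplex y) = ‖y‖ ^ 2 := by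
  rw [EuclideanSpace.norm_sq_eq, Fin.sum_univ_two, Complex.normSq_apply]
  simp [toComplex, sq]

/-- Since `w⁻¹` is the conjugate of `w` over `|w|²`, the sum is minus the conjugate of `pull 0 x y`.
-/
theorem sum_inv_eq_zero_of_pull_eq_zero {x : Fin n → Plane} {y : Plane} (h : pull 0 x y = 0) :
    ∑ j, (toComplex y - toComplex (x j))⁻¹ = 0 := by
  have hterm : ∀ j, (toComplex y - toComplex (x j))⁻¹ =
      ⟨-(‖y - x j‖ ^ (-(0 + 2) : ℝ) • (x j - y)) 0, (‖y - x j‖ ^ (-(0 + 2) : ℝ) • (x j - y)) 1⟩ := by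
    intro j
    have h1 : toComplex y - toComplex (x j) = toComplex (y - x j) := by
      apply Complex.ext <;> simp [toComplex]
    have h2 : ‖y - x j‖ ^ (-(0 + 2) : ℝ) = (‖y - x j‖ ^ 2)⁻¹ := by
      rw [zero_add, Real.rpow_neg (norm_nonneg _)]
      norm_num
    rw [h1, h2]
    apply Complex.ext
    · rw [Complex.inv_re, normSq_toComplex]
      simp [toComplex]
      ring
    · rw [Complex.inv_im, normSq_toComplex]
      simp [toComplex]
      ring
  have hc : ∀ k, ∑ j, (‖y - x j‖ ^ (-(0 + 2) : ℝ) • (x j - y)) k = 0 := fun k => by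
    have := congrArg (fun z : Plane => z k) h
    simpa [pull] using this
  apply Complex.ext
  · rw [Complex.re_sum, Finset.sum_congr rfl fun j _ => congrArg Complex.re (hterm j),
      Finset.sum_neg_distrib, hc 0]
    simp
  · rw [Complex.im_sum, Finset.sum_congr rfl fun j _ => congrArg Complex.im (hterm j), hc 1]
    rfl

/-- The logarithmic energy has finitely many critical points. -/
theorem propertyP_zero (hn : 0 < n) (x : Fin n → Plane) : PropertyP 0 x := by
  -- `P' / P` is the sum of the `(z - z j)⁻¹`, so critical points are roots of `P'`, which is
  -- nonzero because `P` has degree `n > 0`.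
  set P : Polynomial ℂ := ∏ j, (Polynomial.X - Polynomial.C (toComplex (x j))) with hP
  have hdeg : P.natDegree = n := by
    rw [hP, Polynomial.natDegree_finsetProd_X_sub_C_eq_card]
    simp
  have hder : Polynomial.derivative P ≠ 0 := fun h => by
    have := Polynomial.derivative_eq_zero.1 h
    omega
  refine Set.Finite.of_finite_image (f := toComplex) ?_ toComplex_injective.injOn
  refine (Polynomial.derivative P).roots.toFinset.finite_toSet.subset ?_
  rintro _ ⟨y, ⟨hy, hgrad⟩, rfl⟩
  rw [(hasGradientAt_energy hy).gradient, if_pos rfl, one_smul] at hgrad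
  have hne : ∀ j ∈ Finset.univ, toComplex y - toComplex (x j) ≠ 0 := fun j _ =>
    sub_ne_zero.2 (toComplex_injective.ne (hy j))
  rw [Finset.mem_coe, Multiset.mem_toFinset, Polynomial.mem_roots hder, Polynomial.IsRoot, hP,
    Polynomial.derivative_prod_finset, Polynomial.eval_finsetSum]
  have key : ∀ j ∈ Finset.univ, Polynomial.eval (toComplex y)
      ((∏ k ∈ Finset.univ.erase j, (Polynomial.X - Polynomial.C (toComplex (x k)))) *
        Polynomial.derivative (Polynomial.X - Polynomial.C (toComplex (x j)))) =
      (∏ k, (toComplex y - toComplex (x k))) * (toComplex y - toComplex (x j))⁻¹ := by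
    intro j hj
    rw [Polynomial.derivative_X_sub_C, mul_one, Polynomial.eval_prod,
      ← Finset.prod_erase_mul _ _ hj, mul_assoc, mul_inv_cancel₀ (hne j hj), mul_one]
    simp
  rw [Finset.sum_congr rfl key, ← Finset.mul_sum, sum_inv_eq_zero_of_pull_eq_zero hgrad, mul_zero]

end LogarithmicCriticalPoints

/-! ### A square lattice block as the extremal example. -/

section Lattice

/-- The first points of the square lattice in the rows of length `m`. -/
noncomputable def latticePoint (m k : ℕ) : Plane := !₂[((k % m : ℕ) : ℝ), ((k / m : ℕ) : ℝ)]

theorem dist_latticePoint_sq (q : Plane) (m k : ℕ) :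
    dist q (latticePoint m k) ^ 2 = (q 0 - (k % m : ℕ)) ^ 2 + (q 1 - (k / m : ℕ)) ^ 2 := by
  rw [dist_eq_norm, EuclideanSpace.norm_sq_eq, Fin.sum_univ_two]
  simp [latticePoint]

theorem one_le_dist_latticePoint {m j k : ℕ} (h : j ≠ k) :
    1 ≤ dist (latticePoint m j) (latticePoint m k) := by
  have hsq := dist_latticePoint_sq (latticePoint m j) m k
  have hcast : dist (latticePoint m j) (latticePoint m k) ^ 2 =
      (((((j % m : ℕ) : ℤ) - (k % m : ℕ)) ^ 2 + (((j / m : ℕ) : ℤ) - (k / m : ℕ)) ^ 2 : ℤ) : ℝ) := by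
    rw [hsq]
    simp only [Int.cast_add, Int.cast_pow, Int.cast_sub, Int.cast_natCast]
    rfl
  have hpos : (0 : ℤ) < (((j % m : ℕ) : ℤ) - (k % m : ℕ)) ^ 2 +
      (((j / m : ℕ) : ℤ) - (k / m : ℕ)) ^ 2 := by
    by_contra hle
    have s1 := sq_nonneg (((j % m : ℕ) : ℤ) - (k % m : ℕ))
    have s2 := sq_nonneg (((j / m : ℕ) : ℤ) - (k / m : ℕ))
    have h1 : ((j % m : ℕ) : ℤ) - (k % m : ℕ) = 0 := sq_eq_zero_iff.1 (by linarith)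
    have h2 : ((j / m : ℕ) : ℤ) - (k / m : ℕ) = 0 := sq_eq_zero_iff.1 (by linarith)
    apply h
    rw [← Nat.mod_add_div j m, ← Nat.mod_add_div k m]
    have h3 : j % m = k % m := by omega
    have h4 : j / m = k / m := by omega
    rw [h3, h4]
  have h1 : (1 : ℝ) ≤ dist (latticePoint m j) (latticePoint m k) ^ 2 := by
    rw [hcast]
    exact_mod_cast hpos
  exact (one_le_sq_iff₀ dist_nonneg).1 h1

theorem add_self_mod_div {m : ℕ} (hm : 0 < m) (k : ℕ) :
    (k + m) % m = k % m ∧ (k + m) / m = k / m + 1 :=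
  ⟨Nat.add_mod_right k m, Nat.add_div_right k hm⟩

theorem succ_mod_div {m k : ℕ} (h : k % m + 1 < m) :
    (k + 1) % m = k % m + 1 ∧ (k + 1) / m = k / m := by
  have hm : 0 < m := by omega
  have h1 : k + 1 = (k % m + 1) + m * (k / m) := by
    have := Nat.mod_add_div k m
    omega
  constructor
  · conv_lhs => rw [h1]
    rw [Nat.add_mul_mod_self_left, Nat.mod_eq_of_lt h]
  · conv_lhs => rw [h1]
    rw [Nat.add_mul_div_left _ _ hm, Nat.div_eq_of_lt h, zero_add]

theorem pred_mod_div {m k : ℕ} (hm : 0 < m) (h : k % m ≠ 0) :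
    (k - 1) % m + 1 = k % m ∧ (k - 1) / m = k / m := by
  have hk : k ≠ 0 := fun h0 => h (by rw [h0, Nat.zero_mod])
  have hlt := Nat.mod_lt k hm
  have h1 : k - 1 = (k % m - 1) + m * (k / m) := by
    have := Nat.mod_add_div k m
    omega
  have h2 : k % m - 1 < m := by omega
  constructor
  · conv_lhs => rw [h1]
    rw [Nat.add_mul_mod_self_left, Nat.mod_eq_of_lt h2]
    omega
  · conv_lhs => rw [h1]
    rw [Nat.add_mul_div_left _ _ hm, Nat.div_eq_of_lt h2, zero_add]

theorem sub_self_mod_div {m k : ℕ} (hm : 0 < m) (h : m ≤ k) :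
    (k - m) % m = k % m ∧ (k - m) / m + 1 = k / m := by
  have := add_self_mod_div hm (k - m)
  rw [Nat.sub_add_cancel h] at this
  exact ⟨this.1.symm, this.2.symm⟩

theorem isAggregate_latticePoint {m : ℕ} (hm : 0 < m) (n : ℕ) :
    IsAggregate fun k : Fin n => latticePoint m k where
  separated j k h := one_le_dist_latticePoint fun h0 => h (Fin.ext h0)
  attached k hk := by
    have hone : ∀ j : ℕ, dist (latticePoint m k) (latticePoint m j) ^ 2 = 1 →
        dist (latticePoint m k) (latticePoint m j) = 1 := fun j hj =>
      (pow_eq_one_iff_of_nonneg dist_nonneg two_ne_zero).1 hj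
    by_cases h : (k : ℕ) % m = 0
    · have hmk : m ≤ k := Nat.le_of_dvd hk (Nat.dvd_of_mod_eq_zero h)
      obtain ⟨h1, h2⟩ := sub_self_mod_div hm hmk
      refine ⟨⟨k - m, by omega⟩, Fin.lt_def.2 (by change (k : ℕ) - m < k; omega), hone _ ?_⟩
      rw [dist_latticePoint_sq]
      simp [latticePoint, h1, ← h2]
    · obtain ⟨h1, h2⟩ := pred_mod_div hm h
      refine ⟨⟨k - 1, by omega⟩, Fin.lt_def.2 (by change (k : ℕ) - 1 < k; omega), hone _ ?_⟩
      rw [dist_latticePoint_sq]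
      simp [latticePoint, ← h1, h2]

/-- A point at distance 1 from the particle but at least 1 from its four neighbours has both
relative coordinates in `[-1/2, 1/2]`, so its squared distance is at most `1 / 2`. -/
theorem not_attachesTo_of_interior {α : ℝ} {m n : ℕ} (k : Fin n) (hm : 0 < m) (h1 : (k : ℕ) % m ≠ 0)
    (h2 : (k : ℕ) % m + 1 < m) (h3 : m ≤ k) (h4 : k + m < n) (y : Plane) :
    ¬ AttachesTo α (fun k : Fin n => latticePoint m k) k y := by
  rintro ⟨T, γ, -, -, -, -, hge, heq⟩
  set q := γ T
  have hge' : ∀ j : ℕ, j < n → 1 ≤ (q 0 - (j % m : ℕ)) ^ 2 + (q 1 - (j / m : ℕ)) ^ 2 := by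
    intro j hj
    rw [← dist_latticePoint_sq]
    exact one_le_pow₀ (hge ⟨j, hj⟩)
  have hk0 : (k : ℕ) ≠ 0 := fun h0 => h1 (by rw [h0, Nat.zero_mod])
  have heq' : (q 0 - ((k : ℕ) % m : ℕ)) ^ 2 + (q 1 - ((k : ℕ) / m : ℕ)) ^ 2 = 1 := by
    rw [← dist_latticePoint_sq, heq, one_pow]
  have e1 := hge' (k + 1) (by omega)
  have e2 := hge' (k - 1) (by omega)
  have e3 := hge' (k + m) h4
  have e4 := hge' (k - m) (by omega)
  obtain ⟨a1, b1⟩ := succ_mod_div h2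
  obtain ⟨a2, b2⟩ := pred_mod_div hm h1
  obtain ⟨a3, b3⟩ := add_self_mod_div hm k
  obtain ⟨a4, b4⟩ := sub_self_mod_div hm h3
  rw [a1, b1] at e1
  rw [a3, b3] at e3
  have a2' : (((k - 1 : ℕ) % m : ℕ) : ℝ) = ((k : ℕ) % m : ℕ) - 1 := by
    rw [← a2]
    push_cast
    ring
  have b4' : (((k - m : ℕ) / m : ℕ) : ℝ) = ((k : ℕ) / m : ℕ) - 1 := by
    rw [← b4]
    push_cast
    ring
  rw [a2', b2] at e2
  rw [a4, b4'] at e4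
  push_cast at e1 e3
  set a := q 0 - (((k : ℕ) % m : ℕ) : ℝ) with ha
  set b := q 1 - (((k : ℕ) / m : ℕ) : ℝ) with hb
  have f1 : a ≤ 1 / 2 := by nlinarith
  have f2 : -(1 / 2) ≤ a := by nlinarith
  have f3 : b ≤ 1 / 2 := by nlinarith
  have f4 : -(1 / 2) ≤ b := by nlinarith
  nlinarith

theorem HasAttachProb.eq_zero_of_not_attachesTo {α : ℝ} {n : ℕ} {x : Fin n → Plane} {i : Fin n}
    {p : ℝ} (hp : HasAttachProb α x i p) (h : ∀ y, ¬ AttachesTo α x i y) : p = 0 := by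
  refine tendsto_nhds_unique hp (tendsto_const_nhds.congr fun r => ?_)
  simp [attachProbFrom, h]

/-- Some particle of a square lattice catches the new particle with probability at least the
inverse of the number of the particles on the boundary. -/
theorem exists_hasAttachProb_latticePoint {α : ℝ} (hα : 0 ≤ α) {m n : ℕ} (hm : 0 < m) (hn : 0 < n)
    (hnm : n ≤ m * m) : ∃ (i : Fin n) (p : ℝ),
      HasAttachProb α (fun k : Fin n => latticePoint m k) i p ∧ 1 / (4 * m : ℝ) ≤ p := by
  choose p hp using exists_hasAttachProb hα (fun k : Fin n => latticePoint m k)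
  by_contra hcon
  push Not at hcon
  have hlt : ∀ i, p i < 1 / (4 * m : ℝ) := fun i => hcon i (p i) (hp i)
  have hm' : (0 : ℝ) < m := by exact_mod_cast hm
  -- The two outer columns, the first row and the last `m` indices. Each has at most `m` members, as
  -- `n ≤ m * m` leaves at most `m` rows; all other particles have four neighbours.
  set B : Finset (Fin n) := Finset.univ.filter fun k =>
    (k : ℕ) % m = 0 ∨ (k : ℕ) % m + 1 = m ∨ (k : ℕ) < m ∨ n ≤ k + m with hB
  have hcard : B.card ≤ 4 * m := by
    have hsub : B.image Fin.val ⊆ (((Finset.range m).image fun a => m * a) ∪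
        (Finset.range m).image fun a => m - 1 + m * a) ∪
        (Finset.range m ∪ (Finset.range m).image fun a => n - 1 - a) := by
      intro k hk
      obtain ⟨k, hkB, rfl⟩ := Finset.mem_image.1 hk
      have hdiv : (k : ℕ) / m < m := Nat.div_lt_of_lt_mul (k.2.trans_le hnm)
      have hmd := Nat.mod_add_div (k : ℕ) m
      simp only [Finset.mem_union, Finset.mem_image, Finset.mem_range]
      have hkn := k.2
      rcases (Finset.mem_filter.1 hkB).2 with h | h | h | h
      · exact Or.inl (Or.inl ⟨k / m, hdiv, by omega⟩)
      · exact Or.inl (Or.inr ⟨k / m, hdiv, by omega⟩)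
      · exact Or.inr (Or.inl h)
      · exact Or.inr (Or.inr ⟨n - 1 - k, by omega, by omega⟩)
    rw [← Finset.card_image_of_injective B Fin.val_injective]
    have hi : ∀ f : ℕ → ℕ, ((Finset.range m).image f).card ≤ m := fun f =>
      Finset.card_image_le.trans (Finset.card_range m).le
    refine (Finset.card_le_card hsub).trans ?_
    refine (Finset.card_union_le _ _).trans ?_
    have u1 := Finset.card_union_le ((Finset.range m).image fun a => m * a)
      ((Finset.range m).image fun a => m - 1 + m * a)
    have u2 := Finset.card_union_le (Finset.range m) ((Finset.range m).image fun a => n - 1 - a)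
    rw [Finset.card_range] at u2
    have := hi fun a => m * a
    have := hi fun a => m - 1 + m * a
    have := hi fun a => n - 1 - a
    omega
  have hzero : ∀ i, i ∉ B → p i = 0 := fun i hi => by
    refine (hp i).eq_zero_of_not_attachesTo fun y => ?_
    have hi' : ¬ ((i : ℕ) % m = 0 ∨ (i : ℕ) % m + 1 = m ∨ (i : ℕ) < m ∨ n ≤ i + m) := fun h =>
      hi (Finset.mem_filter.2 ⟨Finset.mem_univ _, h⟩)
    have := Nat.mod_lt i hm
    exact not_attachesTo_of_interior i hm (by omega) (by omega) (by omega) (by omega) y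
  have hsum : ∑ i ∈ B, p i = ∑ i, p i :=
    Finset.sum_subset (Finset.subset_univ _) fun i _ hi => hzero i hi
  have hone := one_le_sum_of_hasAttachProb hα hn hp
  rw [← hsum] at hone
  have hne : B.Nonempty := by
    rw [Finset.nonempty_iff_ne_empty]
    intro h
    rw [h, Finset.sum_empty] at hone
    linarith
  have h1 : ∑ i ∈ B, p i < ∑ i ∈ B, 1 / (4 * m : ℝ) := Finset.sum_lt_sum_of_nonempty hne
    fun i _ => hlt i
  rw [Finset.sum_const, nsmul_eq_mul] at h1
  have h2 : (B.card : ℝ) * (1 / (4 * m : ℝ)) ≤ (4 * m : ℝ) * (1 / (4 * m : ℝ)) := by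
    gcongr
    exact_mod_cast hcard
  rw [mul_one_div_cancel (by positivity)] at h2
  linarith

end Lattice

end GFA

theorem theorem2 :
    (∀ α : ℝ, 0 ≤ α → α ≤ 1 → ∃ c : ℝ, 0 < c ∧
      ∀ (n : ℕ) (x : Fin n → GFA.Plane), GFA.IsAggregate x → GFA.PropertyP α x →
        ∀ i : Fin n, ∃ p : ℝ, GFA.HasAttachProb α x i p ∧
          p ≤ c * (n : ℝ) ^ ((α - 1) / (2 * α + 2))) ∧
    (∃ c : ℝ, 0 < c ∧
      ∀ n : ℕ, 1 ≤ n → ∃ x : Fin n → GFA.Plane, GFA.IsAggregate x ∧ GFA.PropertyP 0 x ∧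
        ∃ i : Fin n, ∃ p : ℝ, GFA.HasAttachProb 0 x i p ∧
          c * (n : ℝ) ^ (-(1 / 2) : ℝ) ≤ p) := by
  refine ⟨fun α hα hα1 => ⟨12 * 145 * (volume (Metric.ball (0 : GFA.Plane) 1)).toReal, ?_, ?_⟩,
    1 / 8, by norm_num, fun n hn => ?_⟩
  · have := ENNReal.toReal_pos (Metric.measure_ball_pos volume (0 : GFA.Plane) one_pos).ne'
      measure_ball_lt_top.ne
    positivity
  · intro n x hx _ i
    obtain ⟨p, hp⟩ := GFA.exists_hasAttachProb hα x i
    exact ⟨p, hp, GFA.beurling_estimate hα hα1 hx hp⟩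
  · have hn' : (1 : ℝ) ≤ n := by exact_mod_cast hn
    have hs : 1 ≤ Real.sqrt n := Real.one_le_sqrt.2 hn'
    -- Then `m ≤ √n + 1 ≤ 2 √n`, so `1 / (4 m) ≥ 1 / (8 √n)`; hence the constant `1 / 8`.
    set m := ⌈Real.sqrt n⌉₊ with hm
    have hsm : Real.sqrt n ≤ m := Nat.le_ceil _
    have hms : (m : ℝ) < Real.sqrt n + 1 := Nat.ceil_lt_add_one (Real.sqrt_nonneg _)
    have hm0 : 0 < m := Nat.ceil_pos.2 (by linarith)
    have hnm : n ≤ m * m := by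
      have h1 : (n : ℝ) ≤ m * m := by
        nlinarith [Real.mul_self_sqrt (by linarith : (0 : ℝ) ≤ n)]
      exact_mod_cast h1
    obtain ⟨i, p, hp, hle⟩ := GFA.exists_hasAttachProb_latticePoint le_rfl hm0 hn hnm
    refine ⟨_, GFA.isAggregate_latticePoint hm0 n, GFA.propertyP_zero hn _, i, p, hp, le_trans ?_ hle⟩
    rw [Real.rpow_neg (by linarith), ← Real.sqrt_eq_rpow, ← one_div, one_div_mul_one_div]
    exact one_div_le_one_div_of_le (by positivity) (by linarith)
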